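/- **Conventions.** For a diffeological space $X$, $\Omega^1(X)$ is the space of diffeological differential 1-forms with the functional diffeology, $\Lambda^1_x(X)$ is the quotient of $\Omega^1(X)$ by the forms vanishing at $x$ (those with $\omega(p)(0)=0$ for every plot $p$ with $p(0)=x$), and $\Lambda^1(X)=\bigcup_x\Lambda^1_x(X)$ carries the quotient diffeology from $X\times\Omega^1(X)$. A *pseudo-metric* on a pseudo-bundle $V\to X$ with finite-dimensional fibres is a smooth section $g$ of $V^*\otimes V^*$ whose values are symmetric positive semi-definite forms of rank $\dim V_x^*$ ($V_x^*$ the diffeological dual of the fibre). A *connection* on $V$ is a smooth linear operator $\nabla:C^\infty(X,V)\to C^\infty(X,\Lambda^1(X)\otimes V)$ with $\nabla(hs)=dh\otimes s+h\nabla s$; for a section $t$ of $(\Lambda^1(X))^*$, $\nabla_ts$ is the contraction of $\nabla s$ with $t$; $\nabla$ is *compatible with* $g$ if $d(g(s,t))=g(\nabla s,t)+g(s,\nabla t)$. A *Levi-Civita connection* on $(\Lambda^1(X),g^\Lambda)$ is a connection compatible with $g^\Lambda$ such that, writing $s(h):=g^\Lambda(s,dh)$ and $\nabla_s:=\nabla_{g^\Lambda(s,\cdot)}$,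 one has $(\nabla_ss'-\nabla_{s'}s)(h)=s(s'(h))-s'(s(h))$ for all smooth sections $s,s'$ of $\Lambda^1(X)$ and smooth functions $h$. The algebra $C\ell(\Lambda^1(X),g^\Lambda)$ has fibre relations $vw+wv=-2g^\Lambda(v,w)$. *Dirac data* on $X$ consist of a pseudo-metric $g^\Lambda$ on $\Lambda^1(X)$ (assumed to have finite-dimensional fibres), a Levi-Civita connection $\nabla^\Lambda$ for it, a finite-dimensional diffeological vector pseudo-bundle $E\to X$ with a smooth action $c$ of $C\ell(\Lambda^1(X),g^\Lambda)$, a pseudo-metric $g$ on $E$, and a connection $\nabla$ on $E$ that is compatible with $g$ and is a Clifford connection: $\nabla_t(c(s)r)=c(\nabla^\Lambda_ts)r+c(s)\nabla_tr$ for all smooth sections $t,s,r$ of $(\Lambda^1(X))^*,\Lambda^1(X),E$. The *Dirac operator* of the data is $D=c\circ\nabla:C^\infty(X,E)\to C^\infty(X,E)$. **Gluing.** Let $X_1,X_2$ be diffeological spaces, $Y\subseteq X_1$ with inclusion $i$, and $f:Y\to X_2$ a diffeomorphism onto its image (subset diffeologies). Let $X_1\cup_fX_2$ be the quotient of $X_1\sqcup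 X_2$ by $y\sim f(y)$, with natural maps $\tilde i_1:X_1\to X_1\cup_fX_2$ and $i_2:X_2\to X_1\cup_fX_2$, and let $\tilde\rho_1,\tilde\rho_2$ be the pullbacks of elements of $\Lambda^1(X_1\cup_fX_2)$ along $\tilde i_1,i_2$. Assume that the pushforward diffeologies on $\Omega^1(Y)$ along $i^*:\Omega^1(X_1)\to\Omega^1(Y)$ and $f^*:\Omega^1(X_2)\to\Omega^1(Y)$ coincide. Let $(g_k^\Lambda,\nabla^{\Lambda,k},E_k,c_k,g_k,\nabla^k)$ be Dirac data on $X_k$ with Dirac operators $D_k$, $k=1,2$, and let $\tilde f'$ be a fibrewise linear diffeomorphism from the restriction of $E_1$ to $Y$ onto the restriction of $E_2$ to $f(Y)$ that covers $f$. Smooth sections $s_1,s_2$ of $E_1,E_2$ are *compatible* if $\tilde f'(s_1(y))=s_2(f(y))$ for all $y\in Y$; then $s_1\cup s_2$ denotes the glued section of $E_1\cup_{\tilde f'}E_2$. Elements $\alpha_1\in\Lambda^1_y(X_1)$, $\alpha_2\in\Lambda^1_{f(y)}(X_2)$ are *compatible* if $i^*\alpha_1=f^*\alpha_2$ in $\Lambda^1_y(Y)$.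 Assume, for all $y\in Y$: 1. $g_1^\Lambda(y)(\alpha_1,\beta_1)=g_2^\Lambda(f(y))(\alpha_2,\beta_2)$ for all compatible pairs $(\alpha_1,\alpha_2)$, $(\beta_1,\beta_2)$; 2. $(i^*\otimes i^*)(\nabla^{\Lambda,1}s_1)(y)=(f^*\otimes f^*)(\nabla^{\Lambda,2}s_2)(f(y))$ for all smooth sections $s_1,s_2$ of $\Lambda^1(X_1),\Lambda^1(X_2)$ that are pointwise compatible over $Y$; 3. $c_2(\tilde\rho_2\alpha)(\tilde f'(e))=\tilde f'(c_1(\tilde\rho_1\alpha)(e))$ for all $\alpha$ in the fibre of $\Lambda^1(X_1\cup_fX_2)$ over $i_2(f(y))$ and all $e\in (E_1)_y$; 4. $g_1(y)(e,e')=g_2(f(y))(\tilde f'(e),\tilde f'(e'))$ for all $e,e'\in (E_1)_y$; 5. $(i^*\otimes\tilde f')(\nabla^1s_1)(y)=(f^*\otimes\mathrm{id})(\nabla^2s_2)(f(y))$ for all compatible smooth sections $s_1,s_2$ of $E_1,E_2$. Define on $X_1\cup_fX_2$ the induced objects as follows. The form $g^\Lambda$ is $g_1^\Lambda(\tilde\rho_1\cdot,\tilde\rho_1\cdot)$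 over $X_1\setminus Y$, $g_2^\Lambda(\tilde\rho_2\cdot,\tilde\rho_2\cdot)$ over $X_2\setminus f(Y)$, and one half of the sum of the two over $f(Y)$. The induced action $\tilde c$ on $E_1\cup_{\tilde f'}E_2$ is $c_1\circ\tilde\rho_1$ over $X_1\setminus Y$ and $c_2\circ\tilde\rho_2$ over $X_2$. The form $\tilde g$ is $g_1$ over $X_1\setminus Y$ and $g_2$ over $X_2$. The operator $\nabla^\cup$ sends a section $s=s_1\cup s_2$ to the section that $\tilde\rho_1\otimes\mathrm{id}$ maps to $\nabla^1s_1$ and $\tilde\rho_2\otimes\mathrm{id}$ maps to $\nabla^2s_2$ (over $f(Y)$ both conditions are imposed, the fibre $(E_1)_y$ being identified with $(E_2)_{f(y)}$ by $\tilde f'$). The operator $\nabla^\Lambda_\cup$ sends $s$ to the section that $\tilde\rho_k\otimes\tilde\rho_k$ maps to $\nabla^{\Lambda,k}s_k$, where $s_1=\tilde\rho_1\circ s\circ\tilde i_1$, $s_2=\tilde\rho_2\circ s\circ i_2$. **Proposition.** Under these assumptions: * $(g^\Lambda,\nabla^\Lambda_\cup,E_1\cup_{\tilde f'}E_2,\tilde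 c,\tilde g,\nabla^\cup)$ are Dirac data on $X_1\cup_fX_2$, so that $\tilde D:=\tilde c\circ\nabla^\cup$ is a Dirac operator; if $c_1$ and $c_2$ are unitary (that is, $g_k(c_k(\alpha)e,c_k(\alpha)e')=g_k(e,e')$ whenever $g^\Lambda_k(\alpha,\alpha)=1$), then so is $\tilde c$. * For every pair of compatible smooth sections $s_1\in C^\infty(X_1,E_1)$, $s_2\in C^\infty(X_2,E_2)$, the section $s_1\cup s_2$ is smooth, the sections $D_1(s_1)$ and $D_2(s_2)$ are smooth and compatible, and $$\tilde D(s_1\cup s_2)=D_1(s_1)\cup D_2(s_2).$$ * Every smooth section of $E_1\cup_{\tilde f'}E_2$ is of the form $s_1\cup s_2$ for compatible smooth sections $s_1,s_2$, which are its restrictions. -/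

import Mathlib

open Diffeology
open scoped Topology ContDiff TensorProduct

universe u v w

noncomputable section

namespace DiffDirac

/-- The Euclidean space on which plots are defined. -/
abbrev Eu (n : ℕ) := EuclideanSpace ℝ (Fin n)

/-! ### Construction of diffeologies -/

theorem exists_smooth_retract {n : ℕ} {U : Set (Eu n)} (hU : IsOpen U) {x : Eu n} (hx : x ∈ U) :
    ∃ r : Eu n → Eu n, ContDiff ℝ ∞ r ∧ (∀ z, r z ∈ U) ∧ r =ᶠ[𝓝 x] id := by
  obtain ⟨ε, hε, hball⟩ := Metric.isOpen_iff.1 hU x hx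
  let χ : ContDiffBump x := ⟨ε / 4, ε / 2, by positivity, by linarith⟩
  refine ⟨fun z => x + χ z • (z - x), ?_, ?_, ?_⟩
  · exact contDiff_const.add (χ.contDiff.smul (contDiff_id.sub contDiff_const))
  · intro z
    apply hball
    rw [Metric.mem_ball, dist_eq_norm, add_sub_cancel_left, norm_smul]
    by_cases hz : dist z x < ε / 2
    · have h1 : ‖χ z‖ ≤ 1 := by
        rw [Real.norm_eq_abs, abs_of_nonneg χ.nonneg]
        exact χ.le_one
      have h2 : ‖z - x‖ < ε / 2 := by rwa [← dist_eq_norm]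
      nlinarith [norm_nonneg (z - x), norm_nonneg (χ z)]
    · have : χ z = 0 := χ.zero_of_le_dist (not_lt.1 hz)
      simp [this, hε]
  · filter_upwards [χ.eventuallyEq_one] with z hz
    simp [hz]

/-- The diffeology whose plots are the maps that locally coincide with a map satisfying `G`. -/
abbrev ofLocal {X : Type u} (G : ∀ n : ℕ, (Eu n → X) → Prop)
    (hc : ∀ n x, G n (fun _ => x))
    (hr : ∀ {n m : ℕ} {p : Eu m → X} {r : Eu n → Eu m}, G m p → ContDiff ℝ ∞ r → G n (p ∘ r)) :
    DiffeologicalSpace X where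
  plots n := {p | ∀ u₀, ∃ q, G n q ∧ p =ᶠ[𝓝 u₀] q}
  constant_plots x _ := ⟨_, hc _ x, Filter.EventuallyEq.rfl⟩
  plot_reparam {n m p r} hp hf u₀ := by
    obtain ⟨q, hq, e⟩ := hp (r u₀)
    exact ⟨q ∘ r, hr hq hf, e.comp_tendsto hf.continuous.continuousAt⟩
  locality {n p} hp u₀ := by
    obtain ⟨U, hU, hx, h⟩ := hp u₀
    obtain ⟨r, hr1, hr2, hr3⟩ := exists_smooth_retract hU hx
    obtain ⟨q, hq, e⟩ := h hr2 hr1 u₀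
    refine ⟨q, hq, ?_⟩
    filter_upwards [e, hr3] with z h1 h2
    simpa [h2] using h1

/-- The subset diffeology. -/
instance instSubset {X : Type u} [DiffeologicalSpace X] (Y : Set X) : DiffeologicalSpace Y where
  plots n := {p | IsPlot fun z => (p z : X)}
  constant_plots _ := isPlot_const
  plot_reparam hp hf := isPlot_reparam hp hf
  locality hp := DiffeologicalSpace.locality (fun x => by
    obtain ⟨U, hU, hx, h⟩ := hp x
    exact ⟨U, hU, hx, fun h1 h2 => h h1 h2⟩)

/-- The pushforward of the diffeology of `A` along a map. -/
abbrev pushforward {A : Type u} {B : Type v} [DiffeologicalSpace A] (φ : A → B) :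
    DiffeologicalSpace B :=
  ofLocal (fun n q => (∃ p : Eu n → A, IsPlot p ∧ q = φ ∘ p) ∨ ∃ x, q = fun _ => x)
    (fun _ x => Or.inr ⟨x, rfl⟩)
    (fun {_ _ _ r} h hr => by
      rcases h with ⟨p, hp, rfl⟩ | ⟨x, rfl⟩
      · exact Or.inl ⟨p ∘ r, isPlot_reparam hp hr, rfl⟩
      · exact Or.inr ⟨x, rfl⟩)

/-! ### Differential 1-forms and the pseudo-bundle of values of 1-forms -/

section Forms

/-- The space of diffeological 1-forms of `X`: assignments of a smooth 1-form on the domain to every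
plot that commute with smooth reparametrisation. -/
def forms (X : Type u) [DiffeologicalSpace X] :
    Submodule ℝ (∀ n : ℕ, {p : Eu n → X // IsPlot p} → Eu n → (Eu n →L[ℝ] ℝ)) where
  carrier := {η | (∀ n p, ContDiff ℝ ∞ (η n p)) ∧
    ∀ (m n : ℕ) (p : {p : Eu n → X // IsPlot p}) (r : Eu m → Eu n) (hr : ContDiff ℝ ∞ r) (z : Eu m),
      η m ⟨p.1 ∘ r, isPlot_reparam p.2 hr⟩ z = (η n p (r z)).comp (fderiv ℝ r z)}
  add_mem' := by
    rintro a b ⟨ha1, ha2⟩ ⟨hb1, hb2⟩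
    refine ⟨fun n p => (ha1 n p).add (hb1 n p), fun m n p r hr z => ?_⟩
    simp only [Pi.add_apply, ha2 m n p r hr z, hb2 m n p r hr z, ContinuousLinearMap.add_comp]
  zero_mem' := ⟨fun n p => contDiff_const, fun m n p r hr z => by simp⟩
  smul_mem' := by
    rintro c a ⟨ha1, ha2⟩
    refine ⟨fun n p => (ha1 n p).const_smul c, fun m n p r hr z => ?_⟩
    simp only [Pi.smul_apply, ha2 m n p r hr z, ContinuousLinearMap.smul_comp]

/-- The type of 1-forms on `X`. -/
def Om (X : Type u) [DiffeologicalSpace X] : Type u := forms X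

instance instOmGroup (X : Type u) [DiffeologicalSpace X] : AddCommGroup (Om X) :=
  inferInstanceAs (AddCommGroup (forms X))

instance instOmModule (X : Type u) [DiffeologicalSpace X] : Module ℝ (Om X) :=
  inferInstanceAs (Module ℝ (forms X))

/-- The functional diffeology on the space of 1-forms. -/
instance instOm (X : Type u) [DiffeologicalSpace X] : DiffeologicalSpace (Om X) where
  plots m := {φ | ∀ (n : ℕ) (p : {p : Eu n → X // IsPlot p}),
    ContDiff ℝ ∞ fun z : Eu m × Eu n => (φ z.1).1 n p z.2}
  constant_plots η n p := (η.2.1 n p).comp contDiff_snd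
  plot_reparam {n m φ r} hp hf k p :=
    (hp k p).comp ((hf.comp contDiff_fst).prodMk contDiff_snd)
  locality {m φ} hp n p := by
    rw [contDiff_iff_contDiffAt]
    intro z
    obtain ⟨U, hU, hx, h⟩ := hp z.1
    obtain ⟨r, hr1, hr2, hr3⟩ := exists_smooth_retract hU hx
    refine ((h hr2 hr1 n p).contDiffAt (x := z)).congr_of_eventuallyEq ?_
    have : ∀ᶠ y : Eu m × Eu n in 𝓝 z, r y.1 = id y.1 :=
      (continuous_fst.tendsto z).eventually hr3
    filter_upwards [this] with y hy
    simp [hy]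

/-- Pullback of 1-forms along a smooth map. -/
def Om.pull {A : Type u} {B : Type v} [DiffeologicalSpace A] [DiffeologicalSpace B]
    (φ : A → B) (hφ : DSmooth φ) : Om B →ₗ[ℝ] Om A where
  toFun η := ⟨fun n p => η.1 n ⟨φ ∘ p.1, hφ n p.1 p.2⟩, fun n _ => η.2.1 n _,
    fun m n p r hr z => η.2.2 m n ⟨φ ∘ p.1, hφ n p.1 p.2⟩ r hr z⟩
  map_add' _ _ := rfl
  map_smul' _ _ := rfl

/-- The 1-forms that vanish at the point `x`. -/
def vanishing {X : Type u} [DiffeologicalSpace X] (x : X) : Submodule ℝ (Om X) where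
  carrier := {η | ∀ (n : ℕ) (p : {p : Eu n → X // IsPlot p}), p.1 0 = x → η.1 n p 0 = 0}
  add_mem' := by
    intro a b ha hb n p hp
    change a.1 n p 0 + b.1 n p 0 = 0
    rw [ha n p hp, hb n p hp, add_zero]
  zero_mem' := fun n p hp => rfl
  smul_mem' := by
    intro c a ha n p hp
    change c • a.1 n p 0 = 0
    rw [ha n p hp, smul_zero]

/-- The fibre at `x` of the pseudo-bundle of values of 1-forms. -/
def Lam (X : Type u) [DiffeologicalSpace X] (x : X) : Type u := Om X ⧸ vanishing x

variable (X : Type u) [DiffeologicalSpace X]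

instance instLamGroup (x : X) : AddCommGroup (Lam X x) :=
  inferInstanceAs (AddCommGroup (Om X ⧸ vanishing x))

instance instLamModule (x : X) : Module ℝ (Lam X x) :=
  inferInstanceAs (Module ℝ (Om X ⧸ vanishing x))

variable {X}

/-- The value of a 1-form at a point. -/
def Lam.mk (x : X) : Om X →ₗ[ℝ] Lam X x := (vanishing x).mkQ

/-- The diffeology on the total space: the quotient of the diffeology of `X × Om X`. -/
instance instLam : DiffeologicalSpace (Σ x, Lam X x) :=
  ofLocal (fun n p => ∃ (b : Eu n → X) (η : Eu n → Om X), IsPlot b ∧ IsPlot η ∧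
      p = fun z => ⟨b z, Lam.mk (b z) (η z)⟩)
    (fun n a => by
      obtain ⟨η, hη⟩ := Submodule.mkQ_surjective (vanishing a.1) a.2
      exact ⟨fun _ => a.1, fun _ => η, isPlot_const, isPlot_const, funext fun _ =>
        Sigma.ext rfl (heq_of_eq hη.symm)⟩)
    (fun {_ _ _ r} h hr => by
      obtain ⟨b, η, hb, hη, rfl⟩ := h
      exact ⟨b ∘ r, η ∘ r, isPlot_reparam hb hr, isPlot_reparam hη hr, rfl⟩)

/-- Pullback of values of 1-forms, from the fibre over `b = φ a` to the fibre over `a`. -/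
def Lam.pull {A : Type u} {B : Type v} [DiffeologicalSpace A] [DiffeologicalSpace B]
    (φ : A → B) (hφ : DSmooth φ) {a : A} {b : B} (h : φ a = b) : Lam B b →ₗ[ℝ] Lam A a :=
  Submodule.mapQ (vanishing b) (vanishing a) (Om.pull φ hφ) (fun η hη n p hp =>
    hη n ⟨φ ∘ p.1, hφ n p.1 p.2⟩ (by simp [hp, h]))

/-- The differential of a smooth function. -/
def dForm (h : X → ℝ) (hh : DSmooth h) : Om X :=
  ⟨fun _ p => fderiv ℝ (h ∘ p.1),
    fun n p => (isPlot_iff_contDiff.1 (hh n p.1 p.2)).fderiv_right (m := ∞) (by simp),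
    fun m n p r hr z => by
      have h1 : ContDiff ℝ ∞ (h ∘ p.1) := isPlot_iff_contDiff.1 (hh n p.1 p.2)
      exact fderiv_comp (𝕜 := ℝ) z (h1.differentiable (by simp) _) (hr.differentiable (by simp) _)⟩

open Classical in
/-- The differential of a smooth function as a section (zero if the function is not smooth). -/
def dSec (h : X → ℝ) (x : X) : Lam X x :=
  if hh : DSmooth h then Lam.mk x (dForm h hh) else 0

end Forms

/-! ### Pseudo-bundles, sections, tensor products, duals, pseudo-metrics -/

section Bundles

variable {X : Type u} [DiffeologicalSpace X]

/-- The map `z ↦ (b z, v z)` is a plot of the total space. -/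
abbrev FPlot (E : X → Type w) [DiffeologicalSpace (Σ x, E x)] {n : ℕ} (b : Eu n → X)
    (v : ∀ z, E (b z)) : Prop :=
  IsPlot fun z => (⟨b z, v z⟩ : Σ x, E x)

/-- Diffeological vector pseudo-bundles, given by their fibres and a diffeology of the total
space. -/
structure IsPseudoBundle (E : X → Type w) [∀ x, AddCommGroup (E x)] [∀ x, Module ℝ (E x)]
    [DiffeologicalSpace (Σ x, E x)] : Prop where
  proj : DSmooth (Sigma.fst : (Σ x, E x) → X)
  zero : DSmooth fun x => (⟨x, 0⟩ : Σ x, E x)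
  add : ∀ (n : ℕ) (b : Eu n → X) (v v' : ∀ z, E (b z)), FPlot E b v → FPlot E b v' →
    FPlot E b fun z => v z + v' z
  smul : ∀ (n : ℕ) (b : Eu n → X) (r : Eu n → ℝ) (v : ∀ z, E (b z)), ContDiff ℝ ∞ r →
    FPlot E b v → FPlot E b fun z => r z • v z

/-- Smooth sections. -/
def IsSmoothSec (E : X → Type w) [DiffeologicalSpace (Σ x, E x)] (s : ∀ x, E x) : Prop :=
  DSmooth fun x => (⟨x, s x⟩ : Σ x, E x)

/-- The plots of the space of smooth sections for its functional diffeology. -/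
def SecPlot (E : X → Type w) [DiffeologicalSpace (Σ x, E x)] {m : ℕ} (q : Eu m → ∀ x, E x) : Prop :=
  ∀ (k : ℕ) (a : Eu k → Eu m) (p : Eu k → X), ContDiff ℝ ∞ a → IsPlot p →
    FPlot E p fun z => q (a z) (p z)

/-- The tensor product of two pseudo-bundles: its plots are locally the finite sums of tensor
products of plots over a common plot of the base. -/
instance instTensor (E : X → Type v) (F : X → Type w)
    [∀ x, AddCommGroup (E x)] [∀ x, Module ℝ (E x)] [DiffeologicalSpace (Σ x, E x)]
    [∀ x, AddCommGroup (F x)] [∀ x, Module ℝ (F x)] [DiffeologicalSpace (Σ x, F x)] :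
    DiffeologicalSpace (Σ x, E x ⊗[ℝ] F x) :=
  ofLocal (fun n p => ∃ (b : Eu n → X) (k : ℕ) (a : Fin k → ∀ z, E (b z))
      (c : Fin k → ∀ z, F (b z)), IsPlot b ∧ (∀ i, FPlot E b (a i)) ∧ (∀ i, FPlot F b (c i)) ∧
      p = fun z => ⟨b z, ∑ i, a i z ⊗ₜ[ℝ] c i z⟩)
    (fun n t => by
      obtain ⟨x, t⟩ := t
      have key : ∃ (k : ℕ) (a : Fin k → E x) (c : Fin k → F x), t = ∑ i, a i ⊗ₜ[ℝ] c i := by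
        induction t with
        | zero => exact ⟨0, Fin.elim0, Fin.elim0, by simp⟩
        | tmul a c => exact ⟨1, fun _ => a, fun _ => c, by simp⟩
        | add t t' h h' =>
          obtain ⟨k, a, c, rfl⟩ := h
          obtain ⟨k', a', c', rfl⟩ := h'
          exact ⟨k + k', Fin.append a a', Fin.append c c', by simp [Fin.sum_univ_add]⟩
      obtain ⟨k, a, c, rfl⟩ := key
      exact ⟨fun _ => x, k, fun i _ => a i, fun i _ => c i, isPlot_const, fun _ => isPlot_const,
        fun _ => isPlot_const, rfl⟩)
    (fun {_ _ _ r} h hr => by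
      obtain ⟨b, k, a, c, hb, ha, hc, rfl⟩ := h
      exact ⟨b ∘ r, k, fun i z => a i (r z), fun i z => c i (r z), isPlot_reparam hb hr,
        fun i => isPlot_reparam (ha i) hr, fun i => isPlot_reparam (hc i) hr, rfl⟩)

variable (E : X → Type w) [∀ x, AddCommGroup (E x)] [∀ x, Module ℝ (E x)]
  [DiffeologicalSpace (Σ x, E x)]

/-- Plots of the dual pseudo-bundle over a plot `b` of the base. -/
def DualPlot {n : ℕ} (b : Eu n → X) (φ : ∀ z, E (b z) →ₗ[ℝ] ℝ) : Prop :=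
  ∀ (m : ℕ) (a : Eu m → Eu n) (v : ∀ z, E (b (a z))), ContDiff ℝ ∞ a →
    FPlot E (fun z => b (a z)) v → ContDiff ℝ ∞ fun z => φ (a z) (v z)

/-- Smooth sections of the dual pseudo-bundle. -/
def IsSmoothDualSec (t : ∀ x, E x →ₗ[ℝ] ℝ) : Prop :=
  ∀ (n : ℕ) (b : Eu n → X), IsPlot b → DualPlot E b fun z => t (b z)

/-- The diffeological dual of a fibre. -/
def smoothDual (x : X) : Submodule ℝ (E x →ₗ[ℝ] ℝ) where
  carrier := {φ | ∀ (n : ℕ) (v : Eu n → E x), FPlot E (fun _ => x) v →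
    ContDiff ℝ ∞ fun z => φ (v z)}
  add_mem' ha hb n v hv := (ha n v hv).add (hb n v hv)
  zero_mem' _ _ _ := contDiff_const
  smul_mem' c _ ha n v hv := (ha n v hv).const_smul c

/-- Pseudo-metrics: smooth sections of the tensor square of the dual pseudo-bundle, each value of
which is a symmetric positive semi-definite form of rank the dimension of the diffeological dual
of the fibre. -/
structure IsPseudoMetric (g : ∀ x, E x →ₗ[ℝ] E x →ₗ[ℝ] ℝ) : Prop where
  symm : ∀ x e e', g x e e' = g x e' e
  nonneg : ∀ x e, 0 ≤ g x e e
  rank : ∀ x, Module.finrank ℝ (LinearMap.ker (g x)) + Module.finrank ℝ (smoothDual E x) =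
    Module.finrank ℝ (E x)
  smooth : ∀ (n : ℕ) (b : Eu n → X), IsPlot b → ∀ u₀, ∃ (k : ℕ)
    (φ ψ : Fin k → ∀ z, E (b z) →ₗ[ℝ] ℝ), (∀ i, DualPlot E b (φ i)) ∧ (∀ i, DualPlot E b (ψ i)) ∧
    ∀ᶠ z in 𝓝 u₀, ∀ e e', g (b z) e e' = ∑ i, φ i z e * ψ i z e'

end Bundles

/-! ### Connections, Clifford actions, Dirac operators -/

section Dirac

variable {X : Type u} [DiffeologicalSpace X]

/-- Operators from sections of `E` to sections of the tensor product of the pseudo-bundle of values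
of 1-forms with `E`. Only the values on smooth sections matter. -/
abbrev Op (E : X → Type w) [∀ x, AddCommGroup (E x)] [∀ x, Module ℝ (E x)] :=
  (∀ x, E x) → ∀ x, Lam X x ⊗[ℝ] E x

variable (E : X → Type w) [∀ x, AddCommGroup (E x)] [∀ x, Module ℝ (E x)]
  [DiffeologicalSpace (Σ x, E x)]

/-- Connections. The last field is smoothness for the functional diffeologies. -/
structure IsConnection (nab : Op E) : Prop where
  smooth_sec : ∀ s, IsSmoothSec E s → IsSmoothSec (fun x => Lam X x ⊗[ℝ] E x) (nab s)
  add : ∀ s s', IsSmoothSec E s → IsSmoothSec E s' → nab (s + s') = nab s + nab s'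
  smul : ∀ (c : ℝ) s, IsSmoothSec E s → nab (c • s) = c • nab s
  leibniz : ∀ (h : X → ℝ) s, DSmooth h → IsSmoothSec E s → ∀ x,
    nab (fun x => h x • s x) x = dSec h x ⊗ₜ[ℝ] s x + h x • nab s x
  smooth : ∀ (m : ℕ) (q : Eu m → ∀ x, E x), SecPlot E q →
    SecPlot (fun x => Lam X x ⊗[ℝ] E x) fun z => nab (q z)

variable {E} in
/-- The contraction of a section with a section of the dual of the pseudo-bundle of values of
1-forms; `covD t (nab s)` is the covariant derivative of `s` along `t`. -/
def covD (t : ∀ x, Lam X x →ₗ[ℝ] ℝ) (σ : ∀ x, Lam X x ⊗[ℝ] E x) (x : X) : E x :=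
  TensorProduct.lid ℝ (E x) (LinearMap.rTensor (E x) (t x) (σ x))

/-- Compatibility of a connection with a pseudo-metric: `d (g(s,t)) = g(∇s,t) + g(s,∇t)`. -/
def IsMetricCompatible (g : ∀ x, E x →ₗ[ℝ] E x →ₗ[ℝ] ℝ) (nab : Op E) : Prop :=
  ∀ s t, IsSmoothSec E s → IsSmoothSec E t → ∀ x,
    dSec (fun x => g x (s x) (t x)) x =
      TensorProduct.rid ℝ (Lam X x) (LinearMap.lTensor (Lam X x) ((g x).flip (t x)) (nab s x)) +
      TensorProduct.rid ℝ (Lam X x) (LinearMap.lTensor (Lam X x) (g x (s x)) (nab t x))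

/-- The derivative of the function `h` along the section `s`, turned into a vector field by `g`. -/
def dirD (g : ∀ x, Lam X x →ₗ[ℝ] Lam X x →ₗ[ℝ] ℝ) (s : ∀ x, Lam X x) (h : X → ℝ) (x : X) : ℝ :=
  g x (s x) (dSec h x)

/-- Vanishing torsion: the vector field dual to `∇_s s' - ∇_s' s` is, as a derivation of the smooth
functions, the commutator of the vector fields dual to `s` and `s'`. -/
def IsSymmetric (g : ∀ x, Lam X x →ₗ[ℝ] Lam X x →ₗ[ℝ] ℝ) (nab : Op (Lam X)) : Prop :=
  ∀ s s', IsSmoothSec (Lam X) s → IsSmoothSec (Lam X) s' → ∀ h : X → ℝ, DSmooth h → ∀ x,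
    g x (covD (fun x => g x (s x)) (nab s') x - covD (fun x => g x (s' x)) (nab s) x) (dSec h x) =
      dirD g s (dirD g s' h) x - dirD g s' (dirD g s h) x

/-- Levi-Civita connections on the pseudo-bundle of values of 1-forms. -/
structure IsLeviCivita (g : ∀ x, Lam X x →ₗ[ℝ] Lam X x →ₗ[ℝ] ℝ) (nab : Op (Lam X)) : Prop where
  conn : IsConnection (Lam X) nab
  metric : IsMetricCompatible (Lam X) g nab
  symm : IsSymmetric g nab

/-- The quadratic form `v ↦ -g(v,v)`, so that `v w + w v = -2 g(v,w)` in the Clifford algebra. -/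
abbrev cliffQ (g : ∀ x, Lam X x →ₗ[ℝ] Lam X x →ₗ[ℝ] ℝ) (x : X) : QuadraticForm ℝ (Lam X x) :=
  -LinearMap.BilinMap.toQuadraticMap (g x)

/-- Plots of the pseudo-bundle of Clifford algebras over a plot `b` of the base: locally smooth
linear combinations of products of plots of the pseudo-bundle of values of 1-forms. -/
def CliffPlot (g : ∀ x, Lam X x →ₗ[ℝ] Lam X x →ₗ[ℝ] ℝ) {n : ℕ} (b : Eu n → X)
    (ξ : ∀ z, CliffordAlgebra (cliffQ g (b z))) : Prop :=
  ∀ u₀, ∃ (k : ℕ) (r : Fin k → Eu n → ℝ) (l : Fin k → ℕ)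
    (a : ∀ i, Fin (l i) → ∀ z, Lam X (b z)), (∀ i, ContDiff ℝ ∞ (r i)) ∧
    (∀ i j, FPlot (Lam X) b (a i j)) ∧ ∀ᶠ z in 𝓝 u₀,
      ξ z = ∑ i, r i z • (List.ofFn fun j => CliffordAlgebra.ι (cliffQ g (b z)) (a i j z)).prod

/-- `c` is (the restriction to the generators of) a smooth action of the pseudo-bundle of Clifford
algebras on `E`. -/
def IsCliffordAction (g : ∀ x, Lam X x →ₗ[ℝ] Lam X x →ₗ[ℝ] ℝ)
    (c : ∀ x, Lam X x →ₗ[ℝ] E x →ₗ[ℝ] E x) : Prop :=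
  ∃ C : ∀ x, CliffordAlgebra (cliffQ g x) →ₐ[ℝ] Module.End ℝ (E x),
    (∀ x α, C x (CliffordAlgebra.ι (cliffQ g x) α) = c x α) ∧
    ∀ (n : ℕ) (b : Eu n → X) (ξ : ∀ z, CliffordAlgebra (cliffQ g (b z))) (e : ∀ z, E (b z)),
      IsPlot b → CliffPlot g b ξ → FPlot E b e → FPlot E b fun z => C (b z) (ξ z) (e z)

/-- Unitary Clifford actions. -/
def IsUnitaryAction (gL : ∀ x, Lam X x →ₗ[ℝ] Lam X x →ₗ[ℝ] ℝ)
    (c : ∀ x, Lam X x →ₗ[ℝ] E x →ₗ[ℝ] E x) (g : ∀ x, E x →ₗ[ℝ] E x →ₗ[ℝ] ℝ) : Prop :=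
  ∀ x α, gL x α α = 1 → ∀ e e', g x (c x α e) (c x α e') = g x e e'

/-- Clifford connections, with respect to the connection `nabL` on values of 1-forms. -/
def IsCliffordConnection (nabL : Op (Lam X)) (c : ∀ x, Lam X x →ₗ[ℝ] E x →ₗ[ℝ] E x)
    (nab : Op E) : Prop :=
  ∀ (t : ∀ x, Lam X x →ₗ[ℝ] ℝ) (s : ∀ x, Lam X x) (r : ∀ x, E x), IsSmoothDualSec (Lam X) t →
    IsSmoothSec (Lam X) s → IsSmoothSec E r → ∀ x,
      covD t (nab fun x => c x (s x) (r x)) x =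
        c x (covD t (nabL s) x) (r x) + c x (s x) (covD t (nab r) x)

/-- The data that define a Dirac operator. -/
structure IsDiracData (gL : ∀ x, Lam X x →ₗ[ℝ] Lam X x →ₗ[ℝ] ℝ) (nabL : Op (Lam X))
    (c : ∀ x, Lam X x →ₗ[ℝ] E x →ₗ[ℝ] E x) (g : ∀ x, E x →ₗ[ℝ] E x →ₗ[ℝ] ℝ) (nab : Op E) :
    Prop where
  finite_lam : ∀ x, FiniteDimensional ℝ (Lam X x)
  metric_lam : IsPseudoMetric (Lam X) gL
  leviCivita : IsLeviCivita gL nabL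
  bundle : IsPseudoBundle E
  finite : ∀ x, FiniteDimensional ℝ (E x)
  action : IsCliffordAction E gL c
  metric : IsPseudoMetric E g
  conn : IsConnection E nab
  clifford : IsCliffordConnection E nabL c nab
  compatible : IsMetricCompatible E g nab

variable {E} in
/-- The Dirac operator: the connection followed by the Clifford action. -/
def diracOp (c : ∀ x, Lam X x →ₗ[ℝ] E x →ₗ[ℝ] E x) (nab : Op E) (s : ∀ x, E x) (x : X) : E x :=
  TensorProduct.lift (c x) (nab s x)

end Dirac

/-! ### Gluing of spaces -/

section Gluing

variable {X₁ : Type u} {X₂ : Type v} [DiffeologicalSpace X₁] [DiffeologicalSpace X₂]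

/-- The gluing of `X₁` to `X₂` along `f : Y → X₂`, as a set: the quotient of the disjoint union that
identifies `y` with `f y`, described through the unique representative of each class that is
not in `Y` (see `Glue.proj_eq_iff`). -/
inductive Glue (Y : Set X₁) (f : Y → X₂) : Type (max u v)
  | left (x : X₁) (h : x ∉ Y) : Glue Y f
  | right (x : X₂) : Glue Y f

variable (Y : Set X₁) (f : Y → X₂)

open Classical in
/-- The natural map of `X₁` into the glued space. -/
def Glue.inOne (x : X₁) : Glue Y f :=
  if h : x ∈ Y then Glue.right (f ⟨x, h⟩) else Glue.left x h

/-- The natural map of `X₂` into the glued space. -/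
def Glue.inTwo (x : X₂) : Glue Y f := Glue.right x

/-- The quotient projection. -/
def Glue.proj : X₁ ⊕ X₂ → Glue Y f := Sum.elim (Glue.inOne Y f) (Glue.inTwo Y f)

theorem Glue.inOne_mem {x : X₁} (h : x ∈ Y) : Glue.inOne Y f x = Glue.right (f ⟨x, h⟩) :=
  dif_pos h

theorem Glue.inOne_notMem {x : X₁} (h : x ∉ Y) : Glue.inOne Y f x = Glue.left x h :=
  dif_neg h

theorem Glue.proj_surjective : Function.Surjective (Glue.proj Y f) := by
  rintro (⟨x, h⟩ | x)
  · exact ⟨Sum.inl x, Glue.inOne_notMem Y f h⟩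
  · exact ⟨Sum.inr x, rfl⟩

theorem Glue.proj_eq_iff (a b : X₁ ⊕ X₂) : Glue.proj Y f a = Glue.proj Y f b ↔
    Relation.EqvGen (fun a b => ∃ y : Y, a = Sum.inl y.1 ∧ b = Sum.inr (f y)) a b := by
  constructor
  · have key : ∀ a : X₁ ⊕ X₂, (∃ (x : X₁) (h : x ∉ Y), a = Sum.inl x ∧
        Glue.proj Y f a = Glue.left x h) ∨ ∃ x : X₂, Glue.proj Y f a = Glue.right x ∧
        Relation.EqvGen (fun a b => ∃ y : Y, a = Sum.inl y.1 ∧ b = Sum.inr (f y)) a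
          (Sum.inr x) := by
      rintro (x | x)
      · by_cases h : x ∈ Y
        · exact Or.inr ⟨f ⟨x, h⟩, Glue.inOne_mem Y f h, .rel _ _ ⟨⟨x, h⟩, rfl, rfl⟩⟩
        · exact Or.inl ⟨x, h, rfl, Glue.inOne_notMem Y f h⟩
      · exact Or.inr ⟨x, rfl, .refl _⟩
    intro hab
    rcases key a with ⟨x, h, ha, hpa⟩ | ⟨x, hpa, ha⟩ <;>
      rcases key b with ⟨x', h', hb, hpb⟩ | ⟨x', hpb, hb⟩ <;> rw [hpa, hpb] at hab
    · cases hab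
      rw [ha, hb]
      exact .refl _
    · cases hab
    · cases hab
    · cases hab
      exact ha.trans _ _ _ hb.symm
  · intro h
    induction h with
    | rel a b h =>
      obtain ⟨y, rfl, rfl⟩ := h
      exact Glue.inOne_mem Y f y.2
    | refl => rfl
    | symm _ _ _ ih => exact ih.symm
    | trans _ _ _ _ _ ih ih' => exact ih.trans ih'

/-- The gluing diffeology: the quotient of the disjoint union diffeology. -/
instance instGlue : DiffeologicalSpace (Glue Y f) :=
  ofLocal (fun n p => (∃ q : Eu n → X₁, IsPlot q ∧ p = Glue.inOne Y f ∘ q) ∨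
      ∃ q : Eu n → X₂, IsPlot q ∧ p = Glue.inTwo Y f ∘ q)
    (fun n z => by
      rcases z with ⟨x, h⟩ | x
      · exact Or.inl ⟨fun _ => x, isPlot_const, funext fun _ => (Glue.inOne_notMem Y f h).symm⟩
      · exact Or.inr ⟨fun _ => x, isPlot_const, rfl⟩)
    (fun {_ _ _ r} h hr => by
      rcases h with ⟨q, hq, rfl⟩ | ⟨q, hq, rfl⟩
      · exact Or.inl ⟨q ∘ r, isPlot_reparam hq hr, rfl⟩
      · exact Or.inr ⟨q ∘ r, isPlot_reparam hq hr, rfl⟩)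

theorem Glue.inOne_smooth : DSmooth (Glue.inOne Y f) :=
  fun _ p hp _ => ⟨Glue.inOne Y f ∘ p, Or.inl ⟨p, hp, rfl⟩, Filter.EventuallyEq.rfl⟩

theorem Glue.inTwo_smooth : DSmooth (Glue.inTwo Y f) :=
  fun _ p hp _ => ⟨Glue.inTwo Y f ∘ p, Or.inr ⟨p, hp, rfl⟩, Filter.EventuallyEq.rfl⟩

theorem incl_smooth : DSmooth (Subtype.val : Y → X₁) := fun _ _ hp => hp

variable {Y f}

/-- `f` is a diffeomorphism of `Y` onto its image, for the subset diffeologies. -/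
structure IsGluingDiffeo (f : Y → X₂) : Prop where
  injective : Function.Injective f
  isPlot_iff : ∀ (n : ℕ) (p : Eu n → Y), IsPlot p ↔ IsPlot fun z => f (p z)

theorem IsGluingDiffeo.smooth (hf : IsGluingDiffeo f) : DSmooth f :=
  fun n p hp => (hf.isPlot_iff n p).1 hp

/-- The two pushforward diffeologies on the 1-forms of `Y`, by restriction of the forms of `X₁` and
by pullback of the forms of `X₂`, coincide. -/
def SameFormDiffeology (hf : DSmooth f) : Prop :=
  pushforward (Om.pull (Subtype.val : Y → X₁) (incl_smooth Y)) = pushforward (Om.pull f hf)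

/-- Pullback of values of 1-forms along the inclusion of `Y`. -/
abbrev resY (y : Y) : Lam X₁ y.1 →ₗ[ℝ] Lam Y y :=
  Lam.pull (Subtype.val : Y → X₁) (incl_smooth Y) rfl

/-- Pullback of values of 1-forms along `f`. -/
abbrev pullF (hf : DSmooth f) (y : Y) : Lam X₂ (f y) →ₗ[ℝ] Lam Y y := Lam.pull f hf rfl

/-- Pullback of values of 1-forms on the glued space to `X₁`. -/
abbrev rhoOne {x : X₁} {z : Glue Y f} (h : Glue.inOne Y f x = z) : Lam (Glue Y f) z →ₗ[ℝ] Lam X₁ x :=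
  Lam.pull (Glue.inOne Y f) (Glue.inOne_smooth Y f) h

/-- Pullback of values of 1-forms on the glued space to `X₂`. -/
abbrev rhoTwo (x : X₂) : Lam (Glue Y f) (Glue.right x) →ₗ[ℝ] Lam X₂ x :=
  Lam.pull (Glue.inTwo Y f) (Glue.inTwo_smooth Y f) rfl

theorem Glue.inOne_eq_right {y : Y} {x : X₂} (h : f y = x) :
    Glue.inOne Y f y.1 = Glue.right x := by
  rw [Glue.inOne_mem Y f y.2, ← h]

/-! ### Compatibility and gluing of data on values of 1-forms -/

/-- Compatibility of values of 1-forms over `y` and `f y`: their pullbacks to `Y` coincide. -/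
def LamCompatible (hf : DSmooth f) (y : Y) (α : Lam X₁ y.1) (β : Lam X₂ (f y)) : Prop :=
  resY y α = pullF hf y β

/-- Compatibility of pseudo-metrics on values of 1-forms. -/
def LamMetricCompatible (hf : DSmooth f) (g₁ : ∀ x, Lam X₁ x →ₗ[ℝ] Lam X₁ x →ₗ[ℝ] ℝ)
    (g₂ : ∀ x, Lam X₂ x →ₗ[ℝ] Lam X₂ x →ₗ[ℝ] ℝ) : Prop :=
  ∀ (y : Y) α α' β β', LamCompatible hf y α β → LamCompatible hf y α' β' →
    g₁ y α α' = g₂ (f y) β β'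

/-- Compatibility of connections on values of 1-forms. -/
def LamConnCompatible (hf : DSmooth f) (nab₁ : Op (Lam X₁)) (nab₂ : Op (Lam X₂)) : Prop :=
  ∀ s₁ s₂, IsSmoothSec (Lam X₁) s₁ → IsSmoothSec (Lam X₂) s₂ →
    (∀ y : Y, LamCompatible hf y (s₁ y) (s₂ (f y))) → ∀ y : Y,
      TensorProduct.map (resY y) (resY y) (nab₁ s₁ y) =
        TensorProduct.map (pullF hf y) (pullF hf y) (nab₂ s₂ (f y))

open Classical in
/-- The induced pseudo-metric on values of 1-forms of the glued space. -/
def glueLamMetric (g₁ : ∀ x, Lam X₁ x →ₗ[ℝ] Lam X₁ x →ₗ[ℝ] ℝ)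
    (g₂ : ∀ x, Lam X₂ x →ₗ[ℝ] Lam X₂ x →ₗ[ℝ] ℝ) :
    ∀ z : Glue Y f, Lam (Glue Y f) z →ₗ[ℝ] Lam (Glue Y f) z →ₗ[ℝ] ℝ
  | .left x h =>
    (g₁ x).compl₁₂ (rhoOne (Glue.inOne_notMem Y f h)) (rhoOne (Glue.inOne_notMem Y f h))
  | .right x =>
    if h : ∃ y : Y, f y = x then
      (1 / 2 : ℝ) • ((g₁ h.choose).compl₁₂ (rhoOne (Glue.inOne_eq_right h.choose_spec))
          (rhoOne (Glue.inOne_eq_right h.choose_spec)) +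
        (g₂ x).compl₁₂ (rhoTwo x) (rhoTwo x))
    else (g₂ x).compl₁₂ (rhoTwo x) (rhoTwo x)

/-- The section over `X₁` induced by a section of the values of 1-forms of the glued space. -/
def resLamOne (s : ∀ z, Lam (Glue Y f) z) (x : X₁) : Lam X₁ x := rhoOne rfl (s (Glue.inOne Y f x))

/-- The section over `X₂` induced by a section of the values of 1-forms of the glued space. -/
def resLamTwo (s : ∀ z, Lam (Glue Y f) z) (x : X₂) : Lam X₂ x := rhoTwo x (s (Glue.right x))

open Classical in
/-- The induced connection on values of 1-forms of the glued space: its value is the tensor whose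
pullbacks to `X₁` and to `X₂` are the values of the two given connections (over points of only one
of the two spaces, whose pullback to this space is the value of the connection). -/
def glueLamConn (nab₁ : Op (Lam X₁)) (nab₂ : Op (Lam X₂)) (s : ∀ z, Lam (Glue Y f) z) :
    ∀ z, Lam (Glue Y f) z ⊗[ℝ] Lam (Glue Y f) z
  | .left x h =>
    Function.invFun (TensorProduct.map (rhoOne (Glue.inOne_notMem Y f h))
      (rhoOne (Glue.inOne_notMem Y f h))) (nab₁ (resLamOne s) x)
  | .right x =>
    if h : ∃ y : Y, f y = x then
      Function.invFun
        ((TensorProduct.map (rhoOne (Glue.inOne_eq_right h.choose_spec))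
          (rhoOne (Glue.inOne_eq_right h.choose_spec))).prod
          (TensorProduct.map (rhoTwo x) (rhoTwo x)))
        (nab₁ (resLamOne s) h.choose, nab₂ (resLamTwo s) x)
    else Function.invFun (TensorProduct.map (rhoTwo x) (rhoTwo x)) (nab₂ (resLamTwo s) x)

/-! ### Gluing of pseudo-bundles -/

variable {E₁ : X₁ → Type w} {E₂ : X₂ → Type w}
  [∀ x, AddCommGroup (E₁ x)] [∀ x, Module ℝ (E₁ x)] [DiffeologicalSpace (Σ x, E₁ x)]
  [∀ x, AddCommGroup (E₂ x)] [∀ x, Module ℝ (E₂ x)] [DiffeologicalSpace (Σ x, E₂ x)]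

/-- A fibrewise linear lift of `f`, bijective on fibres, is a diffeomorphism between the restrictions
of the pseudo-bundles to `Y` and to the image of `f`, for the subset diffeologies. -/
def IsBundleDiffeo (ft : ∀ y : Y, E₁ y ≃ₗ[ℝ] E₂ (f y)) : Prop :=
  ∀ (n : ℕ) (b : Eu n → Y) (e : ∀ z, E₁ (b z)),
    FPlot E₁ (fun z => (b z).1) e ↔ FPlot E₂ (fun z => f (b z)) fun z => ft (b z) (e z)

/-- The fibres of the glued pseudo-bundle. -/
def GlueFib (_ft : ∀ y : Y, E₁ y ≃ₗ[ℝ] E₂ (f y)) : Glue Y f → Type w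
  | .left x _ => E₁ x
  | .right x => E₂ x

variable (ft : ∀ y : Y, E₁ y ≃ₗ[ℝ] E₂ (f y))

instance instGlueFibGroup : ∀ z, AddCommGroup (GlueFib ft z)
  | .left x _ => inferInstanceAs (AddCommGroup (E₁ x))
  | .right x => inferInstanceAs (AddCommGroup (E₂ x))

instance instGlueFibModule : ∀ z, Module ℝ (GlueFib ft z)
  | .left x _ => inferInstanceAs (Module ℝ (E₁ x))
  | .right x => inferInstanceAs (Module ℝ (E₂ x))

open Classical in
/-- The natural map of the total space of `E₁` into that of the glued pseudo-bundle. -/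
def GlueFib.inOne (e : Σ x, E₁ x) : Σ z, GlueFib ft z :=
  if h : e.1 ∈ Y then ⟨Glue.right (f ⟨e.1, h⟩), ft ⟨e.1, h⟩ e.2⟩ else ⟨Glue.left e.1 h, e.2⟩

/-- The natural map of the total space of `E₂` into that of the glued pseudo-bundle. -/
def GlueFib.inTwo (e : Σ x, E₂ x) : Σ z, GlueFib ft z := ⟨Glue.right e.1, e.2⟩

/-- The gluing diffeology on the total space of the glued pseudo-bundle. -/
instance instGlueFib : DiffeologicalSpace (Σ z, GlueFib ft z) :=
  ofLocal (fun n p => (∃ q : Eu n → Σ x, E₁ x, IsPlot q ∧ p = GlueFib.inOne ft ∘ q) ∨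
      ∃ q : Eu n → Σ x, E₂ x, IsPlot q ∧ p = GlueFib.inTwo ft ∘ q)
    (fun n e => by
      rcases e with ⟨⟨x, h⟩ | x, e⟩
      · refine Or.inl ⟨fun _ => ⟨x, e⟩, isPlot_const, funext fun _ => ?_⟩
        simp [GlueFib.inOne, h]
      · exact Or.inr ⟨fun _ => ⟨x, e⟩, isPlot_const, rfl⟩)
    (fun {_ _ _ r} h hr => by
      rcases h with ⟨q, hq, rfl⟩ | ⟨q, hq, rfl⟩
      · exact Or.inl ⟨q ∘ r, isPlot_reparam hq hr, rfl⟩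
      · exact Or.inr ⟨q ∘ r, isPlot_reparam hq hr, rfl⟩)

/-- Compatibility of sections. -/
def SecCompatible (s₁ : ∀ x, E₁ x) (s₂ : ∀ x, E₂ x) : Prop :=
  ∀ y : Y, ft y (s₁ y) = s₂ (f y)

/-- The gluing of two sections. -/
def glueSec (s₁ : ∀ x, E₁ x) (s₂ : ∀ x, E₂ x) : ∀ z, GlueFib ft z
  | .left x _ => s₁ x
  | .right x => s₂ x

variable {ft}

open Classical in
/-- The section of `E₁` induced by a section of the glued pseudo-bundle. -/
def resOne (s : ∀ z, GlueFib ft z) (x : X₁) : E₁ x :=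
  if h : x ∈ Y then (ft ⟨x, h⟩).symm (s (Glue.right (f ⟨x, h⟩))) else s (Glue.left x h)

/-- The section of `E₂` induced by a section of the glued pseudo-bundle. -/
def resTwo (s : ∀ z, GlueFib ft z) (x : X₂) : E₂ x := s (Glue.right x)

variable (ft)

/-- Compatibility of pseudo-metrics on the two pseudo-bundles. -/
def MetricCompatible (g₁ : ∀ x, E₁ x →ₗ[ℝ] E₁ x →ₗ[ℝ] ℝ) (g₂ : ∀ x, E₂ x →ₗ[ℝ] E₂ x →ₗ[ℝ] ℝ) :
    Prop :=
  ∀ (y : Y) e e', g₁ y e e' = g₂ (f y) (ft y e) (ft y e')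

/-- The induced pseudo-metric on the glued pseudo-bundle. -/
def glueMetric (g₁ : ∀ x, E₁ x →ₗ[ℝ] E₁ x →ₗ[ℝ] ℝ) (g₂ : ∀ x, E₂ x →ₗ[ℝ] E₂ x →ₗ[ℝ] ℝ) :
    ∀ z, GlueFib ft z →ₗ[ℝ] GlueFib ft z →ₗ[ℝ] ℝ
  | .left x _ => g₁ x
  | .right x => g₂ x

/-- Compatibility of Clifford actions. -/
def ActionCompatible (c₁ : ∀ x, Lam X₁ x →ₗ[ℝ] E₁ x →ₗ[ℝ] E₁ x)
    (c₂ : ∀ x, Lam X₂ x →ₗ[ℝ] E₂ x →ₗ[ℝ] E₂ x) : Prop :=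
  ∀ (y : Y) (α : Lam (Glue Y f) (Glue.right (f y))) (e : E₁ y),
    c₂ (f y) (rhoTwo (f y) α) (ft y e) = ft y (c₁ y (rhoOne (Glue.inOne_eq_right rfl) α) e)

/-- The induced action of the values of 1-forms on the glued pseudo-bundle. -/
def glueAction (c₁ : ∀ x, Lam X₁ x →ₗ[ℝ] E₁ x →ₗ[ℝ] E₁ x)
    (c₂ : ∀ x, Lam X₂ x →ₗ[ℝ] E₂ x →ₗ[ℝ] E₂ x) :
    ∀ z, Lam (Glue Y f) z →ₗ[ℝ] GlueFib ft z →ₗ[ℝ] GlueFib ft z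
  | .left x h => (c₁ x).comp (rhoOne (Glue.inOne_notMem Y f h))
  | .right x => (c₂ x).comp (rhoTwo x)

/-- Compatibility of connections on the two pseudo-bundles. -/
def ConnCompatible (hf : DSmooth f) (nab₁ : Op E₁) (nab₂ : Op E₂) : Prop :=
  ∀ s₁ s₂, IsSmoothSec E₁ s₁ → IsSmoothSec E₂ s₂ → SecCompatible ft s₁ s₂ → ∀ y : Y,
    TensorProduct.map (resY y) (ft y).toLinearMap (nab₁ s₁ y) =
      TensorProduct.map (pullF hf y) LinearMap.id (nab₂ s₂ (f y))

/-- The map of fibres given by `ft y`, with target the fibre over `x = f y`. -/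
def ftTo {y : Y} {x : X₂} (h : f y = x) : E₁ y →ₗ[ℝ] E₂ x := h ▸ (ft y).toLinearMap

open Classical in
/-- The induced connection on the glued pseudo-bundle. Over the points of `f(Y)`, it is the
preimage, under the joint pullback of values of 1-forms to `X₁` and `X₂`, of the sum of the values
of the two given connections. -/
def glueConn (nab₁ : Op E₁) (nab₂ : Op E₂) (s : ∀ z, GlueFib ft z) :
    ∀ z, Lam (Glue Y f) z ⊗[ℝ] GlueFib ft z
  | .left x h =>
    Function.invFun (LinearMap.rTensor (E₁ x) (rhoOne (Glue.inOne_notMem Y f h)))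
      (nab₁ (resOne s) x)
  | .right x =>
    if h : ∃ y : Y, f y = x then
      Function.invFun
        (LinearMap.rTensor (E₂ x)
          ((rhoOne (Glue.inOne_eq_right h.choose_spec)).prod (rhoTwo x)))
        (TensorProduct.map (LinearMap.inl ℝ (Lam X₁ h.choose) (Lam X₂ x)) (ftTo ft h.choose_spec)
            (nab₁ (resOne s) h.choose) +
          TensorProduct.map (LinearMap.inr ℝ (Lam X₁ h.choose) (Lam X₂ x)) LinearMap.id
            (nab₂ (resTwo s) x))
    else Function.invFun (LinearMap.rTensor (E₂ x) (rhoTwo x)) (nab₂ (resTwo s) x)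

end Gluing

end DiffDirac

end

open DiffDirac

/-!
Being the data of a Dirac operator is a local property, and the two natural maps into the glued
space `Z` are charts for it: every plot of `Z` lifts locally along one of them, and along each of
them the bundles `Λ¹(Z)` and `E₁ ∪ E₂`, with all the induced structure, are identified with the
given ones. Every axiom is then checked in the two charts (`isDiracData_of_cover`), and the formula
for the glued Dirac operator is its expression in the charts (`IsDiracChart.diracOp`).

The point is that pullback identifies the fibre of `Λ¹(Z)` with that of `Λ¹(X₁)` or `Λ¹(X₂)` even
over the image of `Y`, where a priori it only embeds into the product of the two. This comes from
the metrics. Evaluating forms on tangent vectors of plots gives smooth functionals that separate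
the points of `Λ¹_x(X)`; hence the diffeological dual of this finite-dimensional space is its full
dual (`smoothDual_lam_eq_top`), and a pseudo-metric on `Λ¹(X)` is nondegenerate
(`IsPseudoMetric.ker_lam`). The hypothesis on the diffeologies of `Ω¹(Y)` says that the forms on `Y`
that extend to `X₁` are those that come from `X₂`, and that plots of such forms lift locally
(`exists_pull_eq`, `exists_local_lift`). So a value of a 1-form on `X₁` whose restriction to `Y`
vanishes is compatible with zero, and by compatibility of the metrics it is in the kernel of the
metric: the restrictions to `Y` are injective (`resY_injective`, `pullF_injective`). Two consequences
follow. The restriction of a form on `Z` to one side determines its value on the other side, which,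
with the local lifts, makes the two maps charts (`Glue.isFormChart_inOne`,
`Glue.isFormChart_inTwo`). And the compatibility of the connections, stated after restriction to
`Y`, yields the single tensor over `f(Y)` with the two prescribed pullbacks
(`map_glueLamConn_right`, `map_glueConn_right`).
-/

noncomputable section

namespace DiffDirac

/-! ### Locality of plots -/

section Locality

variable {X : Type u} [DiffeologicalSpace X]

/-- A map is a plot if near each point it becomes one after reparametrisation by a map `r` that is
the identity there. In contrast to equality of germs, this needs no transport between fibres when
applied to plots of a pseudo-bundle. -/
theorem isPlot_of_retract {n : ℕ} {p : Eu n → X}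
    (h : ∀ u₀, ∃ r : Eu n → Eu n, ContDiff ℝ ∞ r ∧ r =ᶠ[𝓝 u₀] id ∧ IsPlot (p ∘ r)) : IsPlot p := by
  refine DiffeologicalSpace.locality fun u₀ => ?_
  obtain ⟨r, hr, he, hp⟩ := h u₀
  obtain ⟨U, hU, hUo, hu⟩ := mem_nhds_iff.1 he
  refine ⟨U, hUo, hu, fun {m f} hf1 hf2 => ?_⟩
  have : p ∘ f = (p ∘ r) ∘ f := funext fun z => by
    have : r (f z) = f z := hU (hf1 z)
    simp [this]
  rw [this]
  exact isPlot_reparam hp hf2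

theorem exists_retract_of_eventually {n : ℕ} {P : Eu n → Prop} {u₀ : Eu n}
    (h : ∀ᶠ z in 𝓝 u₀, P z) :
    ∃ r : Eu n → Eu n, ContDiff ℝ ∞ r ∧ r =ᶠ[𝓝 u₀] id ∧ ∀ z, P (r z) := by
  obtain ⟨U, hU, hUo, hu⟩ := mem_nhds_iff.1 h
  obtain ⟨r, h1, h2, h3⟩ := exists_smooth_retract hUo hu
  exact ⟨r, h1, h3, fun z => hU (h2 z)⟩

theorem isPlot_of_eventuallyEq {n : ℕ} {p : Eu n → X}
    (h : ∀ u₀, ∃ q : Eu n → X, IsPlot q ∧ p =ᶠ[𝓝 u₀] q) : IsPlot p := by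
  refine isPlot_of_retract fun u₀ => ?_
  obtain ⟨q, hq, e⟩ := h u₀
  obtain ⟨r, hr, he, hp⟩ := exists_retract_of_eventually e
  refine ⟨r, hr, he, ?_⟩
  rw [show p ∘ r = q ∘ r from funext hp]
  exact isPlot_reparam hq hr

theorem contDiff_of_retract {n : ℕ} {F : Type*} [NormedAddCommGroup F] [NormedSpace ℝ F]
    {p : Eu n → F}
    (h : ∀ u₀, ∃ r : Eu n → Eu n, r =ᶠ[𝓝 u₀] id ∧ ContDiff ℝ ∞ (p ∘ r)) : ContDiff ℝ ∞ p := by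
  rw [contDiff_iff_contDiffAt]
  intro u₀
  obtain ⟨r, he, hp⟩ := h u₀
  refine hp.contDiffAt.congr_of_eventuallyEq ?_
  filter_upwards [he] with z hz
  simp [hz]

end Locality

/-! ### Values of 1-forms -/

section Forms

variable {X : Type u} [DiffeologicalSpace X]

/-- The value of a 1-form on a plot at a point depends only on the germ of the plot. -/
theorem Om.apply_congr (η : Om X) {n : ℕ} (p q : {p : Eu n → X // IsPlot p}) {u₀ : Eu n}
    (h : p.1 =ᶠ[𝓝 u₀] q.1) : η.1 n p u₀ = η.1 n q u₀ := by
  obtain ⟨r, hr, he, hp⟩ := exists_retract_of_eventually h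
  have h0 : r u₀ = u₀ := he.self_of_nhds
  have h1 : fderiv ℝ r u₀ = ContinuousLinearMap.id ℝ _ := by
    rw [he.fderiv_eq, fderiv_id]
  have key : ∀ p : {p : Eu n → X // IsPlot p},
      η.1 n ⟨p.1 ∘ r, isPlot_reparam p.2 hr⟩ u₀ = η.1 n p u₀ := fun p => by
    rw [η.2.2 n n p r hr u₀, h0, h1, ContinuousLinearMap.comp_id]
  rw [← key p, ← key q]
  have : (⟨p.1 ∘ r, isPlot_reparam p.2 hr⟩ : {p : Eu n → X // IsPlot p}) =
      ⟨q.1 ∘ r, isPlot_reparam q.2 hr⟩ := Subtype.ext (funext hp)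
  rw [this]

theorem Lam.mk_surjective (x : X) : Function.Surjective (Lam.mk x) :=
  Submodule.mkQ_surjective _

theorem Lam.mk_eq_zero {x : X} {η : Om X} : Lam.mk x η = 0 ↔ η ∈ vanishing x :=
  Submodule.Quotient.mk_eq_zero _

theorem Lam.pull_mk {A : Type u} {B : Type v} [DiffeologicalSpace A] [DiffeologicalSpace B]
    (φ : A → B) (hφ : DSmooth φ) {a : A} {b : B} (h : φ a = b) (η : Om B) :
    Lam.pull φ hφ h (Lam.mk b η) = Lam.mk a (Om.pull φ hφ η) := rfl

theorem Lam.pull_pull {A : Type u} {B : Type v} {C : Type w} [DiffeologicalSpace A]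
    [DiffeologicalSpace B] [DiffeologicalSpace C] {φ : A → B} {ψ : B → C} {χ : A → C}
    (hφ : DSmooth φ) (hψ : DSmooth ψ) (hχ : DSmooth χ) (e : ψ ∘ φ = χ) {a : A} {b : B} {c : C}
    (h : φ a = b) (h' : ψ b = c) (h'' : χ a = c) (α : Lam C c) :
    Lam.pull φ hφ h (Lam.pull ψ hψ h' α) = Lam.pull χ hχ h'' α := by
  obtain ⟨η, rfl⟩ := Lam.mk_surjective c α
  subst e
  rfl

theorem Om.isPlot_pull {A : Type u} {B : Type v} [DiffeologicalSpace A] [DiffeologicalSpace B]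
    (φ : A → B) (hφ : DSmooth φ) {n : ℕ} {η : Eu n → Om B} (hη : IsPlot η) :
    IsPlot fun z => Om.pull φ hφ (η z) :=
  fun n p => hη n ⟨φ ∘ p.1, hφ n p.1 p.2⟩

theorem fPlot_mk {n : ℕ} {b : Eu n → X} {η : Eu n → Om X} (hb : IsPlot b) (hη : IsPlot η) :
    FPlot (Lam X) b fun z => Lam.mk (b z) (η z) :=
  fun _ => ⟨_, ⟨b, η, hb, hη, rfl⟩, Filter.EventuallyEq.rfl⟩

/-- A plot of values of 1-forms is locally given by a plot of 1-forms, over its own base plot. -/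
theorem FPlot.exists_mk {n : ℕ} {b : Eu n → X} {v : ∀ z, Lam X (b z)} (h : FPlot (Lam X) b v)
    (u₀ : Eu n) :
    ∃ η : Eu n → Om X, IsPlot η ∧ ∀ᶠ z in 𝓝 u₀, v z = Lam.mk (b z) (η z) := by
  obtain ⟨q, ⟨b', η, hb', hη, rfl⟩, e⟩ := h u₀
  refine ⟨η, hη, ?_⟩
  filter_upwards [e] with z hz
  have key : ∀ (x x' : X) (α : Lam X x), (⟨x, α⟩ : Σ x, Lam X x) = ⟨x', Lam.mk x' (η z)⟩ →
      α = Lam.mk x (η z) := by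
    rintro x x' α h
    cases h
    rfl
  exact key _ _ _ hz

theorem dSec_eq {h : X → ℝ} (hh : DSmooth h) (x : X) : dSec h x = Lam.mk x (dForm h hh) :=
  dif_pos hh

theorem isSmoothSec_dSec {h : X → ℝ} (hh : DSmooth h) : IsSmoothSec (Lam X) (dSec h) := by
  intro n p hp
  have : (fun x => (⟨x, dSec h x⟩ : Σ x, Lam X x)) ∘ p =
      fun z => ⟨p z, Lam.mk (p z) (dForm h hh)⟩ := by
    funext z
    simp [dSec_eq hh]
  rw [this]
  exact fPlot_mk hp isPlot_const

theorem Lam.pull_dSec {A : Type u} {B : Type v} [DiffeologicalSpace A] [DiffeologicalSpace B]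
    (φ : A → B) (hφ : DSmooth φ) {a : A} {b : B} (e : φ a = b) {h : B → ℝ} (hh : DSmooth h) :
    Lam.pull φ hφ e (dSec h b) = dSec (fun a => h (φ a)) a := by
  rw [dSec_eq hh, dSec_eq (X := A) (h := fun a => h (φ a)) (hh.comp hφ)]
  rfl

/-- Evaluation on tangent vectors of plots through `x`: these smooth functionals separate the
points of the fibre, so a finite-dimensional fibre has its full dual as diffeological dual. -/
theorem smoothDual_lam_eq_top (x : X) [FiniteDimensional ℝ (Lam X x)] :
    smoothDual (Lam X) x = ⊤ := by
  have hco : (smoothDual (Lam X) x).dualCoannihilator = ⊥ := by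
    rw [eq_bot_iff]
    intro α hα
    obtain ⟨η, rfl⟩ := Lam.mk_surjective x α
    rw [Submodule.mem_dualCoannihilator] at hα
    refine Lam.mk_eq_zero.2 fun n p hp => ContinuousLinearMap.ext fun v => ?_
    let ev : Om X →ₗ[ℝ] ℝ :=
      { toFun := fun η => η.1 n p 0 v
        map_add' := fun _ _ => rfl
        map_smul' := fun _ _ => rfl }
    have hev : vanishing x ≤ LinearMap.ker ev := fun η hη => by
      change η.1 n p 0 v = 0
      rw [hη n p hp]
      rfl
    refine hα ((vanishing x).liftQ ev hev) fun m w hw => contDiff_iff_contDiffAt.2 fun u₀ => ?_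
    obtain ⟨θ, hθ, e⟩ := FPlot.exists_mk hw u₀
    have hs : ContDiff ℝ ∞ fun z => (θ z).1 n p 0 v :=
      ((hθ n p).comp (contDiff_id.prodMk contDiff_const)).clm_apply contDiff_const
    refine hs.contDiffAt.congr_of_eventuallyEq ?_
    filter_upwards [e] with z hz
    rw [hz]
    rfl
  have := Subspace.dualCoannihilator_dualAnnihilator_eq (W := smoothDual (Lam X) x)
  rw [← this, hco, Submodule.dualAnnihilator_bot]

/-- The rank condition makes a pseudo-metric on finite-dimensional values of 1-forms
nondegenerate. -/
theorem IsPseudoMetric.ker_lam {g : ∀ x, Lam X x →ₗ[ℝ] Lam X x →ₗ[ℝ] ℝ}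
    (hg : IsPseudoMetric (Lam X) g) (x : X) [FiniteDimensional ℝ (Lam X x)] :
    LinearMap.ker (g x) = ⊥ := by
  have h := hg.rank x
  rw [smoothDual_lam_eq_top x, finrank_top, Subspace.dual_finrank_eq] at h
  exact Submodule.finrank_eq_zero.1 (by omega)

end Forms

/-! ### Plots of pseudo-bundles -/

section Bundles

variable {X : Type u} [DiffeologicalSpace X]

theorem IsSmoothSec.fPlot {E : X → Type w} [DiffeologicalSpace (Σ x, E x)] {s : ∀ x, E x}
    (hs : IsSmoothSec E s) {n : ℕ} {b : Eu n → X} (hb : IsPlot b) : FPlot E b fun z => s (b z) :=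
  hs n b hb

variable {E : X → Type w} [∀ x, AddCommGroup (E x)] [∀ x, Module ℝ (E x)]
  [DiffeologicalSpace (Σ x, E x)]

theorem IsPseudoBundle.sum (hE : IsPseudoBundle E) {n : ℕ} {b : Eu n → X} (hb : IsPlot b)
    {ι : Type*} (S : Finset ι) (v : ι → ∀ z, E (b z)) (h : ∀ i, FPlot E b (v i)) :
    FPlot E b fun z => ∑ i ∈ S, v i z := by
  classical
  induction S using Finset.induction_on with
  | empty => exact hE.zero n b hb
  | insert a S ha ih =>
    simp only [Finset.sum_insert ha]
    exact hE.add n b _ _ (h a) ih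

/-- A pseudo-metric pairs plots over a common plot of the base to smooth functions. -/
theorem IsPseudoMetric.contDiff {g : ∀ x, E x →ₗ[ℝ] E x →ₗ[ℝ] ℝ} (hg : IsPseudoMetric E g)
    {n : ℕ} {b : Eu n → X} (hb : IsPlot b) {v w : ∀ z, E (b z)} (hv : FPlot E b v)
    (hw : FPlot E b w) : ContDiff ℝ ∞ fun z => g (b z) (v z) (w z) := by
  rw [contDiff_iff_contDiffAt]
  intro u₀
  obtain ⟨k, φ, ψ, hφ, hψ, e⟩ := hg.smooth n b hb u₀
  have hs : ContDiff ℝ ∞ fun z => ∑ i, φ i z (v z) * ψ i z (w z) :=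
    ContDiff.sum fun i _ => (hφ i n id v contDiff_id hv).mul (hψ i n id w contDiff_id hw)
  refine hs.contDiffAt.congr_of_eventuallyEq ?_
  filter_upwards [e] with z hz
  exact hz _ _

theorem IsPseudoMetric.dSmooth {g : ∀ x, E x →ₗ[ℝ] E x →ₗ[ℝ] ℝ} (hg : IsPseudoMetric E g)
    {s t : ∀ x, E x} (hs : IsSmoothSec E s) (ht : IsSmoothSec E t) :
    DSmooth fun x => g x (s x) (t x) :=
  fun _ _ hb => isPlot_iff_contDiff.2 (hg.contDiff hb (hs.fPlot hb) (ht.fPlot hb))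

theorem SecPlot.isSmoothSec {E : X → Type w} [DiffeologicalSpace (Σ x, E x)] {m : ℕ}
    {q : Eu m → ∀ x, E x} (hq : SecPlot E q) (z : Eu m) : IsSmoothSec E (q z) :=
  fun k p hp => hq k (fun _ => z) p contDiff_const hp

/-- A fibrewise bilinear action of the values of 1-forms that is smooth on plots. -/
def IsSmoothAction (c : ∀ x, Lam X x →ₗ[ℝ] E x →ₗ[ℝ] E x) : Prop :=
  ∀ (n : ℕ) (b : Eu n → X) (α : ∀ z, Lam X (b z)) (e : ∀ z, E (b z)), IsPlot b →
    FPlot (Lam X) b α → FPlot E b e → FPlot E b fun z => c (b z) (α z) (e z)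

theorem IsCliffordAction.isSmoothAction {g : ∀ x, Lam X x →ₗ[ℝ] Lam X x →ₗ[ℝ] ℝ}
    {c : ∀ x, Lam X x →ₗ[ℝ] E x →ₗ[ℝ] E x} (h : IsCliffordAction E g c) : IsSmoothAction c := by
  obtain ⟨C, hC, hs⟩ := h
  intro n b α e hb hα he
  have := hs n b (fun z => CliffordAlgebra.ι (cliffQ g (b z)) (α z)) e hb (fun u₀ =>
    ⟨1, fun _ _ => 1, fun _ => 1, fun _ _ => α, fun _ => contDiff_const, fun _ _ => hα,
      Filter.Eventually.of_forall fun z => by simp⟩) he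
  simpa only [hC] using this

theorem IsCliffordAction.sq {g : ∀ x, Lam X x →ₗ[ℝ] Lam X x →ₗ[ℝ] ℝ}
    {c : ∀ x, Lam X x →ₗ[ℝ] E x →ₗ[ℝ] E x} (h : IsCliffordAction E g c) (x : X) (α : Lam X x)
    (e : E x) : c x α (c x α e) = -g x α α • e := by
  obtain ⟨C, hC, -⟩ := h
  have := congrArg (C x) (CliffordAlgebra.ι_sq_scalar (cliffQ g x) α)
  rw [map_mul, hC, AlgHom.commutes] at this
  simpa [Algebra.algebraMap_eq_smul_one] using LinearMap.congr_fun this e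

/-- A smooth fibrewise action satisfying the Clifford relations extends to a smooth action of the
pseudo-bundle of Clifford algebras: plots of the latter are smooth combinations of products. -/
theorem isCliffordAction_of_sq {g : ∀ x, Lam X x →ₗ[ℝ] Lam X x →ₗ[ℝ] ℝ}
    {c : ∀ x, Lam X x →ₗ[ℝ] E x →ₗ[ℝ] E x} (hE : IsPseudoBundle E) (hc : IsSmoothAction c)
    (hsq : ∀ x α e, c x α (c x α e) = -g x α α • e) : IsCliffordAction E g c := by
  have hl : ∀ x α, (c x α : Module.End ℝ (E x)) * c x α =
      algebraMap ℝ (Module.End ℝ (E x)) (cliffQ g x α) := fun x α => by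
    ext e
    simpa [Algebra.algebraMap_eq_smul_one] using hsq x α e
  refine ⟨fun x => CliffordAlgebra.lift (cliffQ g x) ⟨c x, hl x⟩, fun x α => ?_, ?_⟩
  · exact CliffordAlgebra.lift_ι_apply _ _ _
  intro n b ξ e hb hξ he
  refine isPlot_of_eventuallyEq fun u₀ => ?_
  obtain ⟨k, r, l, a, hr, ha, hev⟩ := hξ u₀
  have hprod : ∀ (m : ℕ) (a : Fin m → ∀ z, Lam X (b z)), (∀ j, FPlot (Lam X) b (a j)) →
      FPlot E b fun z => CliffordAlgebra.lift (cliffQ g (b z)) ⟨c (b z), hl (b z)⟩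
        (List.ofFn fun j => CliffordAlgebra.ι (cliffQ g (b z)) (a j z)).prod (e z) := by
    intro m
    induction m with
    | zero => intro a _; simpa using he
    | succ m ih =>
      intro a ha
      have := hc n b (a 0) _ hb (ha 0) (ih (fun j => a j.succ) fun j => ha j.succ)
      simpa only [List.ofFn_succ, List.prod_cons, map_mul, CliffordAlgebra.lift_ι_apply,
        Module.End.mul_apply] using this
  refine ⟨_, hE.sum hb Finset.univ _ fun i => hE.smul n b (r i) _ (hr i)
    (hprod (l i) (a i) (ha i)), ?_⟩
  filter_upwards [hev] with z hz
  simp only [hz, map_sum, map_smul, LinearMap.sum_apply, LinearMap.smul_apply]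

/-- The Dirac operator preserves smoothness: its value is a smooth contraction of `∇ s`. -/
theorem isSmoothSec_diracOp {c : ∀ x, Lam X x →ₗ[ℝ] E x →ₗ[ℝ] E x} (hE : IsPseudoBundle E)
    (hc : IsSmoothAction c) {nab : Op E} (hnab : IsConnection E nab) {s : ∀ x, E x}
    (hs : IsSmoothSec E s) : IsSmoothSec E (diracOp c nab s) := by
  have key : DSmooth fun T : Σ x, Lam X x ⊗[ℝ] E x =>
      (⟨T.1, TensorProduct.lift (c T.1) T.2⟩ : Σ x, E x) := by
    intro n p hp
    refine isPlot_of_eventuallyEq fun u₀ => ?_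
    obtain ⟨q, ⟨b, k, a, d, hb, ha, hd, rfl⟩, e⟩ := hp u₀
    refine ⟨_, hE.sum hb Finset.univ _ fun i => hc n b (a i) (d i) hb (ha i) (hd i), ?_⟩
    filter_upwards [e] with z hz
    change (⟨(p z).1, TensorProduct.lift (c (p z).1) (p z).2⟩ : Σ x, E x) = _
    rw [hz]
    simp
  exact fun n p hp => key n _ (hnab.smooth_sec s hs n p hp)

end Bundles

section Lam

variable {X : Type u} [DiffeologicalSpace X]

theorem dSmooth_fst_lam : DSmooth (Sigma.fst : (Σ x, Lam X x) → X) :=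
  fun n p hp => isPlot_of_eventuallyEq fun u₀ => by
    obtain ⟨q, ⟨b, η, hb, hη, rfl⟩, e⟩ := hp u₀
    refine ⟨b, hb, ?_⟩
    filter_upwards [e] with z hz
    simp [hz]

theorem isPseudoBundle_lam : IsPseudoBundle (Lam X) where
  proj := dSmooth_fst_lam
  zero n b hb := fPlot_mk (η := fun _ => 0) hb isPlot_const
  add n b v v' hv hv' := by
    refine isPlot_of_eventuallyEq fun u₀ => ?_
    obtain ⟨η, hη, e⟩ := FPlot.exists_mk hv u₀
    obtain ⟨θ, hθ, f⟩ := FPlot.exists_mk hv' u₀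
    refine ⟨_, fPlot_mk (dSmooth_fst_lam n _ hv) (η := fun z => η z + θ z)
      fun m p => (hη m p).add (hθ m p), ?_⟩
    filter_upwards [e, f] with z h1 h2
    rw [h1, h2, ← map_add]
    rfl
  smul n b r v hr hv := by
    refine isPlot_of_eventuallyEq fun u₀ => ?_
    obtain ⟨η, hη, e⟩ := FPlot.exists_mk hv u₀
    refine ⟨_, fPlot_mk (dSmooth_fst_lam n _ hv) (η := fun z => r z • η z) fun m p =>
      (hr.comp contDiff_fst).smul (hη m p), ?_⟩
    filter_upwards [e] with z h1
    rw [h1, ← map_smul]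
    rfl

end Lam

/-- The identification of the fibres over two equal points. -/
def castFib {X : Type u} (E : X → Type w) [∀ x, AddCommGroup (E x)] [∀ x, Module ℝ (E x)]
    {x y : X} (h : x = y) : E x ≃ₗ[ℝ] E y :=
  h ▸ LinearEquiv.refl ℝ (E x)

theorem castFib_mk {X : Type u} {E : X → Type w} [∀ x, AddCommGroup (E x)]
    [∀ x, Module ℝ (E x)] {x y : X} (h : x = y) (e : E x) :
    (⟨y, castFib E h e⟩ : Σ x, E x) = ⟨x, e⟩ := by
  subst h
  rfl

section Sections

variable {X : Type u} [DiffeologicalSpace X] {E : X → Type w} [∀ x, AddCommGroup (E x)]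
  [∀ x, Module ℝ (E x)] [DiffeologicalSpace (Σ x, E x)]

theorem IsSmoothSec.add (hE : IsPseudoBundle E) {s t : ∀ x, E x} (hs : IsSmoothSec E s)
    (ht : IsSmoothSec E t) : IsSmoothSec E (s + t) :=
  fun n b hb => hE.add n b _ _ (hs.fPlot hb) (ht.fPlot hb)

theorem IsSmoothSec.smul (hE : IsPseudoBundle E) {h : X → ℝ} {s : ∀ x, E x} (hh : DSmooth h)
    (hs : IsSmoothSec E s) : IsSmoothSec E fun x => h x • s x :=
  fun n b hb => hE.smul n b _ _ (isPlot_iff_contDiff.1 (hh n b hb)) (hs.fPlot hb)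

/-- A plot of the dual pseudo-bundle over `b ∘ r`, where `r` is the identity near `u₀`, agrees near
`u₀` with a plot over `b`, obtained by cutting off. -/
theorem DualPlot.exists_extension {X : Type u} {E : X → Type w} [∀ x, AddCommGroup (E x)]
    [∀ x, Module ℝ (E x)] [DiffeologicalSpace (Σ x, E x)] {n : ℕ} {b : Eu n → X} {r : Eu n → Eu n} {u₀ : Eu n}
    (hr : r =ᶠ[𝓝 u₀] id) {φ : ∀ z, E (b (r z)) →ₗ[ℝ] ℝ} (hφ : DualPlot E (fun z => b (r z)) φ) :
    ∃ φ' : ∀ z, E (b z) →ₗ[ℝ] ℝ, DualPlot E b φ' ∧ ∀ᶠ z in 𝓝 u₀, φ' (r z) = φ z := by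
  classical
  obtain ⟨U, hU, hUo, hu⟩ := mem_nhds_iff.1 hr
  obtain ⟨ε, hε, hball⟩ := Metric.isOpen_iff.1 hUo u₀ hu
  let χ : ContDiffBump u₀ := ⟨ε / 4, ε / 2, by positivity, by linarith⟩
  let φ' : ∀ z, E (b z) →ₗ[ℝ] ℝ := fun z =>
    if h : r z = z then χ z • (φ z).comp (castFib E (congrArg b h.symm)).toLinearMap else 0
  refine ⟨φ', fun m a v ha hv => contDiff_of_retract fun z₀ => ?_, ?_⟩
  · by_cases hz₀ : a z₀ ∈ U
    · obtain ⟨ρ, hρ, he, hUρ⟩ := exists_retract_of_eventually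
        (ha.continuous.continuousAt.eventually (hUo.mem_nhds hz₀))
      have hfix : ∀ z, r (a (ρ z)) = a (ρ z) := fun z => hU (hUρ z)
      refine ⟨ρ, he, ?_⟩
      have h1 : FPlot E (fun z => b (r (a (ρ z))))
          fun z => castFib E (congrArg b (hfix z).symm) (v (ρ z)) := by
        simp only [FPlot, castFib_mk]
        exact isPlot_reparam hv hρ
      have h2 := (χ.contDiff.comp (ha.comp hρ)).mul (hφ m (a ∘ ρ) _ (ha.comp hρ) h1)
      refine Eq.subst (motive := fun F : Eu m → ℝ => ContDiff ℝ ∞ F) (funext fun z => ?_) h2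
      simp [φ', hfix]
    · -- outside of `U` the cut-off function vanishes
      have hev : ∀ᶠ x in 𝓝 (a z₀), χ x = 0 := by
        have : IsClosed (Metric.closedBall u₀ (ε / 2)) := Metric.isClosed_closedBall
        refine Filter.mem_of_superset (this.isOpen_compl.mem_nhds fun h => hz₀ (hball ?_)) ?_
        · exact Metric.closedBall_subset_ball (by linarith) h
        · intro x hx
          exact χ.zero_of_le_dist (not_le.1 fun h => hx h).le
      obtain ⟨ρ, hρ, he, h0⟩ := exists_retract_of_eventually
        (ha.continuous.continuousAt.eventually hev)
      refine ⟨ρ, he, ?_⟩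
      refine Eq.subst (motive := fun F : Eu m → ℝ => ContDiff ℝ ∞ F) (funext fun z => ?_)
        (contDiff_const (c := (0 : ℝ)))
      by_cases h : r (a (ρ z)) = a (ρ z) <;> simp [φ', h, h0]
  · filter_upwards [hr, χ.eventuallyEq_one] with z hz hχ
    have hz' : r z = z := hz
    have key : ∀ (y : Eu n) (_ : y = z) (hb : b (r z) = b (r y)),
        (φ y).comp (castFib E hb).toLinearMap = φ z := by
      rintro y rfl hb
      rfl
    have h2 : r (r z) = r z := congrArg r hz'
    have hχ' : χ (r z) = 1 := by rw [hz', hχ]; rfl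
    simp only [φ', dif_pos h2, hχ', one_smul]
    exact key _ hz' _

end Sections

/-! ### Linear algebra of contractions -/

section LinearAlgebra

variable {M M' N N' : Type*} [AddCommGroup M] [Module ℝ M] [AddCommGroup M'] [Module ℝ M']
  [AddCommGroup N] [Module ℝ N] [AddCommGroup N'] [Module ℝ N']

theorem rid_lTensor_congr (e : M ≃ₗ[ℝ] M') (f : N ≃ₗ[ℝ] N') (k : N →ₗ[ℝ] ℝ) (k' : N' →ₗ[ℝ] ℝ)
    (h : ∀ n, k' (f n) = k n) (T : M ⊗[ℝ] N) :
    e (TensorProduct.rid ℝ M (LinearMap.lTensor M k T)) =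
      TensorProduct.rid ℝ M' (LinearMap.lTensor M' k' (TensorProduct.congr e f T)) := by
  induction T with
  | zero => simp
  | tmul m n => simp [h]
  | add x y hx hy => simp only [map_add, hx, hy]

theorem lid_rTensor_congr (e : M ≃ₗ[ℝ] M') (f : N ≃ₗ[ℝ] N') (k : M →ₗ[ℝ] ℝ) (k' : M' →ₗ[ℝ] ℝ)
    (h : ∀ n, k' (e n) = k n) (T : M ⊗[ℝ] N) :
    f (TensorProduct.lid ℝ N (LinearMap.rTensor N k T)) =
      TensorProduct.lid ℝ N' (LinearMap.rTensor N' k' (TensorProduct.congr e f T)) := by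
  induction T with
  | zero => simp
  | tmul m n => simp [h]
  | add x y hx hy => simp only [map_add, hx, hy]

theorem lift_congr (e : M ≃ₗ[ℝ] M') (f : N ≃ₗ[ℝ] N') (c : M →ₗ[ℝ] N →ₗ[ℝ] N)
    (c' : M' →ₗ[ℝ] N' →ₗ[ℝ] N') (h : ∀ m n, f (c m n) = c' (e m) (f n)) (T : M ⊗[ℝ] N) :
    f (TensorProduct.lift c T) = TensorProduct.lift c' (TensorProduct.congr e f T) := by
  induction T with
  | zero => simp
  | tmul m n => simp [h]
  | add x y hx hy => simp only [map_add, hx, hy]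

end LinearAlgebra

/-! ### Charts -/

section Chart

variable {A : Type u} {B : Type v} [DiffeologicalSpace A]

/-- A fibrewise isomorphism of `j^* E` with `E'` that is a diffeomorphism, in the sense that it
identifies the plots over `j ∘ q` with the plots over `q`. -/
def IsBundleChart {E : B → Type*} [∀ x, AddCommGroup (E x)] [∀ x, Module ℝ (E x)]
    [DiffeologicalSpace (Σ x, E x)] {E' : A → Type*} [∀ x, AddCommGroup (E' x)]
    [∀ x, Module ℝ (E' x)] [DiffeologicalSpace (Σ x, E' x)] (j : A → B)
    (φ : ∀ a, E (j a) ≃ₗ[ℝ] E' a) : Prop :=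
  ∀ (n : ℕ) (q : Eu n → A) (v : ∀ z, E (j (q z))), IsPlot q →
    (FPlot E (fun z => j (q z)) v ↔ FPlot E' q fun z => φ (q z) (v z))

variable {E : B → Type*} [∀ x, AddCommGroup (E x)] [∀ x, Module ℝ (E x)]
  [DiffeologicalSpace (Σ x, E x)] {E' : A → Type*} [∀ x, AddCommGroup (E' x)]
  [∀ x, Module ℝ (E' x)] [DiffeologicalSpace (Σ x, E' x)] {j : A → B}

/-- The section of `E'` corresponding to the restriction of a section of `E`. -/
def pullSec (φ : ∀ a, E (j a) ≃ₗ[ℝ] E' a) (s : ∀ b, E b) (a : A) : E' a := φ a (s (j a))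

variable {φ : ∀ a, E (j a) ≃ₗ[ℝ] E' a}

theorem IsBundleChart.dualPlot (hφ : IsBundleChart j φ) {n : ℕ} {q : Eu n → A} (hq : IsPlot q)
    {θ : ∀ z, E' (q z) →ₗ[ℝ] ℝ} (hθ : DualPlot E' q θ) :
    DualPlot E (fun z => j (q z)) fun z => (θ z).comp (φ (q z)).toLinearMap :=
  fun m a v ha hv => hθ m a _ ha ((hφ m (q ∘ a) v (isPlot_reparam hq ha)).1 hv)

theorem IsBundleChart.finrank_smoothDual (hφ : IsBundleChart j φ) (a : A) :
    Module.finrank ℝ (smoothDual E (j a)) = Module.finrank ℝ (smoothDual E' a) := by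
  rw [← LinearEquiv.finrank_map_eq (φ a).dualMap (smoothDual E' a)]
  suffices smoothDual E (j a) = (smoothDual E' a).map (φ a).dualMap.toLinearMap by rw [this]
  ext θ
  constructor
  · intro hθ
    refine ⟨θ.comp (φ a).symm.toLinearMap, fun n v hv => ?_, by ext; simp⟩
    exact hθ n (fun z => (φ a).symm (v z)) ((hφ n (fun _ => a) _ isPlot_const).2 (by simpa using hv))
  · rintro ⟨θ', hθ', rfl⟩ n v hv
    exact hθ' n (fun z => φ a (v z)) ((hφ n (fun _ => a) _ isPlot_const).1 hv)

variable [DiffeologicalSpace B]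

/-- A smooth map along which the pullback of values of 1-forms identifies `j^* Λ¹(B)`
with `Λ¹(A)`. -/
structure IsFormChart (j : A → B) : Prop where
  smooth : DSmooth j
  bijective : ∀ a, Function.Bijective (Lam.pull j smooth rfl : Lam B (j a) →ₗ[ℝ] Lam A a)
  fPlot_iff : IsBundleChart j fun a => LinearEquiv.ofBijective _ (bijective a)

/-- The isomorphism of values of 1-forms given by pullback along a chart. -/
def IsFormChart.equiv {j : A → B} (hj : IsFormChart j) (a : A) : Lam B (j a) ≃ₗ[ℝ] Lam A a :=
  LinearEquiv.ofBijective _ (hj.bijective a)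

theorem IsFormChart.isBundleChart {j : A → B} (hj : IsFormChart j) : IsBundleChart j hj.equiv :=
  hj.fPlot_iff

theorem IsFormChart.equiv_dSec {j : A → B} (hj : IsFormChart j) (a : A) {h : B → ℝ}
    (hh : DSmooth h) : hj.equiv a (dSec h (j a)) = dSec (fun a => h (j a)) a :=
  Lam.pull_dSec j hj.smooth rfl hh

/-- The operators correspond to each other on smooth sections. -/
def OpRelated (hj : IsFormChart j) (φ : ∀ a, E (j a) ≃ₗ[ℝ] E' a) (nab : Op E) (nab' : Op E') :
    Prop :=
  ∀ s, IsSmoothSec E s → ∀ a,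
    TensorProduct.congr (hj.equiv a) (φ a) (nab s (j a)) = nab' (pullSec φ s) a

theorem IsBundleChart.isSmoothSec (hφ : IsBundleChart j φ) (hj : DSmooth j) {s : ∀ b, E b}
    (hs : IsSmoothSec E s) : IsSmoothSec E' (pullSec φ s) :=
  fun n q hq => (hφ n q (fun z => s (j (q z))) hq).1 (hs.fPlot (hj n q hq))

theorem IsBundleChart.secPlot (hφ : IsBundleChart j φ) (hj : DSmooth j) {m : ℕ}
    {q : Eu m → ∀ b, E b} (hq : SecPlot E q) : SecPlot E' fun z => pullSec φ (q z) :=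
  fun k a p ha hp => (hφ k p (fun z => q (a z) (j (p z))) hp).1 (hq k a _ ha (hj k p hp))

theorem IsBundleChart.fPlot_tensor {F : B → Type*} [∀ x, AddCommGroup (F x)]
    [∀ x, Module ℝ (F x)] [DiffeologicalSpace (Σ x, F x)] {F' : A → Type*}
    [∀ x, AddCommGroup (F' x)] [∀ x, Module ℝ (F' x)] [DiffeologicalSpace (Σ x, F' x)]
    {ψ : ∀ a, F (j a) ≃ₗ[ℝ] F' a} (hj : DSmooth j) (hφ : IsBundleChart j φ)
    (hψ : IsBundleChart j ψ) {n : ℕ} {q : Eu n → A} {T : ∀ z, E (j (q z)) ⊗[ℝ] F (j (q z))}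
    (hT : FPlot (fun a => E' a ⊗[ℝ] F' a) q fun z =>
      TensorProduct.congr (φ (q z)) (ψ (q z)) (T z)) :
    FPlot (fun b => E b ⊗[ℝ] F b) (fun z => j (q z)) T := by
  refine isPlot_of_eventuallyEq fun u₀ => ?_
  obtain ⟨Q, ⟨b, k, a, c, hb, ha, hc, rfl⟩, e⟩ := hT u₀
  let Φ : (Σ a, E' a ⊗[ℝ] F' a) → Σ b, E b ⊗[ℝ] F b := fun t =>
    ⟨j t.1, (TensorProduct.congr (φ t.1) (ψ t.1)).symm t.2⟩
  refine ⟨fun z => ⟨j (b z), ∑ i, (φ (b z)).symm (a i z) ⊗ₜ[ℝ] (ψ (b z)).symm (c i z)⟩,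
    fun _ => ⟨_, ⟨fun z => j (b z), k, fun i z => (φ (b z)).symm (a i z),
      fun i z => (ψ (b z)).symm (c i z), hj _ b hb, fun i => ?_, fun i => ?_, rfl⟩,
      Filter.EventuallyEq.rfl⟩, ?_⟩
  · exact (hφ n b _ hb).2 (by simpa using ha i)
  · exact (hψ n b _ hb).2 (by simpa using hc i)
  · filter_upwards [e] with z hz
    have := congrArg Φ hz
    simpa only [Φ, LinearEquiv.symm_apply_apply, map_sum, TensorProduct.congr_symm_tmul] using this

theorem IsBundleChart.isSmoothDualSec (hφ : IsBundleChart j φ) (hj : DSmooth j)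
    {t : ∀ b, E b →ₗ[ℝ] ℝ} (ht : IsSmoothDualSec E t) :
    IsSmoothDualSec E' fun a => (t (j a)).comp (φ a).symm.toLinearMap :=
  fun n q hq m a v ha hv => ht n _ (hj n q hq) m a (fun z => (φ (q (a z))).symm (v z)) ha
    ((hφ m (fun z => q (a z)) _ (isPlot_reparam hq ha)).2 (by simpa using hv))

end Chart

/-! ### Covers by two charts -/

section Cover

variable {A₁ A₂ B : Type*} [DiffeologicalSpace A₁] [DiffeologicalSpace A₂] [DiffeologicalSpace B]

/-- Every plot of `B` lifts locally along `j₁` or along `j₂`. Locality is expressed by a smooth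
reparametrisation `r` that is the identity near the given point. -/
def IsCover (j₁ : A₁ → B) (j₂ : A₂ → B) : Prop :=
  ∀ (n : ℕ) (b : Eu n → B), IsPlot b → ∀ u₀, ∃ r : Eu n → Eu n, ContDiff ℝ ∞ r ∧ r =ᶠ[𝓝 u₀] id ∧
    ((∃ q : Eu n → A₁, IsPlot q ∧ (fun z => b (r z)) = fun z => j₁ (q z)) ∨
      ∃ q : Eu n → A₂, IsPlot q ∧ (fun z => b (r z)) = fun z => j₂ (q z))

variable {j₁ : A₁ → B} {j₂ : A₂ → B}

theorem IsCover.forall (h : IsCover j₁ j₂) {P : B → Prop} (h₁ : ∀ a, P (j₁ a))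
    (h₂ : ∀ a, P (j₂ a)) (b : B) : P b := by
  obtain ⟨r, -, -, ⟨q, -, e⟩ | ⟨q, -, e⟩⟩ := h 0 (fun _ => b) isPlot_const 0
  · rw [show b = j₁ (q 0) from congrFun e 0]
    exact h₁ _
  · rw [show b = j₂ (q 0) from congrFun e 0]
    exact h₂ _

theorem IsCover.exists_retract (h : IsCover j₁ j₂) {n : ℕ} {P : (Eu n → B) → Prop}
    (h₁ : ∀ q, IsPlot q → P fun z => j₁ (q z)) (h₂ : ∀ q, IsPlot q → P fun z => j₂ (q z))
    {b : Eu n → B} (hb : IsPlot b) (u₀ : Eu n) :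
    ∃ r : Eu n → Eu n, ContDiff ℝ ∞ r ∧ r =ᶠ[𝓝 u₀] id ∧ P fun z => b (r z) := by
  obtain ⟨r, hr, he, ⟨q, hq, e⟩ | ⟨q, hq, e⟩⟩ := h n b hb u₀
  · exact ⟨r, hr, he, e ▸ h₁ q hq⟩
  · exact ⟨r, hr, he, e ▸ h₂ q hq⟩

variable {E : B → Type*} [∀ x, AddCommGroup (E x)] [∀ x, Module ℝ (E x)]
  [DiffeologicalSpace (Σ x, E x)]
  {E₁ : A₁ → Type*} [∀ x, AddCommGroup (E₁ x)] [∀ x, Module ℝ (E₁ x)]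
  [DiffeologicalSpace (Σ x, E₁ x)]
  {E₂ : A₂ → Type*} [∀ x, AddCommGroup (E₂ x)] [∀ x, Module ℝ (E₂ x)]
  [DiffeologicalSpace (Σ x, E₂ x)]
  {φ₁ : ∀ a, E (j₁ a) ≃ₗ[ℝ] E₁ a} {φ₂ : ∀ a, E (j₂ a) ≃ₗ[ℝ] E₂ a}

theorem isPseudoBundle_of_cover (hcov : IsCover j₁ j₂)
    (hφ₁ : IsBundleChart j₁ φ₁) (hφ₂ : IsBundleChart j₂ φ₂)
    (hproj : DSmooth (Sigma.fst : (Σ b, E b) → B)) (hE₁ : IsPseudoBundle E₁)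
    (hE₂ : IsPseudoBundle E₂) : IsPseudoBundle E where
  proj := hproj
  zero n b hb := isPlot_of_retract <| by
    refine hcov.exists_retract (P := fun b => FPlot E b fun _ => 0) (fun q hq => ?_)
      (fun q hq => ?_) hb
    · refine (hφ₁ n q _ hq).2 ?_
      simp only [map_zero]
      exact hE₁.zero n q hq
    · refine (hφ₂ n q _ hq).2 ?_
      simp only [map_zero]
      exact hE₂.zero n q hq
  add n b v v' hv hv' := isPlot_of_retract fun u₀ => by
    obtain ⟨r, hr, he, h⟩ := hcov.exists_retract (P := fun b => ∀ v v', FPlot E b v →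
        FPlot E b v' → FPlot E b fun z => v z + v' z)
      (fun q hq v v' hv hv' => (hφ₁ n q _ hq).2 <| by
        simpa only [map_add] using
          hE₁.add n q _ _ ((hφ₁ n q _ hq).1 hv) ((hφ₁ n q _ hq).1 hv'))
      (fun q hq v v' hv hv' => (hφ₂ n q _ hq).2 <| by
        simpa only [map_add] using
          hE₂.add n q _ _ ((hφ₂ n q _ hq).1 hv) ((hφ₂ n q _ hq).1 hv')) (hproj n _ hv) u₀
    exact ⟨r, hr, he, h _ _ (isPlot_reparam hv hr) (isPlot_reparam hv' hr)⟩
  smul n b k v hk hv := isPlot_of_retract fun u₀ => by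
    obtain ⟨r, hr, he, h⟩ := hcov.exists_retract (P := fun b => ∀ (k : Eu n → ℝ) v,
        ContDiff ℝ ∞ k → FPlot E b v → FPlot E b fun z => k z • v z)
      (fun q hq k v hk hv => (hφ₁ n q _ hq).2 <| by
        simpa only [map_smul] using hE₁.smul n q _ _ hk ((hφ₁ n q _ hq).1 hv))
      (fun q hq k v hk hv => (hφ₂ n q _ hq).2 <| by
        simpa only [map_smul] using hE₂.smul n q _ _ hk ((hφ₂ n q _ hq).1 hv)) (hproj n _ hv) u₀
    exact ⟨r, hr, he, h _ _ (hk.comp hr) (isPlot_reparam hv hr)⟩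

end Cover

section Metric

variable {A B : Type*} [DiffeologicalSpace A] {j : A → B}
  {E : B → Type*} [∀ x, AddCommGroup (E x)] [∀ x, Module ℝ (E x)]
  [DiffeologicalSpace (Σ x, E x)]

/-- The smoothness condition of a pseudo-metric, over one plot of the base and near one point. -/
def MetricSmoothAt (g : ∀ x, E x →ₗ[ℝ] E x →ₗ[ℝ] ℝ) {n : ℕ} (u₀ : Eu n) (b : Eu n → B) : Prop :=
  ∃ (k : ℕ) (φ ψ : Fin k → ∀ z, E (b z) →ₗ[ℝ] ℝ), (∀ i, DualPlot E b (φ i)) ∧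
    (∀ i, DualPlot E b (ψ i)) ∧ ∀ᶠ z in 𝓝 u₀, ∀ e e', g (b z) e e' = ∑ i, φ i z e * ψ i z e'

theorem MetricSmoothAt.of_retract {g : ∀ x, E x →ₗ[ℝ] E x →ₗ[ℝ] ℝ} {n : ℕ} {u₀ : Eu n}
    {b : Eu n → B} {r : Eu n → Eu n} (hr : r =ᶠ[𝓝 u₀] id)
    (h : MetricSmoothAt g u₀ fun z => b (r z)) : MetricSmoothAt g u₀ b := by
  obtain ⟨k, θ, ψ, hθ, hψ, e⟩ := h
  choose θ' hθ' eθ using fun i => (hθ i).exists_extension hr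
  choose ψ' hψ' eψ using fun i => (hψ i).exists_extension hr
  refine ⟨k, θ', ψ', hθ', hψ', ?_⟩
  filter_upwards [e, hr, Filter.eventually_all.2 eθ, Filter.eventually_all.2 eψ] with z h1 h2 h3 h4
  have key : ∀ y, y = r z → y = z → ∀ e e', g (b y) e e' = ∑ i, θ' i y e * ψ' i y e' := by
    rintro y rfl - e e'
    rw [h1]
    simp only [h3, h4]
  exact key z (show r z = z from h2).symm rfl

variable {E' : A → Type*} [∀ x, AddCommGroup (E' x)] [∀ x, Module ℝ (E' x)]
  [DiffeologicalSpace (Σ x, E' x)] {φ : ∀ a, E (j a) ≃ₗ[ℝ] E' a}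

theorem IsBundleChart.metricSmoothAt (hφ : IsBundleChart j φ) {g : ∀ x, E x →ₗ[ℝ] E x →ₗ[ℝ] ℝ}
    {g' : ∀ x, E' x →ₗ[ℝ] E' x →ₗ[ℝ] ℝ}
    (hg : ∀ a e e', g (j a) e e' = g' a (φ a e) (φ a e')) (h : IsPseudoMetric E' g') {n : ℕ}
    (u₀ : Eu n) (q : Eu n → A) (hq : IsPlot q) : MetricSmoothAt g u₀ fun z => j (q z) := by
  obtain ⟨k, θ, ψ, hθ, hψ, e⟩ := h.smooth n q hq u₀
  refine ⟨k, _, _, fun i => hφ.dualPlot hq (hθ i), fun i => hφ.dualPlot hq (hψ i), ?_⟩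
  filter_upwards [e] with z hz e e'
  simp [hg, hz]

theorem IsBundleChart.metric_rank (hφ : IsBundleChart j φ) {g : ∀ x, E x →ₗ[ℝ] E x →ₗ[ℝ] ℝ}
    {g' : ∀ x, E' x →ₗ[ℝ] E' x →ₗ[ℝ] ℝ}
    (hg : ∀ a e e', g (j a) e e' = g' a (φ a e) (φ a e')) (h : IsPseudoMetric E' g') (a : A) :
    Module.finrank ℝ (LinearMap.ker (g (j a))) + Module.finrank ℝ (smoothDual E (j a)) =
      Module.finrank ℝ (E (j a)) := by
  have hk : (LinearMap.ker (g (j a))).map (φ a).toLinearMap = LinearMap.ker (g' a) := by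
    ext e
    simp only [Submodule.mem_map, LinearMap.mem_ker, LinearEquiv.coe_coe]
    constructor
    · rintro ⟨e, he, rfl⟩
      ext e'
      obtain ⟨e', rfl⟩ := (φ a).surjective e'
      rw [← hg, he]
      rfl
    · intro he
      refine ⟨(φ a).symm e, LinearMap.ext fun e' => ?_, by simp⟩
      rw [hg, LinearEquiv.apply_symm_apply, he]
      rfl
  rw [hφ.finrank_smoothDual, (φ a).finrank_eq, ← h.rank a, ← hk, LinearEquiv.finrank_map_eq]

end Metric

section Contraction

variable {A B : Type*} [DiffeologicalSpace A] [DiffeologicalSpace B] {j : A → B}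
  {E : B → Type*} [∀ x, AddCommGroup (E x)] [∀ x, Module ℝ (E x)]
  [DiffeologicalSpace (Σ x, E x)]
  {E' : A → Type*} [∀ x, AddCommGroup (E' x)] [∀ x, Module ℝ (E' x)]
  {φ : ∀ a, E (j a) ≃ₗ[ℝ] E' a}

theorem OpRelated.apply_eq {hj : IsFormChart j} {nab : Op E} {nab' : Op E'}
    (h : OpRelated hj φ nab nab') {s : ∀ b, E b} (hs : IsSmoothSec E s) (a : A)
    {T : Lam B (j a) ⊗[ℝ] E (j a)}
    (hT : TensorProduct.congr (hj.equiv a) (φ a) T = nab' (pullSec φ s) a) : nab s (j a) = T :=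
  (TensorProduct.congr (hj.equiv a) (φ a)).injective (by rw [h s hs, hT])

/-- The contraction of a connection with a section of the dual, in a chart. -/
theorem OpRelated.covD {hj : IsFormChart j} {nab : Op E} {nab' : Op E'}
    (h : OpRelated hj φ nab nab') {s : ∀ b, E b} (hs : IsSmoothSec E s)
    {t : ∀ b, Lam B b →ₗ[ℝ] ℝ} {t' : ∀ a, Lam A a →ₗ[ℝ] ℝ}
    (ht : ∀ a α, t' a (hj.equiv a α) = t (j a) α) (a : A) :
    φ a (covD t (nab s) (j a)) = covD t' (nab' (pullSec φ s)) a := by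
  rw [DiffDirac.covD, lid_rTensor_congr (hj.equiv a) (φ a) _ _ (ht a), h s hs]
  rfl

end Contraction

section Transfer

variable {A B : Type*} [DiffeologicalSpace A] [DiffeologicalSpace B] {j : A → B}
  {E : B → Type*} [∀ x, AddCommGroup (E x)] [∀ x, Module ℝ (E x)]
  [DiffeologicalSpace (Σ x, E x)]
  {E' : A → Type*} [∀ x, AddCommGroup (E' x)] [∀ x, Module ℝ (E' x)]
  [DiffeologicalSpace (Σ x, E' x)]
  {φ : ∀ a, E (j a) ≃ₗ[ℝ] E' a}

/-- The data of a Dirac operator over `B` correspond, along a chart, to such data over `A`. -/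
structure IsDiracChart (hj : IsFormChart j) (φ : ∀ a, E (j a) ≃ₗ[ℝ] E' a)
    (gL : ∀ x, Lam B x →ₗ[ℝ] Lam B x →ₗ[ℝ] ℝ) (nabL : Op (Lam B))
    (c : ∀ x, Lam B x →ₗ[ℝ] E x →ₗ[ℝ] E x) (g : ∀ x, E x →ₗ[ℝ] E x →ₗ[ℝ] ℝ) (nab : Op E)
    (gL' : ∀ x, Lam A x →ₗ[ℝ] Lam A x →ₗ[ℝ] ℝ) (nabL' : Op (Lam A))
    (c' : ∀ x, Lam A x →ₗ[ℝ] E' x →ₗ[ℝ] E' x) (g' : ∀ x, E' x →ₗ[ℝ] E' x →ₗ[ℝ] ℝ)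
    (nab' : Op E') : Prop where
  bundle : IsBundleChart j φ
  metric_lam : ∀ a α β, gL (j a) α β = gL' a (hj.equiv a α) (hj.equiv a β)
  conn_lam : OpRelated hj hj.equiv nabL nabL'
  action : ∀ a α e, φ a (c (j a) α e) = c' a (hj.equiv a α) (φ a e)
  metric : ∀ a e e', g (j a) e e' = g' a (φ a e) (φ a e')
  conn : OpRelated hj φ nab nab'

theorem OpRelated.fPlot {hj : IsFormChart j} (hφ : IsBundleChart j φ) {nab : Op E} {nab' : Op E'}
    (h : OpRelated hj φ nab nab') (hc : IsConnection E' nab') {n m : ℕ} {s : Eu m → ∀ b, E b}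
    (hs : SecPlot E s) {q : Eu n → A} (hq : IsPlot q) {a : Eu n → Eu m} (ha : ContDiff ℝ ∞ a) :
    FPlot (fun b => Lam B b ⊗[ℝ] E b) (fun z => j (q z)) fun z => nab (s (a z)) (j (q z)) := by
  refine IsBundleChart.fPlot_tensor hj.smooth hj.isBundleChart hφ ?_
  have := hc.smooth m _ (hφ.secPlot hj.smooth hs) n a q ha hq
  have e : ∀ z, TensorProduct.congr (hj.equiv (q z)) (φ (q z)) (nab (s (a z)) (j (q z))) =
      nab' (pullSec φ (s (a z))) (q z) := fun z => h _ (hs.isSmoothSec (a z)) _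
  simp only [← e] at this
  exact this

theorem OpRelated.leibniz {hj : IsFormChart j} {nab : Op E} {nab' : Op E'}
    (h : OpRelated hj φ nab nab') (hφ : IsBundleChart j φ) (hE : IsPseudoBundle E)
    (hc : IsConnection E' nab') {k : B → ℝ} {s : ∀ b, E b} (hk : DSmooth k)
    (hs : IsSmoothSec E s) (a : A) :
    nab (fun x => k x • s x) (j a) = dSec k (j a) ⊗ₜ[ℝ] s (j a) + k (j a) • nab s (j a) := by
  refine h.apply_eq (hs.smul hE hk) a ?_
  have := hc.leibniz (fun a => k (j a)) _ (hk.comp hj.smooth) (hφ.isSmoothSec hj.smooth hs) a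
  have e : pullSec φ (fun x => k x • s x) = fun a => k (j a) • pullSec φ s a := by
    funext a
    simp [pullSec]
  rw [e, this, map_add, map_smul, h s hs, TensorProduct.congr_tmul, hj.equiv_dSec a hk]
  rfl

theorem OpRelated.add {hj : IsFormChart j} {nab : Op E} {nab' : Op E'}
    (h : OpRelated hj φ nab nab') (hφ : IsBundleChart j φ) (hE : IsPseudoBundle E)
    (hc : IsConnection E' nab') {s s' : ∀ b, E b} (hs : IsSmoothSec E s)
    (hs' : IsSmoothSec E s') (a : A) : nab (s + s') (j a) = (nab s + nab s') (j a) := by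
  refine h.apply_eq (hs.add hE hs') a ?_
  have e : pullSec φ (s + s') = pullSec φ s + pullSec φ s' := by
    funext a
    simp [pullSec]
  rw [e, hc.add _ _ (hφ.isSmoothSec hj.smooth hs) (hφ.isSmoothSec hj.smooth hs'), Pi.add_apply,
    Pi.add_apply, map_add, h s hs, h s' hs']

theorem OpRelated.smul {hj : IsFormChart j} {nab : Op E} {nab' : Op E'}
    (h : OpRelated hj φ nab nab') (hφ : IsBundleChart j φ) (hE : IsPseudoBundle E)
    (hc : IsConnection E' nab') (k : ℝ) {s : ∀ b, E b} (hs : IsSmoothSec E s) (a : A) :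
    nab (k • s) (j a) = (k • nab s) (j a) := by
  refine h.apply_eq (hs.smul hE dSmooth_const) a ?_
  have e : pullSec φ (k • s) = k • pullSec φ s := by
    funext a
    simp [pullSec]
  change _ = nab' (pullSec φ (k • s)) a
  rw [e, hc.smul _ _ (hφ.isSmoothSec hj.smooth hs), Pi.smul_apply, Pi.smul_apply, map_smul, h s hs]

theorem OpRelated.metricCompatible {hj : IsFormChart j} {nab : Op E} {nab' : Op E'}
    (h : OpRelated hj φ nab nab') (hφ : IsBundleChart j φ) {g : ∀ x, E x →ₗ[ℝ] E x →ₗ[ℝ] ℝ}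
    {g' : ∀ x, E' x →ₗ[ℝ] E' x →ₗ[ℝ] ℝ}
    (hg : ∀ a e e', g (j a) e e' = g' a (φ a e) (φ a e')) (hgs : IsPseudoMetric E g)
    (hm : IsMetricCompatible E' g' nab') {s t : ∀ b, E b} (hs : IsSmoothSec E s)
    (ht : IsSmoothSec E t) (a : A) :
    dSec (fun x => g x (s x) (t x)) (j a) =
      TensorProduct.rid ℝ _ (LinearMap.lTensor _ ((g (j a)).flip (t (j a))) (nab s (j a))) +
      TensorProduct.rid ℝ _ (LinearMap.lTensor _ (g (j a) (s (j a))) (nab t (j a))) := by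
  apply (hj.equiv a).injective
  rw [map_add, hj.equiv_dSec a (hgs.dSmooth hs ht),
    rid_lTensor_congr (hj.equiv a) (φ a) (k' := (g' a).flip (pullSec φ t a))
      (k := (g (j a)).flip (t (j a)))
      (fun e => (hg a e (t (j a))).symm),
    rid_lTensor_congr (hj.equiv a) (φ a) _ (g' a (pullSec φ s a)) (fun e => (hg a _ e).symm),
    h s hs, h t ht,
    ← hm _ _ (hφ.isSmoothSec hj.smooth hs) (hφ.isSmoothSec hj.smooth ht) a]
  simp only [hg]
  rfl

theorem dirD_chart (hj : IsFormChart j) {g : ∀ x, Lam B x →ₗ[ℝ] Lam B x →ₗ[ℝ] ℝ}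
    {g' : ∀ x, Lam A x →ₗ[ℝ] Lam A x →ₗ[ℝ] ℝ}
    (hg : ∀ a α β, g (j a) α β = g' a (hj.equiv a α) (hj.equiv a β)) (s : ∀ b, Lam B b)
    {h : B → ℝ} (hh : DSmooth h) (a : A) :
    dirD g s h (j a) = dirD g' (pullSec hj.equiv s) (fun a => h (j a)) a := by
  rw [dirD, hg, hj.equiv_dSec a hh]
  rfl

theorem OpRelated.symmetric {hj : IsFormChart j} {nab : Op (Lam B)} {nab' : Op (Lam A)}
    (h : OpRelated hj hj.equiv nab nab') {g : ∀ x, Lam B x →ₗ[ℝ] Lam B x →ₗ[ℝ] ℝ}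
    {g' : ∀ x, Lam A x →ₗ[ℝ] Lam A x →ₗ[ℝ] ℝ}
    (hg : ∀ a α β, g (j a) α β = g' a (hj.equiv a α) (hj.equiv a β))
    (hgs : IsPseudoMetric (Lam B) g) (hm : IsSymmetric g' nab') {s s' : ∀ b, Lam B b}
    (hs : IsSmoothSec (Lam B) s) (hs' : IsSmoothSec (Lam B) s') {k : B → ℝ} (hk : DSmooth k)
    (a : A) :
    g (j a) (DiffDirac.covD (fun x => g x (s x)) (nab s') (j a) -
        DiffDirac.covD (fun x => g x (s' x)) (nab s) (j a)) (dSec k (j a)) =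
      dirD g s (dirD g s' k) (j a) - dirD g s' (dirD g s k) (j a) := by
  have e : ∀ s : ∀ b, Lam B b, (fun a => dirD g s k (j a)) =
      dirD g' (pullSec hj.equiv s) fun a => k (j a) := fun s =>
    funext fun a => dirD_chart hj hg s hk a
  have hd : ∀ s : ∀ b, Lam B b, IsSmoothSec (Lam B) s → DSmooth (dirD g s k) := fun s hs =>
    hgs.dSmooth hs (isSmoothSec_dSec hk)
  rw [dirD_chart hj hg s (hd s' hs'), dirD_chart hj hg s' (hd s hs), e, e,
    ← hm _ _ (hj.isBundleChart.isSmoothSec hj.smooth hs)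
      (hj.isBundleChart.isSmoothSec hj.smooth hs') (fun a => k (j a)) (hk.comp hj.smooth) a,
    hg, hj.equiv_dSec a hk, map_sub,
    h.covD hs' (t' := fun a => g' a (pullSec hj.equiv s a)) (fun a α => (hg a _ _).symm) a,
    h.covD hs (t' := fun a => g' a (pullSec hj.equiv s' a)) (fun a α => (hg a _ _).symm) a]

variable {hj : IsFormChart j} {gL : ∀ x, Lam B x →ₗ[ℝ] Lam B x →ₗ[ℝ] ℝ} {nabL : Op (Lam B)}
  {c : ∀ x, Lam B x →ₗ[ℝ] E x →ₗ[ℝ] E x} {g : ∀ x, E x →ₗ[ℝ] E x →ₗ[ℝ] ℝ} {nab : Op E}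
  {gL' : ∀ x, Lam A x →ₗ[ℝ] Lam A x →ₗ[ℝ] ℝ} {nabL' : Op (Lam A)}
  {c' : ∀ x, Lam A x →ₗ[ℝ] E' x →ₗ[ℝ] E' x} {g' : ∀ x, E' x →ₗ[ℝ] E' x →ₗ[ℝ] ℝ}
  {nab' : Op E'}

theorem IsDiracChart.cliffordConnection
    (h : IsDiracChart hj φ gL nabL c g nab gL' nabL' c' g' nab') (hc : IsSmoothAction c)
    (hm : IsCliffordConnection E' nabL' c' nab') {t : ∀ x, Lam B x →ₗ[ℝ] ℝ} {s : ∀ x, Lam B x}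
    {r : ∀ x, E x} (ht : IsSmoothDualSec (Lam B) t) (hs : IsSmoothSec (Lam B) s)
    (hr : IsSmoothSec E r) (a : A) :
    covD t (nab fun x => c x (s x) (r x)) (j a) =
      c (j a) (covD t (nabL s) (j a)) (r (j a)) + c (j a) (s (j a)) (covD t (nab r) (j a)) := by
  have hcs : IsSmoothSec E fun x => c x (s x) (r x) := fun n b hb =>
    hc n b _ _ hb (hs.fPlot hb) (hr.fPlot hb)
  have ht' : ∀ a α, (t (j a)).comp (hj.equiv a).symm.toLinearMap (hj.equiv a α) = t (j a) α := by
    simp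
  have e : pullSec φ (fun x => c x (s x) (r x)) =
      fun a => c' a (pullSec hj.equiv s a) (pullSec φ r a) := funext fun a => h.action a _ _
  apply (φ a).injective
  rw [map_add, h.action, h.action, h.conn.covD hcs ht', h.conn_lam.covD hs ht', h.conn.covD hr ht',
    e, hm _ _ _ (hj.isBundleChart.isSmoothDualSec hj.smooth ht)
      (hj.isBundleChart.isSmoothSec hj.smooth hs) (h.bundle.isSmoothSec hj.smooth hr) a]
  rfl

theorem IsDiracChart.diracOp (h : IsDiracChart hj φ gL nabL c g nab gL' nabL' c' g' nab')
    {s : ∀ x, E x} (hs : IsSmoothSec E s) (a : A) :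
    φ a (diracOp c nab s (j a)) = diracOp c' nab' (pullSec φ s) a := by
  rw [DiffDirac.diracOp, lift_congr (hj.equiv a) (φ a) _ _ (h.action a), h.conn s hs]
  rfl

theorem IsDiracChart.fPlot_action (h : IsDiracChart hj φ gL nabL c g nab gL' nabL' c' g' nab')
    (hc : IsSmoothAction c') {n : ℕ} {q : Eu n → A} (hq : IsPlot q) {α : ∀ z, Lam B (j (q z))}
    {e : ∀ z, E (j (q z))} (hα : FPlot (Lam B) (fun z => j (q z)) α)
    (he : FPlot E (fun z => j (q z)) e) :
    FPlot E (fun z => j (q z)) fun z => c (j (q z)) (α z) (e z) := by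
  refine (h.bundle n q _ hq).2 ?_
  simp only [h.action]
  exact hc n q _ _ hq ((hj.isBundleChart n q _ hq).1 hα) ((h.bundle n q _ hq).1 he)

end Transfer

section DiracCover

variable {A₁ A₂ B : Type*} [DiffeologicalSpace A₁] [DiffeologicalSpace A₂] [DiffeologicalSpace B]
  {j₁ : A₁ → B} {j₂ : A₂ → B}
  {E : B → Type*} [∀ x, AddCommGroup (E x)] [∀ x, Module ℝ (E x)]
  [DiffeologicalSpace (Σ x, E x)]
  {E₁ : A₁ → Type*} [∀ x, AddCommGroup (E₁ x)] [∀ x, Module ℝ (E₁ x)]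
  [DiffeologicalSpace (Σ x, E₁ x)]
  {E₂ : A₂ → Type*} [∀ x, AddCommGroup (E₂ x)] [∀ x, Module ℝ (E₂ x)]
  [DiffeologicalSpace (Σ x, E₂ x)]
  {φ₁ : ∀ a, E (j₁ a) ≃ₗ[ℝ] E₁ a} {φ₂ : ∀ a, E (j₂ a) ≃ₗ[ℝ] E₂ a}

theorem isPseudoMetric_of_cover (hcov : IsCover j₁ j₂) (hφ₁ : IsBundleChart j₁ φ₁)
    (hφ₂ : IsBundleChart j₂ φ₂) {g : ∀ x, E x →ₗ[ℝ] E x →ₗ[ℝ] ℝ}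
    {g₁ : ∀ x, E₁ x →ₗ[ℝ] E₁ x →ₗ[ℝ] ℝ} {g₂ : ∀ x, E₂ x →ₗ[ℝ] E₂ x →ₗ[ℝ] ℝ}
    (hg₁ : ∀ a e e', g (j₁ a) e e' = g₁ a (φ₁ a e) (φ₁ a e'))
    (hg₂ : ∀ a e e', g (j₂ a) e e' = g₂ a (φ₂ a e) (φ₂ a e'))
    (h₁ : IsPseudoMetric E₁ g₁) (h₂ : IsPseudoMetric E₂ g₂) : IsPseudoMetric E g where
  symm := hcov.forall (fun a e e' => by rw [hg₁, hg₁, h₁.symm])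
    fun a e e' => by rw [hg₂, hg₂, h₂.symm]
  nonneg := hcov.forall (fun a e => by rw [hg₁]; exact h₁.nonneg _ _)
    fun a e => by rw [hg₂]; exact h₂.nonneg _ _
  rank := hcov.forall (fun a => hφ₁.metric_rank hg₁ h₁ a) fun a => hφ₂.metric_rank hg₂ h₂ a
  smooth n b hb u₀ := by
    obtain ⟨r, -, he, h⟩ := hcov.exists_retract (P := MetricSmoothAt g u₀)
      (hφ₁.metricSmoothAt hg₁ h₁ u₀) (hφ₂.metricSmoothAt hg₂ h₂ u₀) hb u₀
    exact h.of_retract he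

theorem isConnection_of_cover (hcov : IsCover j₁ j₂) {hj₁ : IsFormChart j₁} {hj₂ : IsFormChart j₂}
    (hφ₁ : IsBundleChart j₁ φ₁) (hφ₂ : IsBundleChart j₂ φ₂) (hE : IsPseudoBundle E)
    {nab : Op E} {nab₁ : Op E₁} {nab₂ : Op E₂} (h₁ : OpRelated hj₁ φ₁ nab nab₁)
    (h₂ : OpRelated hj₂ φ₂ nab nab₂) (hc₁ : IsConnection E₁ nab₁) (hc₂ : IsConnection E₂ nab₂) :
    IsConnection E nab := by
  have hsm : ∀ (m : ℕ) (q : Eu m → ∀ x, E x), SecPlot E q →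
      SecPlot (fun x => Lam B x ⊗[ℝ] E x) fun z => nab (q z) := by
    intro m s hs k a p ha hp
    refine isPlot_of_retract fun u₀ => ?_
    obtain ⟨r, hr, he, h⟩ := hcov.exists_retract (P := fun b => ∀ a : Eu k → Eu m, ContDiff ℝ ∞ a →
      FPlot (fun x => Lam B x ⊗[ℝ] E x) b fun z => nab (s (a z)) (b z))
      (fun q hq a ha => h₁.fPlot hφ₁ hc₁ hs hq ha) (fun q hq a ha => h₂.fPlot hφ₂ hc₂ hs hq ha)
      hp u₀
    exact ⟨r, hr, he, h (fun z => a (r z)) (ha.comp hr)⟩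
  refine ⟨fun s hs n p hp => ?_, fun s s' hs hs' => ?_, fun k s hs => ?_,
    fun k s hk hs => ?_, hsm⟩
  · exact hsm 0 (fun _ => s) (fun k a p _ hp => hs.fPlot hp) n (fun _ => 0) p contDiff_const hp
  · exact funext (hcov.forall (h₁.add hφ₁ hE hc₁ hs hs') (h₂.add hφ₂ hE hc₂ hs hs'))
  · exact funext (hcov.forall (h₁.smul hφ₁ hE hc₁ k hs) (h₂.smul hφ₂ hE hc₂ k hs))
  · exact hcov.forall (h₁.leibniz hφ₁ hE hc₁ hk hs) (h₂.leibniz hφ₂ hE hc₂ hk hs)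

variable {hj₁ : IsFormChart j₁} {hj₂ : IsFormChart j₂}
  {gL : ∀ x, Lam B x →ₗ[ℝ] Lam B x →ₗ[ℝ] ℝ} {nabL : Op (Lam B)}
  {c : ∀ x, Lam B x →ₗ[ℝ] E x →ₗ[ℝ] E x} {g : ∀ x, E x →ₗ[ℝ] E x →ₗ[ℝ] ℝ} {nab : Op E}
  {gL₁ : ∀ x, Lam A₁ x →ₗ[ℝ] Lam A₁ x →ₗ[ℝ] ℝ} {nabL₁ : Op (Lam A₁)}
  {c₁ : ∀ x, Lam A₁ x →ₗ[ℝ] E₁ x →ₗ[ℝ] E₁ x} {g₁ : ∀ x, E₁ x →ₗ[ℝ] E₁ x →ₗ[ℝ] ℝ}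
  {nab₁ : Op E₁}
  {gL₂ : ∀ x, Lam A₂ x →ₗ[ℝ] Lam A₂ x →ₗ[ℝ] ℝ} {nabL₂ : Op (Lam A₂)}
  {c₂ : ∀ x, Lam A₂ x →ₗ[ℝ] E₂ x →ₗ[ℝ] E₂ x} {g₂ : ∀ x, E₂ x →ₗ[ℝ] E₂ x →ₗ[ℝ] ℝ}
  {nab₂ : Op E₂}

/-- Being the data of a Dirac operator is local: it can be checked in charts. -/
theorem isDiracData_of_cover (hcov : IsCover j₁ j₂)
    (H₁ : IsDiracChart hj₁ φ₁ gL nabL c g nab gL₁ nabL₁ c₁ g₁ nab₁)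
    (H₂ : IsDiracChart hj₂ φ₂ gL nabL c g nab gL₂ nabL₂ c₂ g₂ nab₂)
    (hE : IsPseudoBundle E) (h₁ : IsDiracData E₁ gL₁ nabL₁ c₁ g₁ nab₁)
    (h₂ : IsDiracData E₂ gL₂ nabL₂ c₂ g₂ nab₂) : IsDiracData E gL nabL c g nab := by
  have hL₁ := hj₁.isBundleChart
  have hL₂ := hj₂.isBundleChart
  have hmL : IsPseudoMetric (Lam B) gL :=
    isPseudoMetric_of_cover hcov hL₁ hL₂ H₁.metric_lam H₂.metric_lam h₁.metric_lam h₂.metric_lam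
  have hm : IsPseudoMetric E g :=
    isPseudoMetric_of_cover hcov H₁.bundle H₂.bundle H₁.metric H₂.metric h₁.metric h₂.metric
  have hact : IsSmoothAction c := by
    intro n b α e hb hα he
    refine isPlot_of_retract fun u₀ => ?_
    obtain ⟨r, hr, hre, h⟩ := hcov.exists_retract (P := fun b => ∀ α e, FPlot (Lam B) b α →
      FPlot E b e → FPlot E b fun z => c (b z) (α z) (e z))
      (fun q hq α e hα he => H₁.fPlot_action h₁.action.isSmoothAction hq hα he)
      (fun q hq α e hα he => H₂.fPlot_action h₂.action.isSmoothAction hq hα he) hb u₀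
    exact ⟨r, hr, hre, h _ _ (isPlot_reparam hα hr) (isPlot_reparam he hr)⟩
  refine ⟨?_, hmL, ⟨?_, ?_, ?_⟩, hE, ?_, ?_, hm, ?_, ?_, ?_⟩
  · refine hcov.forall (fun a => ?_) fun a => ?_
    · have := h₁.finite_lam a
      exact Module.Finite.equiv (hj₁.equiv a).symm
    · have := h₂.finite_lam a
      exact Module.Finite.equiv (hj₂.equiv a).symm
  · exact isConnection_of_cover hcov hL₁ hL₂ isPseudoBundle_lam H₁.conn_lam H₂.conn_lam
      h₁.leviCivita.conn h₂.leviCivita.conn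
  · exact fun s t hs ht => hcov.forall
      (H₁.conn_lam.metricCompatible hL₁ H₁.metric_lam hmL h₁.leviCivita.metric hs ht)
      (H₂.conn_lam.metricCompatible hL₂ H₂.metric_lam hmL h₂.leviCivita.metric hs ht)
  · exact fun s s' hs hs' k hk => hcov.forall
      (H₁.conn_lam.symmetric H₁.metric_lam hmL h₁.leviCivita.symm hs hs' hk)
      (H₂.conn_lam.symmetric H₂.metric_lam hmL h₂.leviCivita.symm hs hs' hk)
  · refine hcov.forall (fun a => ?_) fun a => ?_
    · have := h₁.finite a
      exact Module.Finite.equiv (φ₁ a).symm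
    · have := h₂.finite a
      exact Module.Finite.equiv (φ₂ a).symm
  · refine isCliffordAction_of_sq hE hact (hcov.forall (fun a α e => ?_) fun a α e => ?_)
    · apply (φ₁ a).injective
      rw [H₁.action, H₁.action, h₁.action.sq, map_smul, H₁.metric_lam]
    · apply (φ₂ a).injective
      rw [H₂.action, H₂.action, h₂.action.sq, map_smul, H₂.metric_lam]
  · exact isConnection_of_cover hcov H₁.bundle H₂.bundle hE H₁.conn H₂.conn h₁.conn h₂.conn
  · exact fun t s r ht hs hr => hcov.forall
      (H₁.cliffordConnection hact h₁.clifford ht hs hr)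
      (H₂.cliffordConnection hact h₂.clifford ht hs hr)
  · exact fun s t hs ht => hcov.forall
      (H₁.conn.metricCompatible H₁.bundle H₁.metric hm h₁.compatible hs ht)
      (H₂.conn.metricCompatible H₂.bundle H₂.metric hm h₂.compatible hs ht)

theorem isUnitaryAction_of_cover (hcov : IsCover j₁ j₂)
    (H₁ : IsDiracChart hj₁ φ₁ gL nabL c g nab gL₁ nabL₁ c₁ g₁ nab₁)
    (H₂ : IsDiracChart hj₂ φ₂ gL nabL c g nab gL₂ nabL₂ c₂ g₂ nab₂)
    (h₁ : IsUnitaryAction E₁ gL₁ c₁ g₁) (h₂ : IsUnitaryAction E₂ gL₂ c₂ g₂) :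
    IsUnitaryAction E gL c g := by
  refine hcov.forall (fun a α hα e e' => ?_) fun a α hα e e' => ?_
  · rw [H₁.metric_lam] at hα
    rw [H₁.metric, H₁.metric, H₁.action, H₁.action, h₁ a _ hα]
  · rw [H₂.metric_lam] at hα
    rw [H₂.metric, H₂.metric, H₂.action, H₂.action, h₂ a _ hα]

end DiracCover

/-! ### Lifting 1-forms -/

section Lift

variable {A B C : Type*} [DiffeologicalSpace A] [DiffeologicalSpace B] [DiffeologicalSpace C]

/-- A smooth map is a chart for values of 1-forms if pullback along it is injective on these and
plots of 1-forms lift locally; surjectivity is the case of constant plots. -/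
theorem isFormChart_of_lift {j : A → B} (hj : DSmooth j)
    (hinj : ∀ a, Function.Injective (Lam.pull j hj rfl : Lam B (j a) →ₗ[ℝ] Lam A a))
    (hlift : ∀ (n : ℕ) (η : Eu n → Om A), IsPlot η → ∀ u₀, ∃ ζ : Eu n → Om B, IsPlot ζ ∧
      ∀ᶠ z in 𝓝 u₀, Om.pull j hj (ζ z) = η z) : IsFormChart j where
  smooth := hj
  bijective a := by
    refine ⟨hinj a, fun α => ?_⟩
    obtain ⟨η, rfl⟩ := Lam.mk_surjective a α
    obtain ⟨ζ, -, h⟩ := hlift 0 (fun _ => η) isPlot_const 0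
    refine ⟨Lam.mk (j a) (ζ 0), ?_⟩
    rw [Lam.pull_mk, h.self_of_nhds]
  fPlot_iff n q v hq := by
    constructor
    · refine fun h => isPlot_of_eventuallyEq fun u₀ => ?_
      obtain ⟨ζ, hζ, e⟩ := FPlot.exists_mk h u₀
      refine ⟨_, fPlot_mk hq (Om.isPlot_pull j hj hζ), ?_⟩
      filter_upwards [e] with z hz
      rw [hz]
      rfl
    · refine fun h => isPlot_of_eventuallyEq fun u₀ => ?_
      obtain ⟨η, hη, e⟩ := FPlot.exists_mk h u₀
      obtain ⟨ζ, hζ, e'⟩ := hlift n η hη u₀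
      refine ⟨_, fPlot_mk (hj n q hq) hζ, ?_⟩
      filter_upwards [e, e'] with z hz hz'
      have : v z = Lam.mk (j (q z)) (ζ z) := hinj (q z) <| by
        rw [Lam.pull_mk, hz', ← hz]
        rfl
      rw [this]
      rfl

variable {φ : C → A} {ψ : C → B} {hφ : DSmooth φ} {hψ : DSmooth ψ}

/-- Equality of the pushforward diffeologies forces equality of the ranges, although constant maps
are plots whatever their value: the line through `φ^* η` is a plot that is not locally constant,
unless `φ^* η` is zero. -/
theorem exists_pull_eq (h : pushforward (Om.pull φ hφ) = pushforward (Om.pull ψ hψ)) (η : Om A) :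
    ∃ θ : Om B, Om.pull φ hφ η = Om.pull ψ hψ θ := by
  let t : Eu 1 → ℝ := fun z => z 0
  have ht : ContDiff ℝ ∞ t := (EuclideanSpace.proj (𝕜 := ℝ) (0 : Fin 1)).contDiff
  have hη : IsPlot fun z => t z • η := fun n p =>
    (ht.comp contDiff_fst).smul ((η.2.1 n p).comp contDiff_snd)
  have h1 : @IsPlot _ (pushforward (Om.pull φ hφ)) 1 (Om.pull φ hφ ∘ fun z => t z • η) :=
    fun u₀ => ⟨_, Or.inl ⟨_, hη, rfl⟩, Filter.EventuallyEq.rfl⟩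
  rw [h] at h1
  obtain ⟨q, hq, e⟩ := h1 0
  let pt : ℝ → Eu 1 := fun s => s • EuclideanSpace.single (0 : Fin 1) (1 : ℝ)
  have ht1 : ∀ s, t (pt s) = s := fun s => by simp [t, pt]
  have hray : Filter.Tendsto pt (𝓝 0) (𝓝 0) := by
    have hc : Continuous pt := by fun_prop
    simpa [pt] using hc.tendsto 0
  obtain ⟨s, hs, hs0⟩ : ∃ s : ℝ, Om.pull φ hφ (t (pt s) • η) = q (pt s) ∧ s ≠ 0 := by
    have h2 := (hray.eventually e).filter_mono (nhdsWithin_le_nhds (s := {0}ᶜ))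
    exact (h2.and self_mem_nhdsWithin).exists
  rw [ht1, map_smul] at hs
  rcases hq with ⟨p, -, rfl⟩ | ⟨x, rfl⟩
  · exact ⟨s⁻¹ • p (pt s), by rw [map_smul, ← inv_smul_smul₀ hs0 (Om.pull φ hφ η), hs]; rfl⟩
  · refine ⟨0, ?_⟩
    have h0 : Om.pull φ hφ (t 0 • η) = x := e.self_of_nhds
    rw [show t 0 = 0 from rfl, zero_smul, map_zero] at h0
    rw [map_zero]
    exact (smul_eq_zero.1 (hs.trans h0.symm)).resolve_left hs0

/-- Plots of pullbacks from `A` are locally plots of pullbacks from `B`. -/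
theorem exists_local_lift (h : pushforward (Om.pull φ hφ) = pushforward (Om.pull ψ hψ)) {n : ℕ}
    {η : Eu n → Om A} (hη : IsPlot η) (u₀ : Eu n) :
    ∃ θ : Eu n → Om B, IsPlot θ ∧ ∀ᶠ z in 𝓝 u₀, Om.pull φ hφ (η z) = Om.pull ψ hψ (θ z) := by
  have h1 : @IsPlot _ (pushforward (Om.pull φ hφ)) n (Om.pull φ hφ ∘ η) :=
    fun u₀ => ⟨_, Or.inl ⟨_, hη, rfl⟩, Filter.EventuallyEq.rfl⟩
  rw [h] at h1
  obtain ⟨q, ⟨θ, hθ, rfl⟩ | ⟨x, rfl⟩, e⟩ := h1 u₀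
  · exact ⟨θ, hθ, e⟩
  · obtain ⟨θ, hθ⟩ := exists_pull_eq h (η u₀)
    refine ⟨fun _ => θ, isPlot_const, ?_⟩
    filter_upwards [e] with z hz
    rw [← hθ]
    exact hz.trans e.self_of_nhds.symm

end Lift

/-! ### 1-forms on the glued space -/

section Points

variable {X₁ : Type u} {X₂ : Type v} {Y : Set X₁} {f : Y → X₂}

theorem Glue.inOne_eq_right_iff {x : X₁} {x' : X₂} :
    Glue.inOne Y f x = Glue.right x' ↔ ∃ h : x ∈ Y, f ⟨x, h⟩ = x' := by
  by_cases hx : x ∈ Y <;> simp [Glue.inOne, hx]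

theorem Glue.inOne_eq_left_iff {x x' : X₁} {h : x' ∉ Y} :
    Glue.inOne Y f x = Glue.left x' h ↔ x = x' := by
  by_cases hx : x ∈ Y
  · simp only [Glue.inOne, hx, dite_true, reduceCtorEq, false_iff]
    rintro rfl
    exact h hx
  · simp [Glue.inOne, hx]

theorem Glue.inOne_injective (hf : Function.Injective f) :
    Function.Injective (Glue.inOne Y f) := by
  intro x x' h
  by_cases hx : x' ∈ Y
  · rw [show Glue.inOne Y f x' = Glue.right (f ⟨x', hx⟩) from dif_pos hx,
      Glue.inOne_eq_right_iff] at h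
    obtain ⟨hx', e⟩ := h
    exact congrArg Subtype.val (hf e)
  · rwa [show Glue.inOne Y f x' = Glue.left x' hx from dif_neg hx, Glue.inOne_eq_left_iff] at h

theorem Glue.inTwo_injective : Function.Injective (Glue.inTwo Y f) :=
  fun _ _ h => Glue.right.inj h

end Points

section Gluing

variable {X₁ : Type u} {X₂ : Type v} [DiffeologicalSpace X₁] [DiffeologicalSpace X₂]
  {Y : Set X₁} {f : Y → X₂}

theorem Glue.isCover : IsCover (Glue.inOne Y f) (Glue.inTwo Y f) := by
  intro n b hb u₀
  obtain ⟨q, hq, e⟩ := hb u₀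
  obtain ⟨r, hr, he, h⟩ := exists_retract_of_eventually e
  refine ⟨r, hr, he, ?_⟩
  rcases hq with ⟨p, hp, rfl⟩ | ⟨p, hp, rfl⟩
  · exact Or.inl ⟨p ∘ r, isPlot_reparam hp hr, funext h⟩
  · exact Or.inr ⟨p ∘ r, isPlot_reparam hp hr, funext h⟩

/-- Forms with equal pullbacks to `Y` agree on germs of plots that are identified by the gluing. -/
theorem Om.apply_eq_of_glued (hf : DSmooth f) {η₁ : Om X₁} {η₂ : Om X₂}
    (h : Om.pull Subtype.val (incl_smooth Y) η₁ = Om.pull f hf η₂) {n : ℕ}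
    (q₁ : {p : Eu n → X₁ // IsPlot p}) (q₂ : {p : Eu n → X₂ // IsPlot p}) {u₀ : Eu n}
    (e : ∀ᶠ z in 𝓝 u₀, Glue.inOne Y f (q₁.1 z) = Glue.inTwo Y f (q₂.1 z)) :
    η₁.1 n q₁ u₀ = η₂.1 n q₂ u₀ := by
  obtain ⟨r, hr, he, hp⟩ := exists_retract_of_eventually e
  choose hY hfY using fun z => Glue.inOne_eq_right_iff.1 (hp z)
  let b : {p : Eu n → Y // IsPlot p} := ⟨fun z => ⟨q₁.1 (r z), hY z⟩, isPlot_reparam q₁.2 hr⟩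
  have h1 : η₁.1 n ⟨fun z => (b.1 z).1, incl_smooth Y n b.1 b.2⟩ u₀ =
      η₂.1 n ⟨fun z => f (b.1 z), hf n b.1 b.2⟩ u₀ :=
    congrArg (fun η : Om Y => η.1 n b u₀) h
  rw [Om.apply_congr η₁ q₁ ⟨fun z => (b.1 z).1, incl_smooth Y n b.1 b.2⟩ ?_, h1,
    Om.apply_congr η₂ q₂ ⟨fun z => f (b.1 z), hf n b.1 b.2⟩ ?_]
  · filter_upwards [he] with z hz
    have hz' : r z = z := hz
    rw [show f (b.1 z) = q₂.1 (r z) from hfY z, hz']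
  · filter_upwards [he] with z hz
    have hz' : r z = z := hz
    change q₁.1 z = q₁.1 (r z)
    rw [hz']

open Classical in
/-- The value, on a plot of the glued space, of the form glued from `η₁` and `η₂`: it is
computed on a local lift of the plot. -/
def Glue.formVal (η₁ : Om X₁) (η₂ : Om X₂) (n : ℕ) (p : Eu n → Glue Y f) (z : Eu n) :
    Eu n →L[ℝ] ℝ :=
  if h : ∃ q : {q : Eu n → X₁ // IsPlot q}, p =ᶠ[𝓝 z] Glue.inOne Y f ∘ q.1 then
    η₁.1 n h.choose z
  else if h : ∃ q : {q : Eu n → X₂ // IsPlot q}, p =ᶠ[𝓝 z] Glue.inTwo Y f ∘ q.1 then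
    η₂.1 n h.choose z
  else 0

theorem Glue.formVal_one (hf : IsGluingDiffeo f) (η₁ : Om X₁) (η₂ : Om X₂) {n : ℕ}
    {p : Eu n → Glue Y f} (q : {q : Eu n → X₁ // IsPlot q}) {z : Eu n}
    (e : p =ᶠ[𝓝 z] Glue.inOne Y f ∘ q.1) : Glue.formVal η₁ η₂ n p z = η₁.1 n q z := by
  have h : ∃ q : {q : Eu n → X₁ // IsPlot q}, p =ᶠ[𝓝 z] Glue.inOne Y f ∘ q.1 := ⟨q, e⟩
  rw [Glue.formVal, dif_pos h]
  refine Om.apply_congr _ _ _ ?_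
  filter_upwards [h.choose_spec, e] with y h1 h2
  exact Glue.inOne_injective hf.injective (h1.symm.trans h2)

theorem Glue.formVal_two (hf : DSmooth f) {η₁ : Om X₁} {η₂ : Om X₂}
    (hη : Om.pull Subtype.val (incl_smooth Y) η₁ = Om.pull f hf η₂) {n : ℕ}
    {p : Eu n → Glue Y f} (q : {q : Eu n → X₂ // IsPlot q}) {z : Eu n}
    (e : p =ᶠ[𝓝 z] Glue.inTwo Y f ∘ q.1) : Glue.formVal η₁ η₂ n p z = η₂.1 n q z := by
  by_cases h : ∃ q : {q : Eu n → X₁ // IsPlot q}, p =ᶠ[𝓝 z] Glue.inOne Y f ∘ q.1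
  · rw [Glue.formVal, dif_pos h]
    refine Om.apply_eq_of_glued hf hη _ _ ?_
    filter_upwards [h.choose_spec, e] with y h1 h2
    exact h1.symm.trans h2
  · have h' : ∃ q : {q : Eu n → X₂ // IsPlot q}, p =ᶠ[𝓝 z] Glue.inTwo Y f ∘ q.1 := ⟨q, e⟩
    rw [Glue.formVal, dif_neg h, dif_pos h']
    refine Om.apply_congr _ _ _ ?_
    filter_upwards [h'.choose_spec, e] with y h1 h2
    exact Glue.inTwo_injective (h1.symm.trans h2)

/-- Smoothness in parameters of the glued form on each plot. -/
theorem Glue.contDiff_formVal (hf : IsGluingDiffeo f) {m : ℕ} {η₁ : Eu m → Om X₁}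
    {η₂ : Eu m → Om X₂} (h₁ : IsPlot η₁) (h₂ : IsPlot η₂)
    (hη : ∀ z, Om.pull Subtype.val (incl_smooth Y) (η₁ z) = Om.pull f hf.smooth (η₂ z)) {n : ℕ}
    {p : Eu n → Glue Y f} (hp : IsPlot p) :
    ContDiff ℝ ∞ fun z : Eu m × Eu n => Glue.formVal (η₁ z.1) (η₂ z.1) n p z.2 := by
  rw [contDiff_iff_contDiffAt]
  intro z₀
  obtain ⟨q, ⟨q, hq, rfl⟩ | ⟨q, hq, rfl⟩, e⟩ := hp z₀.2
  · refine (h₁ n ⟨q, hq⟩).contDiffAt.congr_of_eventuallyEq ?_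
    filter_upwards [(continuous_snd.tendsto z₀).eventually e.eventually_nhds] with z hz
    exact Glue.formVal_one hf _ _ ⟨q, hq⟩ hz
  · refine (h₂ n ⟨q, hq⟩).contDiffAt.congr_of_eventuallyEq ?_
    filter_upwards [(continuous_snd.tendsto z₀).eventually e.eventually_nhds] with z hz
    exact Glue.formVal_two hf.smooth (hη z.1) ⟨q, hq⟩ hz

/-- The form on the glued space obtained from forms with equal pullbacks to `Y`. -/
def Glue.form (hf : IsGluingDiffeo f) (η₁ : Om X₁) (η₂ : Om X₂)
    (hη : Om.pull Subtype.val (incl_smooth Y) η₁ = Om.pull f hf.smooth η₂) : Om (Glue Y f) :=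
  ⟨fun n p => Glue.formVal η₁ η₂ n p.1,
    fun n p => (Glue.contDiff_formVal (m := 0) hf (η₁ := fun _ => η₁) (η₂ := fun _ => η₂)
      isPlot_const isPlot_const (fun _ => hη) p.2).comp (contDiff_const (c := 0).prodMk contDiff_id),
    fun m n p r hr z => by
      obtain ⟨q, ⟨q, hq, rfl⟩ | ⟨q, hq, rfl⟩, e⟩ := p.2 (r z)
      · beta_reduce
        rw [Glue.formVal_one hf η₁ η₂ ⟨q, hq⟩ e,
          Glue.formVal_one hf η₁ η₂ ⟨q ∘ r, isPlot_reparam hq hr⟩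
            (e.comp_tendsto hr.continuous.continuousAt)]
        exact η₁.2.2 m n ⟨q, hq⟩ r hr z
      · beta_reduce
        rw [Glue.formVal_two hf.smooth hη ⟨q, hq⟩ e,
          Glue.formVal_two hf.smooth hη ⟨q ∘ r, isPlot_reparam hq hr⟩
            (e.comp_tendsto hr.continuous.continuousAt)]
        exact η₂.2.2 m n ⟨q, hq⟩ r hr z⟩

theorem Glue.pull_inOne_form (hf : IsGluingDiffeo f) {η₁ : Om X₁} {η₂ : Om X₂}
    (hη : Om.pull Subtype.val (incl_smooth Y) η₁ = Om.pull f hf.smooth η₂) :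
    Om.pull (Glue.inOne Y f) (Glue.inOne_smooth Y f) (Glue.form hf η₁ η₂ hη) = η₁ :=
  Subtype.ext <| funext fun _ => funext fun q => funext fun _ =>
    Glue.formVal_one hf η₁ η₂ q Filter.EventuallyEq.rfl

theorem Glue.pull_inTwo_form (hf : IsGluingDiffeo f) {η₁ : Om X₁} {η₂ : Om X₂}
    (hη : Om.pull Subtype.val (incl_smooth Y) η₁ = Om.pull f hf.smooth η₂) :
    Om.pull (Glue.inTwo Y f) (Glue.inTwo_smooth Y f) (Glue.form hf η₁ η₂ hη) = η₂ :=
  Subtype.ext <| funext fun _ => funext fun q => funext fun _ =>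
    Glue.formVal_two hf.smooth hη q Filter.EventuallyEq.rfl

/-- Plots of pairs of forms with locally equal pullbacks to `Y` glue, locally. -/
theorem Glue.exists_form_plot (hf : IsGluingDiffeo f) {n : ℕ} {η₁ : Eu n → Om X₁}
    {η₂ : Eu n → Om X₂} (h₁ : IsPlot η₁) (h₂ : IsPlot η₂) {u₀ : Eu n}
    (h : ∀ᶠ z in 𝓝 u₀,
      Om.pull Subtype.val (incl_smooth Y) (η₁ z) = Om.pull f hf.smooth (η₂ z)) :
    ∃ ζ : Eu n → Om (Glue Y f), IsPlot ζ ∧ ∀ᶠ z in 𝓝 u₀,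
      Om.pull (Glue.inOne Y f) (Glue.inOne_smooth Y f) (ζ z) = η₁ z ∧
      Om.pull (Glue.inTwo Y f) (Glue.inTwo_smooth Y f) (ζ z) = η₂ z := by
  obtain ⟨r, hr, he, hη⟩ := exists_retract_of_eventually h
  refine ⟨fun z => Glue.form hf (η₁ (r z)) (η₂ (r z)) (hη z), fun m p => ?_, ?_⟩
  · exact Glue.contDiff_formVal hf (isPlot_reparam h₁ hr) (isPlot_reparam h₂ hr) hη p.2
  · filter_upwards [he] with z hz
    rw [Glue.pull_inOne_form, Glue.pull_inTwo_form, show r z = z from hz]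
    exact ⟨rfl, rfl⟩

/-- A form on the glued space vanishes at a point if its two pullbacks vanish over it. -/
theorem Glue.mem_vanishing {ζ : Om (Glue Y f)} {z : Glue Y f}
    (h₁ : ∀ x, Glue.inOne Y f x = z →
      Om.pull (Glue.inOne Y f) (Glue.inOne_smooth Y f) ζ ∈ vanishing x)
    (h₂ : ∀ x, Glue.inTwo Y f x = z →
      Om.pull (Glue.inTwo Y f) (Glue.inTwo_smooth Y f) ζ ∈ vanishing x) : ζ ∈ vanishing z := by
  intro n p hp
  obtain ⟨q, ⟨q, hq, rfl⟩ | ⟨q, hq, rfl⟩, e⟩ := p.2 0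
  · rw [Om.apply_congr ζ p ⟨_, Glue.inOne_smooth Y f n q hq⟩ e]
    exact h₁ (q 0) (e.self_of_nhds.symm.trans hp) n ⟨q, hq⟩ rfl
  · rw [Om.apply_congr ζ p ⟨_, Glue.inTwo_smooth Y f n q hq⟩ e]
    exact h₂ (q 0) (e.self_of_nhds.symm.trans hp) n ⟨q, hq⟩ rfl

/-- On the values of 1-forms of the glued space, the two pullbacks to `Y` coincide. -/
theorem resY_rhoOne (hf : DSmooth f) {y : Y} {x : X₂} (h : f y = x)
    (α : Lam (Glue Y f) (Glue.right x)) :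
    resY y (rhoOne (Glue.inOne_eq_right h) α) = Lam.pull f hf h (rhoTwo x α) := by
  have hs : DSmooth (Glue.inTwo Y f ∘ f) := (Glue.inTwo_smooth Y f).comp hf
  have e : Glue.inOne Y f ∘ Subtype.val = Glue.inTwo Y f ∘ f :=
    funext fun y => Glue.inOne_mem Y f y.2
  have e' : (Glue.inTwo Y f ∘ f) y = Glue.right x := congrArg Glue.right h
  exact (Lam.pull_pull _ _ hs e rfl _ e' α).trans (Lam.pull_pull hf _ hs rfl h rfl e' α).symm

section Metric

variable {hf : DSmooth f} {g₁ : ∀ x, Lam X₁ x →ₗ[ℝ] Lam X₁ x →ₗ[ℝ] ℝ}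
  {g₂ : ∀ x, Lam X₂ x →ₗ[ℝ] Lam X₂ x →ₗ[ℝ] ℝ}

/-- A value of a 1-form in the kernel of the restriction to `Y` is compatible with zero, so it lies
in the kernel of the metric, which is trivial. -/
theorem resY_injective (hΩ : SameFormDiffeology hf) (hgL : LamMetricCompatible hf g₁ g₂)
    (hk : ∀ x, LinearMap.ker (g₁ x) = ⊥) (y : Y) : Function.Injective (resY y) := by
  rw [← LinearMap.ker_eq_bot, eq_bot_iff]
  intro α hα
  rw [← hk y]
  refine LinearMap.ext fun β => ?_
  obtain ⟨η, rfl⟩ := Lam.mk_surjective _ β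
  obtain ⟨θ, hθ⟩ := exists_pull_eq hΩ η
  have hα' : LamCompatible hf y α 0 := by
    rw [LamCompatible, map_zero]
    exact hα
  have := hgL y α (Lam.mk y.1 η) 0 (Lam.mk (f y) θ) hα' (congrArg (Lam.mk y) hθ)
  simpa using this

theorem pullF_injective (hΩ : SameFormDiffeology hf) (hgL : LamMetricCompatible hf g₁ g₂)
    (hk : ∀ x, LinearMap.ker (g₂ x) = ⊥) (y : Y) : Function.Injective (pullF hf y) := by
  rw [← LinearMap.ker_eq_bot, eq_bot_iff]
  intro α hα
  rw [← hk (f y)]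
  refine LinearMap.ext fun β => ?_
  obtain ⟨η, rfl⟩ := Lam.mk_surjective _ β
  obtain ⟨θ, hθ⟩ := exists_pull_eq hΩ.symm η
  have hα' : LamCompatible hf y 0 α := by
    rw [LamCompatible, map_zero]
    exact hα.symm
  have := hgL y 0 (Lam.mk y.1 θ) α (Lam.mk (f y) η) hα' (congrArg (Lam.mk y) hθ.symm)
  simpa using this.symm

end Metric

/-- The values of 1-forms of the glued space are identified with those of `X₁`: if the pullback of a
form to `X₁` vanishes at a point of `Y`, then so does its pullback to `Y`, hence, by injectivity, its
pullback to `X₂` vanishes at the image point. -/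
theorem Glue.isFormChart_inOne (hf : IsGluingDiffeo f) (hΩ : SameFormDiffeology hf.smooth)
    (hinj : ∀ y, Function.Injective (pullF hf.smooth y)) : IsFormChart (Glue.inOne Y f) := by
  refine isFormChart_of_lift (Glue.inOne_smooth Y f) (fun a => ?_) fun n η hη u₀ => ?_
  · rw [← LinearMap.ker_eq_bot, eq_bot_iff]
    intro α hα
    obtain ⟨ζ, rfl⟩ := Lam.mk_surjective _ α
    have hζ := Lam.mk_eq_zero.1 (show Lam.mk a (Om.pull _ (Glue.inOne_smooth Y f) ζ) = 0 from hα)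
    refine Lam.mk_eq_zero.2 (Glue.mem_vanishing (fun x hx => ?_) fun x hx => ?_)
    · rwa [Glue.inOne_injective hf.injective hx]
    · obtain ⟨ha, rfl⟩ := Glue.inOne_eq_right_iff.1 hx.symm
      refine Lam.mk_eq_zero.1 (hinj ⟨a, ha⟩ ?_)
      have := resY_rhoOne hf.smooth (y := ⟨a, ha⟩) rfl (Lam.mk _ ζ)
      rw [map_zero]
      refine this.symm.trans ?_
      change resY ⟨a, ha⟩ (Lam.mk a (Om.pull _ (Glue.inOne_smooth Y f) ζ)) = 0
      rw [Lam.mk_eq_zero.2 hζ, map_zero]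
  · obtain ⟨θ, hθ, e⟩ := exists_local_lift hΩ hη u₀
    obtain ⟨ζ, hζ, e'⟩ := Glue.exists_form_plot hf hη hθ e
    exact ⟨ζ, hζ, e'.mono fun z hz => hz.1⟩

theorem Glue.isFormChart_inTwo (hf : IsGluingDiffeo f) (hΩ : SameFormDiffeology hf.smooth)
    (hinj : ∀ y : Y, Function.Injective (resY y)) : IsFormChart (Glue.inTwo Y f) := by
  refine isFormChart_of_lift (Glue.inTwo_smooth Y f) (fun a => ?_) fun n η hη u₀ => ?_
  · rw [← LinearMap.ker_eq_bot, eq_bot_iff]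
    intro α hα
    obtain ⟨ζ, rfl⟩ := Lam.mk_surjective _ α
    have hζ := Lam.mk_eq_zero.1 (show Lam.mk a (Om.pull _ (Glue.inTwo_smooth Y f) ζ) = 0 from hα)
    refine Lam.mk_eq_zero.2 (Glue.mem_vanishing (fun x hx => ?_) fun x hx => ?_)
    · obtain ⟨hx', rfl⟩ := Glue.inOne_eq_right_iff.1 hx
      refine Lam.mk_eq_zero.1 (hinj ⟨x, hx'⟩ ?_)
      rw [map_zero]
      refine (resY_rhoOne hf.smooth (y := ⟨x, hx'⟩) rfl (Lam.mk _ ζ)).trans ?_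
      change pullF hf.smooth ⟨x, hx'⟩ (Lam.mk _ (Om.pull _ (Glue.inTwo_smooth Y f) ζ)) = 0
      rw [Lam.mk_eq_zero.2 hζ, map_zero]
    · rwa [Glue.inTwo_injective hx]
  · obtain ⟨θ, hθ, e⟩ := exists_local_lift hΩ.symm hη u₀
    obtain ⟨ζ, hζ, e'⟩ := Glue.exists_form_plot hf hθ hη (e.mono fun z hz => hz.symm)
    exact ⟨ζ, hζ, e'.mono fun z hz => hz.2⟩

end Gluing

/-! ### The glued pseudo-bundle -/

section GlueBundle

section Fibres

variable {X₁ : Type u} {X₂ : Type v} {Y : Set X₁} {f : Y → X₂} {E₁ : X₁ → Type w}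
  {E₂ : X₂ → Type w} [∀ x, AddCommGroup (E₁ x)] [∀ x, Module ℝ (E₁ x)]
  [∀ x, AddCommGroup (E₂ x)] [∀ x, Module ℝ (E₂ x)] (ft : ∀ y : Y, E₁ y ≃ₗ[ℝ] E₂ (f y))

open Classical in
/-- The identification of the fibre of the glued pseudo-bundle over the image of `x : X₁` with the
fibre of `E₁` over `x`. -/
def fibOne {x : X₁} {z : Glue Y f} (h : Glue.inOne Y f x = z) : GlueFib ft z ≃ₗ[ℝ] E₁ x :=
  if hx : x ∈ Y then
    (castFib (GlueFib ft) (h.symm.trans (dif_pos hx) : z = Glue.right (f ⟨x, hx⟩))).trans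
      (ft ⟨x, hx⟩).symm
  else castFib (GlueFib ft) (h.symm.trans (dif_neg hx) : z = Glue.left x hx)

/-- The identification of the fibre of the glued pseudo-bundle over the image of `x : X₂` with the
fibre of `E₂` over `x`. -/
def fibTwo (x : X₂) : GlueFib ft (Glue.inTwo Y f x) ≃ₗ[ℝ] E₂ x := LinearEquiv.refl ℝ (E₂ x)

theorem fibOne_left {x : X₁} {hx : x ∉ Y} (h : Glue.inOne Y f x = Glue.left x hx) :
    fibOne ft h = LinearEquiv.refl ℝ (E₁ x) :=
  dif_neg hx

theorem fibOne_right {y : Y} (h : Glue.inOne Y f y.1 = Glue.right (f y)) :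
    fibOne ft h = (ft y).symm :=
  (dif_pos y.2).trans (LinearEquiv.ext fun _ => rfl)

theorem GlueFib.inOne_mk {x : X₁} {z : Glue Y f} (h : Glue.inOne Y f x = z) (e : GlueFib ft z) :
    GlueFib.inOne ft ⟨x, fibOne ft h e⟩ = ⟨z, e⟩ := by
  by_cases hx : x ∈ Y
  · obtain rfl : Glue.right (f ⟨x, hx⟩) = z := (dif_pos hx).symm.trans h
    rw [fibOne_right ft (y := ⟨x, hx⟩) h]
    simp only [GlueFib.inOne, dif_pos hx]
    congr 1
    exact (ft ⟨x, hx⟩).apply_symm_apply e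
  · obtain rfl : Glue.left x hx = z := (dif_neg hx).symm.trans h
    rw [fibOne_left]
    simp only [GlueFib.inOne, dif_neg hx]
    rfl

theorem GlueFib.inOne_of_mem (y : Y) (e : E₁ y) :
    GlueFib.inOne ft ⟨y.1, e⟩ = GlueFib.inTwo ft ⟨f y, ft y e⟩ :=
  dif_pos y.2

theorem GlueFib.fst_inOne (e : Σ x, E₁ x) :
    (GlueFib.inOne ft e).1 = Glue.inOne Y f e.1 := by
  by_cases h : e.1 ∈ Y <;> simp [GlueFib.inOne, Glue.inOne, h]

theorem GlueFib.inTwo_injective : Function.Injective (GlueFib.inTwo ft) := by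
  rintro ⟨x, e⟩ ⟨x', e'⟩ h
  cases h
  rfl

theorem GlueFib.inOne_injective (hf : Function.Injective f) :
    Function.Injective (GlueFib.inOne ft) := by
  rintro ⟨x, e⟩ ⟨x', e'⟩ h
  obtain rfl : x = x' := Glue.inOne_injective hf <| by
    simpa only [GlueFib.fst_inOne] using congrArg Sigma.fst h
  by_cases hx : x ∈ Y
  · have h' : GlueFib.inTwo ft ⟨f ⟨x, hx⟩, ft ⟨x, hx⟩ e⟩ =
        GlueFib.inTwo ft ⟨f ⟨x, hx⟩, ft ⟨x, hx⟩ e'⟩ :=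
      (GlueFib.inOne_of_mem ft ⟨x, hx⟩ e).symm.trans (h.trans (GlueFib.inOne_of_mem ft ⟨x, hx⟩ e'))
    have h2 := eq_of_heq (Sigma.mk.inj (GlueFib.inTwo_injective ft h')).2
    rw [(ft ⟨x, hx⟩).injective h2]
  · simp only [GlueFib.inOne, dif_neg hx] at h
    rw [eq_of_heq (Sigma.mk.inj h).2]

variable {ft}

theorem resOne_mem (s : ∀ z, GlueFib ft z) (y : Y) :
    resOne s y.1 = (ft y).symm (resTwo s (f y)) :=
  dif_pos y.2

theorem resOne_notMem (s : ∀ z, GlueFib ft z) {x : X₁} (hx : x ∉ Y) :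
    resOne s x = s (Glue.left x hx) :=
  dif_neg hx

theorem resOne_eq (s : ∀ z, GlueFib ft z) {x : X₁} {z : Glue Y f} (h : Glue.inOne Y f x = z) :
    fibOne ft h (s z) = resOne s x := by
  by_cases hx : x ∈ Y
  · obtain rfl : Glue.right (f ⟨x, hx⟩) = z := (dif_pos hx).symm.trans h
    rw [fibOne_right ft (y := ⟨x, hx⟩) h]
    exact (resOne_mem s ⟨x, hx⟩).symm
  · obtain rfl : Glue.left x hx = z := (dif_neg hx).symm.trans h
    rw [fibOne_left, resOne_notMem s hx]
    rfl

theorem secCompatible_res (s : ∀ z, GlueFib ft z) : SecCompatible ft (resOne s) (resTwo s) := by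
  intro y
  rw [resOne_mem]
  exact (ft y).apply_symm_apply _

theorem glueSec_res (s : ∀ z, GlueFib ft z) : glueSec ft (resOne s) (resTwo s) = s := by
  funext z
  rcases z with ⟨x, h⟩ | x
  · exact resOne_notMem s h
  · rfl

theorem resOne_glueSec {s₁ : ∀ x, E₁ x} {s₂ : ∀ x, E₂ x} (h : SecCompatible ft s₁ s₂) :
    resOne (glueSec ft s₁ s₂) = s₁ := by
  funext x
  by_cases hx : x ∈ Y
  · refine (resOne_mem _ ⟨x, hx⟩).trans ?_
    rw [LinearEquiv.symm_apply_eq]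
    exact (h ⟨x, hx⟩).symm
  · exact resOne_notMem _ hx

theorem glueMetric_inOne {g₁ : ∀ x, E₁ x →ₗ[ℝ] E₁ x →ₗ[ℝ] ℝ}
    {g₂ : ∀ x, E₂ x →ₗ[ℝ] E₂ x →ₗ[ℝ] ℝ} (hg : MetricCompatible ft g₁ g₂) {x : X₁}
    {z : Glue Y f} (h : Glue.inOne Y f x = z) (e e' : GlueFib ft z) :
    glueMetric ft g₁ g₂ z e e' = g₁ x (fibOne ft h e) (fibOne ft h e') := by
  rcases z with ⟨x', hx'⟩ | x'
  · obtain rfl := Glue.inOne_eq_left_iff.1 h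
    rw [fibOne_left]
    rfl
  · obtain ⟨hx, rfl⟩ := Glue.inOne_eq_right_iff.1 h
    have key : ∀ e e' : E₂ (f ⟨x, hx⟩), g₂ (f ⟨x, hx⟩) e e' =
        g₁ x ((ft ⟨x, hx⟩).symm e) ((ft ⟨x, hx⟩).symm e') := fun e e' => by
      rw [hg ⟨x, hx⟩, LinearEquiv.apply_symm_apply, LinearEquiv.apply_symm_apply]
    rw [fibOne_right ft (y := ⟨x, hx⟩) h]
    exact key e e'

variable [DiffeologicalSpace (Σ x, E₁ x)] [DiffeologicalSpace (Σ x, E₂ x)]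

theorem GlueFib.isPlot_inOne {n : ℕ} {Q : Eu n → Σ x, E₁ x} (hQ : IsPlot Q) :
    IsPlot (GlueFib.inOne ft ∘ Q) :=
  fun _ => ⟨_, Or.inl ⟨Q, hQ, rfl⟩, Filter.EventuallyEq.rfl⟩

theorem GlueFib.isPlot_inTwo {n : ℕ} {Q : Eu n → Σ x, E₂ x} (hQ : IsPlot Q) :
    IsPlot (GlueFib.inTwo ft ∘ Q) :=
  fun _ => ⟨_, Or.inr ⟨Q, hQ, rfl⟩, Filter.EventuallyEq.rfl⟩

variable [DiffeologicalSpace X₂]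

/-- Over `X₂`, the plots of the glued pseudo-bundle are those of `E₂`. -/
theorem isBundleChart_fibTwo (hft : IsBundleDiffeo ft) :
    IsBundleChart (Glue.inTwo Y f) (fibTwo ft) := by
  intro n q v hq
  constructor
  · intro h
    refine isPlot_of_retract fun u₀ => ?_
    obtain ⟨p, hp, e⟩ := h u₀
    obtain ⟨r, hr, he, hpr⟩ := exists_retract_of_eventually e
    refine ⟨r, hr, he, ?_⟩
    rcases hp with ⟨Q, hQ, rfl⟩ | ⟨Q, hQ, rfl⟩
    · -- the plot stays in the part over `f(Y)`, where the gluing map of the bundles applies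
      have hY : ∀ z, (Q (r z)).1 ∈ Y := fun z => by
        have := (GlueFib.fst_inOne ft (Q (r z))).symm.trans (congrArg Sigma.fst (hpr z)).symm
        exact (Glue.inOne_eq_right_iff.1 this).1
      refine Eq.subst (motive := IsPlot) (funext fun z => ?_)
        ((hft n (fun z => ⟨(Q (r z)).1, hY z⟩) fun z => (Q (r z)).2).1 (isPlot_reparam hQ hr))
      apply GlueFib.inTwo_injective ft
      rw [← GlueFib.inOne_of_mem ft ⟨(Q (r z)).1, hY z⟩]
      exact (hpr z).symm
    · refine Eq.subst (motive := IsPlot) (funext fun z => ?_) (isPlot_reparam hQ hr)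
      exact GlueFib.inTwo_injective ft (hpr z).symm
  · intro h
    exact GlueFib.isPlot_inTwo h

end Fibres

variable {X₁ : Type u} {X₂ : Type v} [DiffeologicalSpace X₁] [DiffeologicalSpace X₂]
  {Y : Set X₁} {f : Y → X₂} {E₁ : X₁ → Type w} {E₂ : X₂ → Type w}
  [∀ x, AddCommGroup (E₁ x)] [∀ x, Module ℝ (E₁ x)] [DiffeologicalSpace (Σ x, E₁ x)]
  [∀ x, AddCommGroup (E₂ x)] [∀ x, Module ℝ (E₂ x)] [DiffeologicalSpace (Σ x, E₂ x)]
  {ft : ∀ y : Y, E₁ y ≃ₗ[ℝ] E₂ (f y)}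

theorem GlueFib.dSmooth_fst (h₁ : DSmooth (Sigma.fst : (Σ x, E₁ x) → X₁))
    (h₂ : DSmooth (Sigma.fst : (Σ x, E₂ x) → X₂)) :
    DSmooth (Sigma.fst : (Σ z, GlueFib ft z) → Glue Y f) := by
  intro n p hp
  refine isPlot_of_eventuallyEq fun u₀ => ?_
  obtain ⟨q, ⟨Q, hQ, rfl⟩ | ⟨Q, hQ, rfl⟩, e⟩ := hp u₀
  · refine ⟨_, Glue.inOne_smooth Y f n _ (h₁ n Q hQ), ?_⟩
    filter_upwards [e] with z hz
    rw [Function.comp_apply, hz]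
    exact GlueFib.fst_inOne ft _
  · refine ⟨_, Glue.inTwo_smooth Y f n _ (h₂ n Q hQ), ?_⟩
    filter_upwards [e] with z hz
    rw [Function.comp_apply, hz]
    rfl

/-- Over `X₁`, the plots of the glued pseudo-bundle are those of `E₁`. -/
theorem isBundleChart_fibOne (hf : IsGluingDiffeo f) (hft : IsBundleDiffeo ft) :
    IsBundleChart (Glue.inOne Y f) fun x => fibOne ft (rfl : Glue.inOne Y f x = _) := by
  intro n q v hq
  have hv : (fun z => (⟨_, v z⟩ : Σ z, GlueFib ft z)) =
      GlueFib.inOne ft ∘ fun z => ⟨q z, fibOne ft rfl (v z)⟩ :=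
    funext fun z => (GlueFib.inOne_mk ft rfl (v z)).symm
  constructor
  · intro h
    refine isPlot_of_retract fun u₀ => ?_
    obtain ⟨p, hp, e⟩ := h u₀
    obtain ⟨r, hr, he, hpr⟩ := exists_retract_of_eventually e
    refine ⟨r, hr, he, ?_⟩
    rcases hp with ⟨Q, hQ, rfl⟩ | ⟨Q, hQ, rfl⟩
    · refine Eq.subst (motive := IsPlot) (funext fun z => ?_) (isPlot_reparam hQ hr)
      exact GlueFib.inOne_injective ft hf.injective ((hpr z).symm.trans (congrFun hv (r z)))
    · -- the plot stays in the part over `f(Y)`, where the gluing map of the bundles applies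
      have hY : ∀ z, q (r z) ∈ Y := fun z =>
        (Glue.inOne_eq_right_iff.1 (congrArg Sigma.fst (hpr z))).1
      refine (hft n (fun z => ⟨q (r z), hY z⟩) fun z => fibOne ft rfl (v (r z))).2 ?_
      refine Eq.subst (motive := IsPlot) (funext fun z => ?_) (isPlot_reparam hQ hr)
      apply GlueFib.inTwo_injective ft
      rw [← GlueFib.inOne_of_mem ft ⟨q (r z), hY z⟩]
      exact (hpr z).symm.trans (congrFun hv (r z))
  · intro h
    rw [FPlot, hv]
    exact GlueFib.isPlot_inOne h

theorem isSmoothSec_glueSec {s₁ : ∀ x, E₁ x} {s₂ : ∀ x, E₂ x} (h : SecCompatible ft s₁ s₂)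
    (h₁ : IsSmoothSec E₁ s₁) (h₂ : IsSmoothSec E₂ s₂) :
    IsSmoothSec (GlueFib ft) (glueSec ft s₁ s₂) := by
  intro n b hb
  refine isPlot_of_eventuallyEq fun u₀ => ?_
  obtain ⟨p, ⟨q, hq, rfl⟩ | ⟨q, hq, rfl⟩, e⟩ := hb u₀
  · refine ⟨_, GlueFib.isPlot_inOne (h₁ n q hq), ?_⟩
    filter_upwards [e] with z hz
    have h3 := resOne_eq (glueSec ft s₁ s₂) hz.symm
    rw [resOne_glueSec h] at h3
    change _ = GlueFib.inOne ft ⟨q z, s₁ (q z)⟩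
    rw [← h3]
    exact (GlueFib.inOne_mk ft hz.symm _).symm
  · refine ⟨_, GlueFib.isPlot_inTwo (h₂ n q hq), ?_⟩
    filter_upwards [e] with z hz
    rw [Function.comp_apply, hz]
    rfl

end GlueBundle

/-! ### The glued data in the two charts -/

section TensorMaps

variable {M M' N N' : Type*} [AddCommGroup M] [Module ℝ M] [AddCommGroup M'] [Module ℝ M']
  [AddCommGroup N] [Module ℝ N] [AddCommGroup N'] [Module ℝ N']

theorem tensorMap_injective {a : M →ₗ[ℝ] M'} {b : N →ₗ[ℝ] N'} (ha : Function.Injective a)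
    (hb : Function.Injective b) : Function.Injective (TensorProduct.map a b) := by
  obtain ⟨a', ha'⟩ := a.exists_leftInverse_of_injective (LinearMap.ker_eq_bot.2 ha)
  obtain ⟨b', hb'⟩ := b.exists_leftInverse_of_injective (LinearMap.ker_eq_bot.2 hb)
  refine Function.LeftInverse.injective (g := TensorProduct.map a' b') fun T => ?_
  rw [TensorProduct.map_map, ha', hb', TensorProduct.map_id]
  rfl

end TensorMaps

section GluedData

variable {X₁ : Type u} {X₂ : Type v} [DiffeologicalSpace X₁] [DiffeologicalSpace X₂]
  {Y : Set X₁} {f : Y → X₂}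

theorem rhoOne_bijective (hc : IsFormChart (Glue.inOne Y f)) {x : X₁} {z : Glue Y f}
    (h : Glue.inOne Y f x = z) : Function.Bijective (rhoOne h) := by
  subst h
  exact hc.bijective x

theorem rhoTwo_bijective (hc : IsFormChart (Glue.inTwo Y f)) (x : X₂) :
    Function.Bijective (rhoTwo (Y := Y) (f := f) x) :=
  hc.bijective x

theorem pullF_comp_rhoTwo (hf : DSmooth f) (y : Y) :
    (pullF hf y).comp (rhoTwo (f y)) = (resY y).comp (rhoOne (Glue.inOne_eq_right rfl)) :=
  LinearMap.ext fun α => (resY_rhoOne hf rfl α).symm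

theorem resLamOne_eq (s : ∀ z, Lam (Glue Y f) z) {x : X₁} {z : Glue Y f}
    (h : Glue.inOne Y f x = z) : rhoOne h (s z) = resLamOne s x := by
  subst h
  rfl

theorem lamCompatible_res (hf : DSmooth f) (s : ∀ z, Lam (Glue Y f) z) (y : Y) :
    LamCompatible hf y (resLamOne s y) (resLamTwo s (f y)) := by
  rw [LamCompatible, ← resLamOne_eq s (Glue.inOne_eq_right (rfl : f y = f y))]
  exact resY_rhoOne hf rfl _

section LamMetric

variable {g₁ : ∀ x, Lam X₁ x →ₗ[ℝ] Lam X₁ x →ₗ[ℝ] ℝ} {g₂ : ∀ x, Lam X₂ x →ₗ[ℝ] Lam X₂ x →ₗ[ℝ] ℝ}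

theorem glueLamMetric_right (hf : Function.Injective f) {y : Y} {x : X₂} (h : f y = x) :
    glueLamMetric g₁ g₂ (Glue.right x : Glue Y f) =
      (1 / 2 : ℝ) • ((g₁ y).compl₁₂ (rhoOne (Glue.inOne_eq_right h))
        (rhoOne (Glue.inOne_eq_right h)) + (g₂ x).compl₁₂ (rhoTwo x) (rhoTwo x)) := by
  have hex : ∃ y : Y, f y = x := ⟨y, h⟩
  obtain rfl : hex.choose = y := hf (hex.choose_spec.trans h.symm)
  exact dif_pos hex

/-- The two metrics whose mean is taken over `f(Y)` coincide there. -/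
theorem LamMetricCompatible.rho {hf : DSmooth f} (hgL : LamMetricCompatible hf g₁ g₂) {y : Y}
    {x : X₂} (h : f y = x) (α β : Lam (Glue Y f) (Glue.right x)) :
    g₁ y (rhoOne (Glue.inOne_eq_right h) α) (rhoOne (Glue.inOne_eq_right h) β) =
      g₂ x (rhoTwo x α) (rhoTwo x β) := by
  subst h
  exact hgL y _ _ _ _ (resY_rhoOne hf rfl α) (resY_rhoOne hf rfl β)

theorem glueLamMetric_inOne (hf : IsGluingDiffeo f)
    (hgL : LamMetricCompatible hf.smooth g₁ g₂) {x : X₁} {z : Glue Y f}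
    (h : Glue.inOne Y f x = z) (α β : Lam (Glue Y f) z) :
    glueLamMetric g₁ g₂ z α β = g₁ x (rhoOne h α) (rhoOne h β) := by
  rcases z with ⟨x', hx'⟩ | x'
  · obtain rfl := Glue.inOne_eq_left_iff.1 h
    rfl
  · obtain ⟨hx, hx'⟩ := Glue.inOne_eq_right_iff.1 h
    rw [glueLamMetric_right hf.injective hx']
    simp only [LinearMap.smul_apply, LinearMap.add_apply, LinearMap.compl₁₂_apply,
      ← hgL.rho hx', smul_eq_mul]
    ring

theorem glueLamMetric_inTwo (hf : IsGluingDiffeo f)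
    (hgL : LamMetricCompatible hf.smooth g₁ g₂) (x : X₂)
    (α β : Lam (Glue Y f) (Glue.right x)) :
    glueLamMetric g₁ g₂ (Glue.right x) α β = g₂ x (rhoTwo x α) (rhoTwo x β) := by
  by_cases hex : ∃ y : Y, f y = x
  · obtain ⟨y, hy⟩ := hex
    rw [glueLamMetric_right hf.injective hy]
    simp only [LinearMap.smul_apply, LinearMap.add_apply, LinearMap.compl₁₂_apply,
      hgL.rho hy, smul_eq_mul]
    ring
  · exact congrArg (fun g => g α β) (dif_neg hex : glueLamMetric g₁ g₂ (Glue.right x) = _)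

end LamMetric

section LamConn

variable {nab₁ : Op (Lam X₁)} {nab₂ : Op (Lam X₂)}

theorem glueLamConn_right (hf : Function.Injective f) {y : Y} {x : X₂} (h : f y = x)
    (s : ∀ z, Lam (Glue Y f) z) :
    glueLamConn nab₁ nab₂ s (Glue.right x) =
      Function.invFun ((TensorProduct.map (rhoOne (Glue.inOne_eq_right h))
          (rhoOne (Glue.inOne_eq_right h))).prod (TensorProduct.map (rhoTwo x) (rhoTwo x)))
        (nab₁ (resLamOne s) y, nab₂ (resLamTwo s) x) := by
  have hex : ∃ y : Y, f y = x := ⟨y, h⟩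
  obtain rfl : hex.choose = y := hf (hex.choose_spec.trans h.symm)
  exact dif_pos hex

/-- Over `f(Y)`, a single tensor pulls back to the values of both connections. -/
theorem map_glueLamConn_right (hf : IsGluingDiffeo f) (hc₁ : IsFormChart (Glue.inOne Y f))
    (hc₂ : IsFormChart (Glue.inTwo Y f)) (hinj : ∀ y, Function.Injective (pullF hf.smooth y))
    (hnab : LamConnCompatible hf.smooth nab₁ nab₂) {s : ∀ z, Lam (Glue Y f) z}
    (hs : IsSmoothSec (Lam (Glue Y f)) s) {y : Y} {x : X₂} (h : f y = x) :
    TensorProduct.map (rhoOne (Glue.inOne_eq_right h)) (rhoOne (Glue.inOne_eq_right h))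
        (glueLamConn nab₁ nab₂ s (Glue.right x)) = nab₁ (resLamOne s) y ∧
      TensorProduct.map (rhoTwo x) (rhoTwo x) (glueLamConn nab₁ nab₂ s (Glue.right x)) =
        nab₂ (resLamTwo s) x := by
  have hex : ∃ T, ((TensorProduct.map (rhoOne (Glue.inOne_eq_right h))
      (rhoOne (Glue.inOne_eq_right h))).prod (TensorProduct.map (rhoTwo x) (rhoTwo x))) T =
      (nab₁ (resLamOne s) y, nab₂ (resLamTwo s) x) := by
    subst h
    have hb := (rhoOne_bijective hc₁ (Glue.inOne_eq_right (rfl : f y = f y))).surjective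
    obtain ⟨T, hT⟩ := TensorProduct.map_surjective hb hb (nab₁ (resLamOne s) y)
    refine ⟨T, Prod.ext hT (tensorMap_injective (hinj y) (hinj y) ?_)⟩
    have hs₁ : IsSmoothSec (Lam X₁) (resLamOne s) := hc₁.isBundleChart.isSmoothSec hc₁.smooth hs
    have hs₂ : IsSmoothSec (Lam X₂) (resLamTwo s) := hc₂.isBundleChart.isSmoothSec hc₂.smooth hs
    rw [← hnab _ _ hs₁ hs₂ (lamCompatible_res hf.smooth s) y, ← hT]
    change TensorProduct.map _ _ (TensorProduct.map (rhoTwo (f y)) (rhoTwo (f y)) T) = _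
    rw [TensorProduct.map_map, TensorProduct.map_map, pullF_comp_rhoTwo]
  rw [glueLamConn_right hf.injective h]
  exact Prod.ext_iff.1 (Function.invFun_eq hex)

theorem map_glueLamConn_inOne (hf : IsGluingDiffeo f) (hc₁ : IsFormChart (Glue.inOne Y f))
    (hc₂ : IsFormChart (Glue.inTwo Y f)) (hinj : ∀ y, Function.Injective (pullF hf.smooth y))
    (hnab : LamConnCompatible hf.smooth nab₁ nab₂) {s : ∀ z, Lam (Glue Y f) z}
    (hs : IsSmoothSec (Lam (Glue Y f)) s) {x : X₁} {z : Glue Y f} (h : Glue.inOne Y f x = z) :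
    TensorProduct.map (rhoOne h) (rhoOne h) (glueLamConn nab₁ nab₂ s z) =
      nab₁ (resLamOne s) x := by
  rcases z with ⟨x', hx'⟩ | x'
  · obtain rfl := Glue.inOne_eq_left_iff.1 h
    have hb := (rhoOne_bijective hc₁ h).surjective
    exact Function.invFun_eq (TensorProduct.map_surjective hb hb _)
  · obtain ⟨hx, hx'⟩ := Glue.inOne_eq_right_iff.1 h
    exact (map_glueLamConn_right hf hc₁ hc₂ hinj hnab hs hx').1

theorem map_glueLamConn_inTwo (hf : IsGluingDiffeo f) (hc₁ : IsFormChart (Glue.inOne Y f))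
    (hc₂ : IsFormChart (Glue.inTwo Y f)) (hinj : ∀ y, Function.Injective (pullF hf.smooth y))
    (hnab : LamConnCompatible hf.smooth nab₁ nab₂) {s : ∀ z, Lam (Glue Y f) z}
    (hs : IsSmoothSec (Lam (Glue Y f)) s) (x : X₂) :
    TensorProduct.map (rhoTwo x) (rhoTwo x) (glueLamConn nab₁ nab₂ s (Glue.right x)) =
      nab₂ (resLamTwo s) x := by
  by_cases hex : ∃ y : Y, f y = x
  · obtain ⟨y, hy⟩ := hex
    exact (map_glueLamConn_right hf hc₁ hc₂ hinj hnab hs hy).2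
  · have hb := (rhoTwo_bijective hc₂ x).surjective
    rw [show glueLamConn nab₁ nab₂ s (Glue.right x) = _ from dif_neg hex]
    exact Function.invFun_eq (TensorProduct.map_surjective hb hb _)

end LamConn

variable {E₁ : X₁ → Type w} {E₂ : X₂ → Type w}
  [∀ x, AddCommGroup (E₁ x)] [∀ x, Module ℝ (E₁ x)]
  [∀ x, AddCommGroup (E₂ x)] [∀ x, Module ℝ (E₂ x)]
  {ft : ∀ y : Y, E₁ y ≃ₗ[ℝ] E₂ (f y)}

theorem fibOne_glueAction {c₁ : ∀ x, Lam X₁ x →ₗ[ℝ] E₁ x →ₗ[ℝ] E₁ x}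
    {c₂ : ∀ x, Lam X₂ x →ₗ[ℝ] E₂ x →ₗ[ℝ] E₂ x} (hc : ActionCompatible ft c₁ c₂) {x : X₁}
    {z : Glue Y f} (h : Glue.inOne Y f x = z) (α : Lam (Glue Y f) z) (e : GlueFib ft z) :
    fibOne ft h (glueAction ft c₁ c₂ z α e) = c₁ x (rhoOne h α) (fibOne ft h e) := by
  rcases z with ⟨x', hx'⟩ | x'
  · obtain rfl := Glue.inOne_eq_left_iff.1 h
    rw [fibOne_left]
    rfl
  · obtain ⟨hx, rfl⟩ := Glue.inOne_eq_right_iff.1 h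
    have key : ∀ e : E₂ (f ⟨x, hx⟩), (ft ⟨x, hx⟩).symm (c₂ (f ⟨x, hx⟩) (rhoTwo _ α) e) =
        c₁ x (rhoOne h α) ((ft ⟨x, hx⟩).symm e) := fun e => by
      rw [LinearEquiv.symm_apply_eq, ← hc ⟨x, hx⟩, LinearEquiv.apply_symm_apply]
    rw [fibOne_right ft (y := ⟨x, hx⟩) h]
    exact key e

variable {nab₁ : Op E₁} {nab₂ : Op E₂}

theorem glueConn_right (hf : Function.Injective f) {y : Y} {x : X₂} (h : f y = x)
    (s : ∀ z, GlueFib ft z) :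
    glueConn ft nab₁ nab₂ s (Glue.right x) =
      Function.invFun
        (LinearMap.rTensor (E₂ x) ((rhoOne (Glue.inOne_eq_right h)).prod (rhoTwo x)))
        (TensorProduct.map (LinearMap.inl ℝ (Lam X₁ y) (Lam X₂ x)) (ftTo ft h)
            (nab₁ (resOne s) y) +
          TensorProduct.map (LinearMap.inr ℝ (Lam X₁ y) (Lam X₂ x)) LinearMap.id
            (nab₂ (resTwo s) x)) := by
  have hex : ∃ y : Y, f y = x := ⟨y, h⟩
  obtain rfl : hex.choose = y := hf (hex.choose_spec.trans h.symm)
  exact dif_pos hex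

variable [DiffeologicalSpace (Σ x, E₁ x)] [DiffeologicalSpace (Σ x, E₂ x)]

/-- Over `f(Y)`, a single tensor pulls back to the values of both connections. -/
theorem map_glueConn_right (hf : IsGluingDiffeo f) (hft : IsBundleDiffeo ft)
    (hc₂ : IsFormChart (Glue.inTwo Y f)) (hinj : ∀ y : Y, Function.Injective (resY y))
    (hnab : ConnCompatible ft hf.smooth nab₁ nab₂) {s : ∀ z, GlueFib ft z}
    (hs : IsSmoothSec (GlueFib ft) s) (y : Y) :
    TensorProduct.map (rhoOne (Glue.inOne_eq_right (rfl : f y = f y))) (LinearMap.id (M := E₂ (f y)))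
        (glueConn ft nab₁ nab₂ s (Glue.right (f y))) =
        TensorProduct.map LinearMap.id (ft y).toLinearMap (nab₁ (resOne s) y) ∧
      TensorProduct.map (rhoTwo (f y)) (LinearMap.id (M := E₂ (f y)))
        (glueConn ft nab₁ nab₂ s (Glue.right (f y))) = nab₂ (resTwo s) (f y) := by
  have hs₁ : IsSmoothSec E₁ (resOne s) := by
    have := (isBundleChart_fibOne hf hft).isSmoothSec (Glue.inOne_smooth Y f) hs
    rwa [show pullSec _ s = resOne s from funext fun x => resOne_eq s rfl] at this
  have hs₂ : IsSmoothSec E₂ (resTwo s) :=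
    (isBundleChart_fibTwo hft).isSmoothSec (Glue.inTwo_smooth Y f) hs
  obtain ⟨T, hT⟩ := TensorProduct.map_surjective (rhoTwo_bijective hc₂ (f y)).surjective
    (g' := (LinearMap.id : E₂ (f y) →ₗ[ℝ] E₂ (f y))) Function.surjective_id
    (nab₂ (resTwo s) (f y))
  have hT' : TensorProduct.map (rhoOne (Glue.inOne_eq_right (rfl : f y = f y)))
      (LinearMap.id (M := E₂ (f y))) T =
      TensorProduct.map LinearMap.id (ft y).toLinearMap (nab₁ (resOne s) y) := by
    apply tensorMap_injective (hinj y) (b := (LinearMap.id : E₂ (f y) →ₗ[ℝ] E₂ (f y)))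
      fun _ _ h => h
    have := hnab _ _ hs₁ hs₂ (secCompatible_res s) y
    rw [← hT] at this
    simp only [TensorProduct.map_map, LinearMap.comp_id, LinearMap.id_comp,
      pullF_comp_rhoTwo] at this ⊢
    exact this.symm
  have hex : ∃ T, LinearMap.rTensor (E₂ (f y))
      ((rhoOne (Glue.inOne_eq_right (rfl : f y = f y))).prod (rhoTwo (f y))) T =
      TensorProduct.map (LinearMap.inl ℝ (Lam X₁ y) (Lam X₂ (f y))) (ftTo ft rfl)
          (nab₁ (resOne s) y) +
        TensorProduct.map (LinearMap.inr ℝ (Lam X₁ y) (Lam X₂ (f y))) LinearMap.id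
          (nab₂ (resTwo s) (f y)) := by
    refine ⟨T, ?_⟩
    have e1 : TensorProduct.map (LinearMap.inl ℝ (Lam X₁ y) (Lam X₂ (f y))) (ftTo ft rfl)
        (nab₁ (resOne s) y) = TensorProduct.map (LinearMap.inl ℝ (Lam X₁ y) (Lam X₂ (f y)))
          LinearMap.id (TensorProduct.map LinearMap.id (ft y).toLinearMap (nab₁ (resOne s) y)) := by
      rw [TensorProduct.map_map]
      rfl
    rw [e1, ← hT', ← hT]
    simp only [TensorProduct.map_map, LinearMap.comp_id]
    rw [← LinearMap.add_apply, ← TensorProduct.map_add_left]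
    rw [LinearMap.rTensor_def]
    congr 2
    ext α <;> simp
  have key := Function.invFun_eq hex
  have e := glueConn_right (nab₁ := nab₁) (nab₂ := nab₂) hf.injective (rfl : f y = f y) s
  -- the two components of the tensor in `(Λ¹(X₁) ⊕ Λ¹(X₂)) ⊗ E₂`
  have p₁ := congrArg (TensorProduct.map (LinearMap.fst ℝ _ _) LinearMap.id) key
  have p₂ := congrArg (TensorProduct.map (LinearMap.snd ℝ _ _) LinearMap.id) key
  rw [LinearMap.rTensor_def, TensorProduct.map_map, map_add, TensorProduct.map_map,
    TensorProduct.map_map] at p₁ p₂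
  simp only [LinearMap.fst_prod, LinearMap.snd_prod, LinearMap.fst_comp_inl,
    LinearMap.fst_comp_inr, LinearMap.snd_comp_inl, LinearMap.snd_comp_inr, LinearMap.id_comp,
    TensorProduct.map_zero_left, LinearMap.zero_apply, add_zero, zero_add, TensorProduct.map_id,
    LinearMap.id_apply] at p₁ p₂
  exact ⟨(congrArg _ e).trans p₁, (congrArg _ e).trans p₂⟩

theorem map_glueConn_inOne (hf : IsGluingDiffeo f) (hft : IsBundleDiffeo ft)
    (hc₁ : IsFormChart (Glue.inOne Y f)) (hc₂ : IsFormChart (Glue.inTwo Y f))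
    (hinj : ∀ y : Y, Function.Injective (resY y))
    (hnab : ConnCompatible ft hf.smooth nab₁ nab₂) {s : ∀ z, GlueFib ft z}
    (hs : IsSmoothSec (GlueFib ft) s) {x : X₁} {z : Glue Y f} (h : Glue.inOne Y f x = z) :
    TensorProduct.map (rhoOne h) (fibOne ft h).toLinearMap (glueConn ft nab₁ nab₂ s z) =
      nab₁ (resOne s) x := by
  rcases z with ⟨x', hx'⟩ | x'
  · obtain rfl := Glue.inOne_eq_left_iff.1 h
    rw [fibOne_left]
    exact Function.invFun_eq (LinearMap.rTensor_surjective _ (rhoOne_bijective hc₁ h).surjective _)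
  · obtain ⟨hx, rfl⟩ := Glue.inOne_eq_right_iff.1 h
    rw [fibOne_right ft (y := ⟨x, hx⟩) h]
    have key : ∀ G : Lam (Glue Y f) (Glue.right (f ⟨x, hx⟩)) ⊗[ℝ] E₂ (f ⟨x, hx⟩),
        TensorProduct.map (rhoOne h) LinearMap.id G =
          TensorProduct.map LinearMap.id (ft ⟨x, hx⟩).toLinearMap (nab₁ (resOne s) x) →
        TensorProduct.map (rhoOne h) (ft ⟨x, hx⟩).symm.toLinearMap G = nab₁ (resOne s) x := by
      intro G hG
      have := congrArg (TensorProduct.map LinearMap.id (ft ⟨x, hx⟩).symm.toLinearMap) hG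
      rw [TensorProduct.map_map, TensorProduct.map_map] at this
      simpa using this
    exact key _ (map_glueConn_right hf hft hc₂ hinj hnab hs ⟨x, hx⟩).1

theorem map_glueConn_inTwo (hf : IsGluingDiffeo f) (hft : IsBundleDiffeo ft)
    (hc₂ : IsFormChart (Glue.inTwo Y f)) (hinj : ∀ y : Y, Function.Injective (resY y))
    (hnab : ConnCompatible ft hf.smooth nab₁ nab₂) {s : ∀ z, GlueFib ft z}
    (hs : IsSmoothSec (GlueFib ft) s) (x : X₂) :
    TensorProduct.map (rhoTwo x) (LinearMap.id (M := E₂ x))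
      (glueConn ft nab₁ nab₂ s (Glue.right x)) = nab₂ (resTwo s) x := by
  by_cases hex : ∃ y : Y, f y = x
  · obtain ⟨y, rfl⟩ := hex
    exact (map_glueConn_right hf hft hc₂ hinj hnab hs y).2
  · have e : glueConn ft nab₁ nab₂ s (Glue.right x) = _ := dif_neg hex
    exact (congrArg _ e).trans <|
      Function.invFun_eq (LinearMap.rTensor_surjective _ (rhoTwo_bijective hc₂ x).surjective _)

end GluedData

section Main

variable {X₁ : Type u} {X₂ : Type v} [DiffeologicalSpace X₁] [DiffeologicalSpace X₂]
  {Y : Set X₁} {f : Y → X₂} {E₁ : X₁ → Type w} {E₂ : X₂ → Type w}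
  [∀ x, AddCommGroup (E₁ x)] [∀ x, Module ℝ (E₁ x)] [DiffeologicalSpace (Σ x, E₁ x)]
  [∀ x, AddCommGroup (E₂ x)] [∀ x, Module ℝ (E₂ x)] [DiffeologicalSpace (Σ x, E₂ x)]
  {ft : ∀ y : Y, E₁ y ≃ₗ[ℝ] E₂ (f y)}
  {gL₁ : ∀ x, Lam X₁ x →ₗ[ℝ] Lam X₁ x →ₗ[ℝ] ℝ} {gL₂ : ∀ x, Lam X₂ x →ₗ[ℝ] Lam X₂ x →ₗ[ℝ] ℝ}
  {nabL₁ : Op (Lam X₁)} {nabL₂ : Op (Lam X₂)}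
  {c₁ : ∀ x, Lam X₁ x →ₗ[ℝ] E₁ x →ₗ[ℝ] E₁ x} {c₂ : ∀ x, Lam X₂ x →ₗ[ℝ] E₂ x →ₗ[ℝ] E₂ x}
  {g₁ : ∀ x, E₁ x →ₗ[ℝ] E₁ x →ₗ[ℝ] ℝ} {g₂ : ∀ x, E₂ x →ₗ[ℝ] E₂ x →ₗ[ℝ] ℝ}
  {nab₁ : Op E₁} {nab₂ : Op E₂}

/-- Along `X₁`, the glued data correspond to the data over `X₁`, also over `Y`, where the
compatibility conditions are used. -/
theorem isDiracChart_inOne (hf : IsGluingDiffeo f) (hft : IsBundleDiffeo ft)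
    (hL₁ : IsFormChart (Glue.inOne Y f)) (hL₂ : IsFormChart (Glue.inTwo Y f))
    (hinj₁ : ∀ y : Y, Function.Injective (resY y))
    (hinj₂ : ∀ y, Function.Injective (pullF hf.smooth y))
    (hgL : LamMetricCompatible hf.smooth gL₁ gL₂)
    (hnabL : LamConnCompatible hf.smooth nabL₁ nabL₂)
    (hc : ActionCompatible ft c₁ c₂) (hg : MetricCompatible ft g₁ g₂)
    (hnab : ConnCompatible ft hf.smooth nab₁ nab₂) :
    IsDiracChart hL₁ (fun x => fibOne ft (rfl : Glue.inOne Y f x = _))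
      (glueLamMetric gL₁ gL₂) (glueLamConn nabL₁ nabL₂) (glueAction ft c₁ c₂)
      (glueMetric ft g₁ g₂) (glueConn ft nab₁ nab₂) gL₁ nabL₁ c₁ g₁ nab₁ where
  bundle := isBundleChart_fibOne hf hft
  metric_lam x α β := glueLamMetric_inOne hf hgL rfl α β
  conn_lam _ hs x := map_glueLamConn_inOne hf hL₁ hL₂ hinj₂ hnabL hs rfl
  action x α e := fibOne_glueAction hc rfl α e
  metric x e e' := glueMetric_inOne hg rfl e e'
  conn s hs x := by
    rw [show pullSec _ s = resOne s from funext fun x => resOne_eq s rfl]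
    exact map_glueConn_inOne hf hft hL₁ hL₂ hinj₁ hnab hs rfl

theorem isDiracChart_inTwo (hf : IsGluingDiffeo f) (hft : IsBundleDiffeo ft)
    (hL₁ : IsFormChart (Glue.inOne Y f)) (hL₂ : IsFormChart (Glue.inTwo Y f))
    (hinj₁ : ∀ y : Y, Function.Injective (resY y))
    (hinj₂ : ∀ y, Function.Injective (pullF hf.smooth y))
    (hgL : LamMetricCompatible hf.smooth gL₁ gL₂)
    (hnabL : LamConnCompatible hf.smooth nabL₁ nabL₂)
    (hnab : ConnCompatible ft hf.smooth nab₁ nab₂) :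
    IsDiracChart hL₂ (fibTwo ft)
      (glueLamMetric gL₁ gL₂) (glueLamConn nabL₁ nabL₂) (glueAction ft c₁ c₂)
      (glueMetric ft g₁ g₂) (glueConn ft nab₁ nab₂) gL₂ nabL₂ c₂ g₂ nab₂ where
  bundle := isBundleChart_fibTwo hft
  metric_lam x α β := glueLamMetric_inTwo hf hgL x α β
  conn_lam _ hs x := map_glueLamConn_inTwo hf hL₁ hL₂ hinj₂ hnabL hs x
  action _ _ _ := rfl
  metric _ _ _ := rfl
  conn _ hs x := map_glueConn_inTwo hf hft hL₂ hinj₁ hnab hs x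

end Main

end DiffDirac

end

theorem mainTheorem2 {X₁ : Type u} {X₂ : Type v}
    [DiffeologicalSpace X₁] [DiffeologicalSpace X₂]
    -- the gluing map of the bases
    (Y : Set X₁) (f : Y → X₂) (hf : IsGluingDiffeo f) (hΩ : SameFormDiffeology hf.smooth)
    -- the two pseudo-bundles and the gluing map of the total spaces
    {E₁ : X₁ → Type w} [∀ x, AddCommGroup (E₁ x)] [∀ x, Module ℝ (E₁ x)]
    [DiffeologicalSpace (Σ x, E₁ x)]
    {E₂ : X₂ → Type w} [∀ x, AddCommGroup (E₂ x)] [∀ x, Module ℝ (E₂ x)]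
    [DiffeologicalSpace (Σ x, E₂ x)]
    (ft : ∀ y : Y, E₁ y ≃ₗ[ℝ] E₂ (f y)) (hft : IsBundleDiffeo ft)
    -- the data of the two Dirac operators
    (gL₁ : ∀ x, Lam X₁ x →ₗ[ℝ] Lam X₁ x →ₗ[ℝ] ℝ) (gL₂ : ∀ x, Lam X₂ x →ₗ[ℝ] Lam X₂ x →ₗ[ℝ] ℝ)
    (nabL₁ : Op (Lam X₁)) (nabL₂ : Op (Lam X₂))
    (c₁ : ∀ x, Lam X₁ x →ₗ[ℝ] E₁ x →ₗ[ℝ] E₁ x) (c₂ : ∀ x, Lam X₂ x →ₗ[ℝ] E₂ x →ₗ[ℝ] E₂ x)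
    (g₁ : ∀ x, E₁ x →ₗ[ℝ] E₁ x →ₗ[ℝ] ℝ) (g₂ : ∀ x, E₂ x →ₗ[ℝ] E₂ x →ₗ[ℝ] ℝ)
    (nab₁ : Op E₁) (nab₂ : Op E₂)
    (h₁ : IsDiracData E₁ gL₁ nabL₁ c₁ g₁ nab₁) (h₂ : IsDiracData E₂ gL₂ nabL₂ c₂ g₂ nab₂)
    -- compatibility of all the data
    (hgL : LamMetricCompatible hf.smooth gL₁ gL₂)
    (hnabL : LamConnCompatible hf.smooth nabL₁ nabL₂)
    (hc : ActionCompatible ft c₁ c₂) (hg : MetricCompatible ft g₁ g₂)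
    (hnab : ConnCompatible ft hf.smooth nab₁ nab₂) :
    -- the glued data are the data of a Dirac operator, with a unitary action if the two given
    -- actions are unitary
    IsDiracData (GlueFib ft) (glueLamMetric gL₁ gL₂) (glueLamConn nabL₁ nabL₂)
        (glueAction ft c₁ c₂) (glueMetric ft g₁ g₂) (glueConn ft nab₁ nab₂) ∧
    (IsUnitaryAction E₁ gL₁ c₁ g₁ → IsUnitaryAction E₂ gL₂ c₂ g₂ →
      IsUnitaryAction (GlueFib ft) (glueLamMetric gL₁ gL₂) (glueAction ft c₁ c₂)
        (glueMetric ft g₁ g₂)) ∧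
    -- the glued Dirac operator acts piecewise
    (∀ s₁ s₂, IsSmoothSec E₁ s₁ → IsSmoothSec E₂ s₂ → SecCompatible ft s₁ s₂ →
      IsSmoothSec (GlueFib ft) (glueSec ft s₁ s₂) ∧
      IsSmoothSec E₁ (diracOp c₁ nab₁ s₁) ∧ IsSmoothSec E₂ (diracOp c₂ nab₂ s₂) ∧
      SecCompatible ft (diracOp c₁ nab₁ s₁) (diracOp c₂ nab₂ s₂) ∧
      diracOp (glueAction ft c₁ c₂) (glueConn ft nab₁ nab₂) (glueSec ft s₁ s₂) =
        glueSec ft (diracOp c₁ nab₁ s₁) (diracOp c₂ nab₂ s₂)) ∧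
    -- every smooth section of the glued pseudo-bundle is the gluing of two compatible sections
    (∀ s, IsSmoothSec (GlueFib ft) s →
      IsSmoothSec E₁ (resOne s) ∧ IsSmoothSec E₂ (resTwo s) ∧
      SecCompatible ft (resOne s) (resTwo s) ∧ glueSec ft (resOne s) (resTwo s) = s) := by
  have hk₁ : ∀ x, LinearMap.ker (gL₁ x) = ⊥ := fun x =>
    have := h₁.finite_lam x
    h₁.metric_lam.ker_lam x
  have hk₂ : ∀ x, LinearMap.ker (gL₂ x) = ⊥ := fun x =>
    have := h₂.finite_lam x
    h₂.metric_lam.ker_lam x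
  have hinj₁ := resY_injective hΩ hgL hk₁
  have hinj₂ := pullF_injective hΩ hgL hk₂
  have hL₁ := Glue.isFormChart_inOne hf hΩ hinj₂
  have hL₂ := Glue.isFormChart_inTwo hf hΩ hinj₁
  have H₁ := isDiracChart_inOne hf hft hL₁ hL₂ hinj₁ hinj₂ hgL hnabL hc hg hnab
  have H₂ := isDiracChart_inTwo (c₁ := c₁) (c₂ := c₂) (g₁ := g₁) (g₂ := g₂) hf hft hL₁ hL₂ hinj₁
    hinj₂ hgL hnabL hnab
  have hE : IsPseudoBundle (GlueFib ft) :=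
    isPseudoBundle_of_cover Glue.isCover H₁.bundle H₂.bundle
      (GlueFib.dSmooth_fst h₁.bundle.proj h₂.bundle.proj) h₁.bundle h₂.bundle
  refine ⟨isDiracData_of_cover Glue.isCover H₁ H₂ hE h₁ h₂,
    isUnitaryAction_of_cover Glue.isCover H₁ H₂, fun s₁ s₂ hs₁ hs₂ hs => ?_, fun s hs => ?_⟩
  · have hsm := isSmoothSec_glueSec hs hs₁ hs₂
    have e₁ : resOne (diracOp (glueAction ft c₁ c₂) (glueConn ft nab₁ nab₂) (glueSec ft s₁ s₂)) =
        diracOp c₁ nab₁ s₁ := funext fun x => by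
      rw [← resOne_eq _ (rfl : Glue.inOne Y f x = _)]
      refine (H₁.diracOp hsm x).trans ?_
      rw [show pullSec _ (glueSec ft s₁ s₂) = s₁ from
        (funext fun x => resOne_eq _ rfl).trans (resOne_glueSec hs)]
    have e₂ : resTwo (diracOp (glueAction ft c₁ c₂) (glueConn ft nab₁ nab₂) (glueSec ft s₁ s₂)) =
        diracOp c₂ nab₂ s₂ := funext (H₂.diracOp hsm)
    refine ⟨hsm, isSmoothSec_diracOp h₁.bundle h₁.action.isSmoothAction h₁.conn hs₁,
      isSmoothSec_diracOp h₂.bundle h₂.action.isSmoothAction h₂.conn hs₂, ?_, ?_⟩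
    · rw [← e₁, ← e₂]
      exact secCompatible_res _
    · rw [← e₁, ← e₂, glueSec_res]
  · refine ⟨?_, H₂.bundle.isSmoothSec hL₂.smooth hs, secCompatible_res s, glueSec_res s⟩
    have := H₁.bundle.isSmoothSec hL₁.smooth hs
    rwa [show pullSec _ s = resOne s from funext fun x => resOne_eq s rfl] at this
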